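/- Let $\Delta\subset\mathbb R^2$ be a reflexive polygon, i.e. a lattice polygon whose dual $\Delta^\circ=\{u : u\cdot v\ge -1\ \forall v\in\Delta\}$ is again a lattice polygon (up to $GL(2,\mathbb Z)$ there are 16). Let $\sigma\subset\mathbb R^3$ be the cone over $\Delta\times\{1\}$, let $S=\sigma^\vee\cap\mathbb Z^3$, let $\mathcal X=\mathrm{Spec}\,\mathbb C[S]$ be the toric Calabi–Yau 3-fold of $\Delta$, with Sasaki–Einstein base $Y$, let $x_1,\dots,x_k$ be the generators of $\mathbb C[S]$ given by the minimal generators $m_1,\dots,m_k$ of $S$, and let $I\subset\mathbb C[x_1,\dots,x_k]$ be the ideal of relations between them. Volumes. A Reeb vector is a $b\in\mathrm{int}(\sigma)$ with $b_3=2$. It grades $\mathbb C[S]$ by $\deg x_h=\langle m_h,b\rangle$. Let $g(e^{-sb};\mathcal X)$ be the Hilbert series at $t=e^{-s}$ and put $$V(b;Y)=\tfrac{8}{27}\lim_{s\to0^+}s^3g(e^{-sb};\mathcal X).$$ For a vertex $v_\alpha$ of $\Delta$ let $D_\alpha\subset\mathcal X$ be the corresponding toric divisor and $\Sigma_\alpha\subset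 Y$ the corresponding submanifold. Let $g(e^{-sb};D_\alpha)=\sum_m e^{-s\langle m,b\rangle}$, summed over $m\in\mathbb Z^3$ with $\langle m,(v_\alpha,1)\rangle\ge-1$ and $\langle m,(w,1)\rangle\ge0$ for all lattice points $w\ne v_\alpha$ of $\Delta$. The normalized volume of $\Sigma_\alpha$ at $b$ is $$V(b;\Sigma_\alpha)=\tfrac32\,V(b;Y)\lim_{s\to0^+}\tfrac1s\left[\frac{g(e^{-sb};D_\alpha)}{g(e^{-sb};\mathcal X)}-1\right].$$ Futaki invariants. Let $q=(q_1,\dots,q_k)$ be the weights of the $x_j$ under a grading $\zeta$ with Hilbert series $g(t=e^{-s};\mathcal X,\zeta)=\frac{2A_0(\zeta)}{s^3}+\frac{A_1(\zeta)}{s^2}+O(1/s)$. Let $\eta_h$ be the test symmetry giving weight $1$ to $x_h$ and $0$ to the other generators, let $I_0$ be the ideal generated by the lowest $\eta_h$-weight parts of the elements of $I$, and let $A_i(\zeta+\epsilon\eta_h)$ be the coefficients obtained in the same way from the Hilbert series of $\mathbb C[x_1,\dots,x_k]/I_0$ with weights $q+\epsilon\eta_h$. Then $$F(\mathcal X;\zeta,\eta_h)=\left.\frac{A_0(\zeta)}{2}\frac{d}{d\epsilon}\left[\frac{A_1(\zeta+\epsilon\eta_h)}{A_0(\zeta+\epsilon\eta_h)}\right]+\frac{A_1(\zeta)}{6A_0(\zeta)}\frac{d}{d\epsilon}A_0(\zeta+\epsilon\eta_h)\right|_{\epsilon=0}.$$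 Proposition. There is exactly one Reeb vector $b^*$ minimizing $V(b;Y)$ (with $V(b;Y)$ defined for every Reeb vector $b$). Let $\zeta_R$ be the grading given by $b^*$ (the $U(1)_R$ symmetry). Then $F(\mathcal X;\zeta_R,\eta_h)$ and $V(b^*;\Sigma_\alpha)$ are well defined for every generator $x_h$ and every vertex $v_\alpha$, and $$F(\mathcal X;\zeta_R,\eta_h)\ \ge\ \tfrac{27}{64}\,V(b^*;\Sigma_\alpha)\qquad\text{for all }h,\alpha .$$ In particular $$F(\mathcal X;\zeta_R,\eta_h)\ge\tfrac{27}{64}\max_\alpha V(b^*;\Sigma_\alpha),\qquad F(\mathcal X;\zeta_R,\eta_h)\ge\tfrac{27}{64}\min_\alpha V(b^*;\Sigma_\alpha)$$ for all $h$. If $\Delta$ is $GL(2,\mathbb Z)$-equivalent to the triangle with vertices $(0,1),(2,-1),(-2,-1)$ (Model 2, $\mathbb C^3/\mathbb Z_4\times\mathbb Z_2$ $(1,0,3)(0,1,1)$), or $(1,0),(0,1),(-3,-2)$ (Model 7, $\mathbb C^3/\mathbb Z_6$ $(1,2,3)$), or $(0,1),(1,-1),(-1,-1)$ (Model 13, $\mathbb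 C^3/\mathbb Z_4$ $(1,1,2)$), then some generator $x_h$ attains equality in both of these bounds. -/

import Mathlib

open Filter Topology Asymptotics

noncomputable section

namespace ToricCY

/-! ### Reflexive polygons -/

/-- The real point underlying a lattice point. -/
def toReal {n : ℕ} (v : Fin n → ℤ) : Fin n → ℝ := fun i => (v i : ℝ)

/-- A lattice polytope: the convex hull of finitely many lattice points. -/
def IsLatticePolytope {n : ℕ} (P : Set (Fin n → ℝ)) : Prop :=
  ∃ V : Finset (Fin n → ℤ), P = convexHull ℝ (toReal '' (V : Set (Fin n → ℤ)))

/-- The dual `Δ° = {u | u · v ≥ -1 for all v ∈ Δ}`. -/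
def dualPolytope {n : ℕ} (P : Set (Fin n → ℝ)) : Set (Fin n → ℝ) :=
  {u | ∀ v ∈ P, -1 ≤ ∑ i, u i * v i}

/-- A reflexive polygon: a lattice polygon whose dual is again a lattice polygon.  (The dual being
bounded forces the origin to be an interior point.) -/
def IsReflexivePolygon (Δ : Set (Fin 2 → ℝ)) : Prop :=
  IsLatticePolytope Δ ∧ IsLatticePolytope (dualPolytope Δ)

/-- The triangle with the three given lattice vertices. -/
def triangle (u v w : Fin 2 → ℤ) : Set (Fin 2 → ℝ) :=
  convexHull ℝ {toReal u, toReal v, toReal w}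

/-- `GL(2,ℤ)`-equivalence of polygons. -/
def LatticeEquivalent (Δ Δ' : Set (Fin 2 → ℝ)) : Prop :=
  ∃ A : Matrix.GeneralLinearGroup (Fin 2) ℤ,
    Δ' = (fun x : Fin 2 → ℝ => fun i => ∑ j, ((A : Matrix (Fin 2) (Fin 2) ℤ) i j : ℝ) * x j) '' Δ

/-- Toric diagram of `ℂ³/ℤ₄×ℤ₂ (1,0,3)(0,1,1)`. -/
def model2 : Set (Fin 2 → ℝ) := triangle ![0, 1] ![2, -1] ![-2, -1]

/-- Toric diagram of `ℂ³/ℤ₆ (1,2,3)`. -/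
def model7 : Set (Fin 2 → ℝ) := triangle ![1, 0] ![0, 1] ![-3, -2]

/-- Toric diagram of `ℂ³/ℤ₄ (1,1,2)`. -/
def model13 : Set (Fin 2 → ℝ) := triangle ![0, 1] ![1, -1] ![-1, -1]

/-! ### The toric Calabi-Yau 3-fold of a polygon -/

/-- `u ↦ (u, 1)`. -/
def lift (u : Fin 2 → ℝ) : Fin 3 → ℝ := ![u 0, u 1, 1]

/-- The pairing of a lattice vector with a real vector. -/
def pairing (m : Fin 3 → ℤ) (x : Fin 3 → ℝ) : ℝ := ∑ i, (m i : ℝ) * x i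

/-- The cone `σ` over `Δ × {1}` (for a convex nonempty `Δ`, the cone generated by the vectors
`(u, 1)`). -/
def cone (Δ : Set (Fin 2 → ℝ)) : Set (Fin 3 → ℝ) :=
  {x | ∃ c : ℝ, 0 ≤ c ∧ ∃ u ∈ Δ, x = c • lift u}

/-- The monoid `σ^∨ ∩ ℤ³` of lattice points of the dual cone. -/
def dualMonoid (Δ : Set (Fin 2 → ℝ)) : AddSubmonoid (Fin 3 → ℤ) where
  carrier := {m | ∀ x ∈ cone Δ, 0 ≤ pairing m x}
  zero_mem' := by intro x _; simp [pairing]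
  add_mem' := by
    intro a b ha hb x hx
    have h : pairing (a + b) x = pairing a x + pairing b x := by
      simp [pairing, add_mul, Finset.sum_add_distrib]
    rw [h]
    exact add_nonneg (ha x hx) (hb x hx)

/-- The minimal generators of `σ^∨ ∩ ℤ³`, i.e. the generators `x_h` of the coordinate ring
`ℂ[σ^∨ ∩ ℤ³]`. -/
def generators (Δ : Set (Fin 2 → ℝ)) : Set (dualMonoid Δ) :=
  {m | m ≠ 0 ∧ ∀ a b : dualMonoid Δ, m = a + b → a = 0 ∨ b = 0}

/-- The ideal of relations between the generators: the kernel of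
`ℂ[x_1, …, x_k] → ℂ[σ^∨ ∩ ℤ³]`. -/
def toricIdeal (Δ : Set (Fin 2 → ℝ)) : Ideal (MvPolynomial (generators Δ) ℂ) :=
  RingHom.ker (MvPolynomial.aeval (R := ℂ)
    (fun h : generators Δ => (AddMonoidAlgebra.single h.1 1 : AddMonoidAlgebra ℂ (dualMonoid Δ))))

/-- The vertices of `Δ`; they index the extremal GLSM fields `p_α` and the toric divisors `D_α`. -/
def vertices (Δ : Set (Fin 2 → ℝ)) : Set (Fin 2 → ℤ) :=
  {v | toReal v ∈ Set.extremePoints ℝ Δ}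

/-! ### Hilbert series, Laurent coefficients, Futaki invariants -/

/-- The Hilbert series at `t = exp (-s)` of `ℂ[x]/I`, where `x_i` has weight `w i ∈ ℝ`: the sum over
all weights `r` of `dim (ℂ[x]/I)_r * t ^ r`. -/
def hilbertSeries {ι : Type*} (I : Ideal (MvPolynomial ι ℂ)) (w : ι → ℝ) (s : ℝ) : ℝ :=
  ∑' r : ℝ, (Module.finrank ℂ
      ((MvPolynomial.weightedHomogeneousSubmodule ℂ w r).map
        (Ideal.Quotient.mkₐ ℂ I).toLinearMap) : ℝ) * Real.exp (-(s * r))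

/-- `A₀` and `A₁` are the first two coefficients of the expansion
`g(s) = 2! A₀ / s³ + 1! A₁ / s² + O(1/s)` as `s → 0⁺`. -/
def HasLaurentCoeffs (g : ℝ → ℝ) (A₀ A₁ : ℝ) : Prop :=
  (fun s => g s - (2 * A₀ / s ^ 3 + A₁ / s ^ 2)) =O[𝓝[>] (0 : ℝ)] (fun s => 1 / s)

/-- The ideal `I₀` of the central fibre of the test configuration given by weights `η`: it is
generated by the lowest `η`-weight parts of the elements of `I`. -/
def initialIdeal {ι : Type*} (I : Ideal (MvPolynomial ι ℂ)) (η : ι → ℕ) :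
    Ideal (MvPolynomial ι ℂ) :=
  Ideal.span {p | ∃ f ∈ I, ∃ k : ℕ,
    (∀ j < k, MvPolynomial.weightedHomogeneousComponent η j f = 0) ∧
      p = MvPolynomial.weightedHomogeneousComponent η k f}

/-- `F` is the Futaki invariant (in dimension `n = 3`) of `ℂ[x]/I`, polarised by the weights `q`,
for the test symmetry `η`:
`F = A₀(ζ)/(n-1) · D_ε [A₁(ζ+εη)/A₀(ζ+εη)] + A₁(ζ)/(n(n-1)A₀(ζ)) · D_ε A₀(ζ+εη)` at `ε = 0`,
where `A_i(ζ+εη)` come from the Hilbert series of the central fibre. -/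
def HasFutaki {ι : Type*} (I : Ideal (MvPolynomial ι ℂ)) (q : ι → ℝ) (η : ι → ℕ) (F : ℝ) : Prop :=
  ∃ (a₀ a₁ : ℝ) (A₀ A₁ : ℝ → ℝ) (d₀ d₁ : ℝ),
    HasLaurentCoeffs (hilbertSeries I q) a₀ a₁ ∧
    (∀ᶠ ε in 𝓝 (0 : ℝ),
      HasLaurentCoeffs (hilbertSeries (initialIdeal I η) (fun i => q i + ε * (η i : ℝ)))
        (A₀ ε) (A₁ ε)) ∧
    a₀ ≠ 0 ∧
    HasDerivAt (fun ε => A₁ ε / A₀ ε) d₁ 0 ∧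
    HasDerivAt A₀ d₀ 0 ∧
    F = a₀ / 2 * d₁ + a₁ / (6 * a₀) * d₀

/-- The weights of the generators under the Reeb vector `b`. -/
def reebWeights (Δ : Set (Fin 2 → ℝ)) (b : Fin 3 → ℝ) : generators Δ → ℝ :=
  fun h => pairing (h.1 : Fin 3 → ℤ) b

open Classical in
/-- The test symmetry `η_h`: weight `1` on `x_h` and weight `0` on all other generators. -/
def testSymmetry (Δ : Set (Fin 2 → ℝ)) (h : generators Δ) : generators Δ → ℕ := Pi.single h 1

/-! ### Volumes -/

/-- The Reeb vectors `b = ∑ b_α (v_α, 1)` in the interior of `σ`, normalised by `∑ b_α = 2`. -/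
def reebVectors (Δ : Set (Fin 2 → ℝ)) : Set (Fin 3 → ℝ) := {b | b ∈ interior (cone Δ) ∧ b 2 = 2}

/-- `V(b; Y) = (8/27) lim_{s → 0} s³ g(exp (-s b); 𝒳)`. -/
def HasVolume (Δ : Set (Fin 2 → ℝ)) (b : Fin 3 → ℝ) (V : ℝ) : Prop :=
  Tendsto (fun s => 8 / 27 * (s ^ 3 * hilbertSeries (toricIdeal Δ) (reebWeights Δ b) s))
    (𝓝[>] 0) (𝓝 V)

/-- `b` minimises the volume function over all normalised Reeb vectors; in particular the volume is
defined at each of them. -/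
def IsVolumeMinimizing (Δ : Set (Fin 2 → ℝ)) (b : Fin 3 → ℝ) : Prop :=
  b ∈ reebVectors Δ ∧ ∃ V, HasVolume Δ b V ∧ ∀ b' ∈ reebVectors Δ, ∃ V', HasVolume Δ b' V' ∧ V ≤ V'

/-- The lattice points counted by the Hilbert series of the divisor `D_v`.  There is a GLSM field
`p_w` for every lattice point `w` of `Δ`; the Molien-Weyl integral with integrand
`(y_v z^{Q_v})⁻¹ / ∏_w (1 - y_w z^{Q_w})` selects the monomials in the `p_w` with the same gauge
charges as `p_v`, and their exponents are `⟨m, (w,1)⟩ + δ_{w,v} ≥ 0` for a lattice vector `m`. -/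
def divisorPoints (Δ : Set (Fin 2 → ℝ)) (v : Fin 2 → ℤ) : Set (Fin 3 → ℤ) :=
  {m | -1 ≤ pairing m (lift (toReal v)) ∧
    ∀ w : Fin 2 → ℤ, toReal w ∈ Δ → w ≠ v → 0 ≤ pairing m (lift (toReal w))}

/-- The Hilbert series `g(exp (-s b); D_v)` of the divisor `D_v`. -/
def divisorSeries (Δ : Set (Fin 2 → ℝ)) (v : Fin 2 → ℤ) (b : Fin 3 → ℝ) (s : ℝ) : ℝ :=
  ∑' m : divisorPoints Δ v, Real.exp (-(s * pairing (m : Fin 3 → ℤ) b))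

/-- The volume at `b` of the submanifold `Σ_v` of the base `Y` corresponding to `D_v`:
`V(b; Σ_v) = (3/2) V(b; Y) lim_{s → 0} (1/s) [g(exp (-s b); D_v) / g(exp (-s b); 𝒳) - 1]`. -/
def HasDivisorVolume (Δ : Set (Fin 2 → ℝ)) (b : Fin 3 → ℝ) (v : Fin 2 → ℤ) (W : ℝ) : Prop :=
  ∃ V L : ℝ, HasVolume Δ b V ∧
    Tendsto (fun s => 1 / s *
        (divisorSeries Δ v b s / hilbertSeries (toricIdeal Δ) (reebWeights Δ b) s - 1))
      (𝓝[>] 0) (𝓝 L) ∧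
    W = 3 / 2 * V * L

end ToricCY

end

open ToricCY

namespace ToricCY

/-! The boundary lattice points `u j` of the dual polygon, in cyclic order, form a `LatticeCycle`:
neighbours are a basis of ℤ², and each step lies on an edge whose normal `v j` is a lattice point of
Δ (`IsReflexivePolygon.exists_cycle`). The half-open cones on neighbours tile the punctured plane,
so each element of S is uniquely zero or a boundary point of σ^∨, plus a multiple of (0,0,1). With
w_j = ⟨(u_j,1), b⟩ the Hilbert series is explicit, and 2A₀ = A₁ = a for a = ½ Σ 1/(w_j w_{j+1})
(`hasJet_cycleSeries`). Hence V(b;Y) = 8a/27.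

The central fibre of η_h still has a basis indexed by S, where m has as η_h-weight the highest power
of x_h in a monomial over m (`hilbertSeries_initialIdeal`). That power grows by exactly one when m_h
is added, so only the geometric factor of x_h changes, and F = a/4 - a/(6⟨m_h,b⟩) (`hasFutaki`). The
additional lattice points of D_α are, up to lower order, those of the facet normal to v_α shifted by
-(0,0,1); so V(b;Σ_α) = 4c/9, where c sums 1/(w_j w_{j+1}) over the j with v_j = v_α
(`hasDivisorVolume`). The inequality therefore follows from ⟨m_h,b*⟩ ≥ 4/3 and c ≤ 2a/3, since then
F ≥ a/8 ≥ 3c/16.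

Both bounds are plane geometry of the polygon P with vertices u_j/w_j, the projected section ⟨m,b⟩ =
1 of σ^∨, whose area is a. The function a is strictly convex in b and blows up at the boundary, so
it has one minimizer, and criticality puts the centroid of P at the origin (`critical_of_min`). For
a lattice point v of Δ, the function ⟨m,(v,1)⟩/⟨m,b⟩ is affine on P with value 1/2 at the origin, so
its mean is 1/2. Over a fan of triangles with apex m, the mean is at least a third of the value at
m; that value is thus at most 3/2 (`height_le`), and for a suitable v the numerator is at least 2
(`four_thirds_le`). A triangle from the centroid to an edge takes at most a third of the area, which
is c ≤ 2a/3 (`facetVol_le`).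

If Δ is a triangle, the three values of c sum to 2a, so all equal 2a/3. In the three models a
generator takes the values 2, 0, 0 on the vertices, and its weight is then 4/3
(`equality_of_triangle`). -/

/-- The determinant of two planar lattice vectors. -/
def det2 (u w : Fin 2 → ℤ) : ℤ := u 0 * w 1 - u 1 * w 0

/-- The dot product of two planar lattice vectors. -/
def dot2 (u v : Fin 2 → ℤ) : ℤ := u 0 * v 0 + u 1 * v 1

lemma fin2_ext {α : Type*} {u v : Fin 2 → α} (h0 : u 0 = v 0) (h1 : u 1 = v 1) : u = v := by
  ext i; fin_cases i <;> assumption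

/-! ### Lattice cycles and the unimodular cones they span. -/

/-- A closed lattice path around the origin with consecutive determinants one, whose edge normals
`v j` support it: the boundary lattice points of the dual of a reflexive polygon. -/
structure LatticeCycle where
  n : ℕ
  n_pos : 0 < n
  u : ℕ → Fin 2 → ℤ
  v : ℕ → Fin 2 → ℤ
  periodic : ∀ j, u (j + n) = u j
  inj : ∀ i j, i < n → j < n → u i = u j → i = j
  det_eq : ∀ j, det2 (u j) (u (j + 1)) = 1
  dot_left : ∀ j, dot2 (u j) (v j) = -1
  dot_right : ∀ j, dot2 (u (j + 1)) (v j) = -1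
  dot_ge : ∀ i j, -1 ≤ dot2 (u i) (v j)

namespace LatticeCycle

/-- The polygon cut out by the vectors of a lattice cycle. -/
def polygon (C : LatticeCycle) : Set (Fin 2 → ℝ) :=
  {x | ∀ j, -1 ≤ (C.u j 0 : ℝ) * x 0 + (C.u j 1 : ℝ) * x 1}

lemma periodic_mul (C : LatticeCycle) (j k : ℕ) : C.u (j + k * C.n) = C.u j := by
  induction k with
  | zero => simp
  | succ k ih => rw [Nat.succ_mul, ← add_assoc, C.periodic, ih]

lemma u_mod (C : LatticeCycle) (j : ℕ) : C.u (j % C.n) = C.u j := by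
  conv_rhs => rw [← Nat.mod_add_div j C.n, mul_comm]
  rw [C.periodic_mul]

lemma eq_of_dot {u w v v' : Fin 2 → ℤ} (h : det2 u w = 1) (h1 : dot2 u v = dot2 u v')
    (h2 : dot2 w v = dot2 w v') : v = v' := by
  unfold det2 at h; unfold dot2 at h1 h2
  apply fin2_ext
  · linear_combination (v' 0 - v 0) * h + w 1 * h1 - u 1 * h2
  · linear_combination (v' 1 - v 1) * h - w 0 * h1 + u 0 * h2

lemma v_eq (C : LatticeCycle) (j : ℕ) :
    C.v j = ![C.u j 1 - C.u (j + 1) 1, C.u (j + 1) 0 - C.u j 0] := by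
  have h := C.det_eq j
  apply eq_of_dot h
  · rw [C.dot_left]; simp only [det2, dot2] at *; simp; linarith
  · rw [C.dot_right]; simp only [det2, dot2] at *; simp; linarith

lemma v_periodic (C : LatticeCycle) (j : ℕ) : C.v (j + C.n) = C.v j := by
  rw [v_eq, v_eq, C.periodic, show j + C.n + 1 = j + 1 + C.n by ring, C.periodic]

/-- A closed path turning counterclockwise does not stay in a closed half plane. -/
lemma not_halfplane (C : LatticeCycle) (p : Fin 2 → ℤ) (hp : p ≠ 0)
    (h : ∀ j, 0 ≤ det2 (C.u j) p) : False := by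
  have hpos : 0 < p 0 * p 0 + p 1 * p 1 := by
    rcases lt_or_eq_of_le (add_nonneg (mul_self_nonneg (p 0)) (mul_self_nonneg (p 1))) with h | h
    · exact h
    · exfalso; apply hp; apply fin2_ext <;> simp <;> nlinarith
  -- The quotient `dot2 (u j) p / det2 (u j) p` is a cotangent of the angle from `u j` to `p`. This
  -- is the numerator of its increment, whereas over one period the increments telescope to zero.
  have key : ∀ j, 0 < dot2 (C.u (j + 1)) p * det2 (C.u j) p
      - dot2 (C.u j) p * det2 (C.u (j + 1)) p := by
    intro j
    have h1 := C.det_eq j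
    have : dot2 (C.u (j + 1)) p * det2 (C.u j) p - dot2 (C.u j) p * det2 (C.u (j + 1)) p
        = -1 * (-(p 0 * p 0 + p 1 * p 1) * det2 (C.u j) (C.u (j + 1))) := by
      simp only [det2, dot2]; ring
    rw [this, h1]; linarith
  -- If the determinant vanished at `j`, `key` at `j` and at its cyclic predecessor would demand
  -- opposite signs of `dot2 (u j) p`.
  have hstrict : ∀ j, 0 < det2 (C.u j) p := by
    intro j
    rcases lt_or_eq_of_le (h j) with h0 | h0
    · exact h0
    · exfalso
      have h1 := key j
      have h2 := key (j + (C.n - 1))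
      rw [show j + (C.n - 1) + 1 = j + C.n by have := C.n_pos; omega, C.periodic] at h2
      rw [← h0] at h1 h2
      rcases le_total 0 (dot2 (C.u j) p) with hs | hs
      · linarith [mul_nonneg hs (h (j + 1))]
      · linarith [mul_nonneg (neg_nonneg.mpr hs) (h (j + (C.n - 1)))]
  have hsum : ∑ j ∈ Finset.range C.n, (((dot2 (C.u (j + 1)) p : ℝ) / det2 (C.u (j + 1)) p)
      - (dot2 (C.u j) p : ℝ) / det2 (C.u j) p) = 0 := by
    rw [Finset.sum_range_sub (fun j => (dot2 (C.u j) p : ℝ) / det2 (C.u j) p)]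
    have := C.periodic 0
    rw [zero_add] at this
    rw [this, sub_self]
  have hgt : 0 < ∑ j ∈ Finset.range C.n, (((dot2 (C.u (j + 1)) p : ℝ) / det2 (C.u (j + 1)) p)
      - (dot2 (C.u j) p : ℝ) / det2 (C.u j) p) := by
    apply Finset.sum_pos
    · intro j _
      have h1 : (0 : ℝ) < det2 (C.u j) p := by exact_mod_cast hstrict j
      have h2 : (0 : ℝ) < det2 (C.u (j + 1)) p := by exact_mod_cast hstrict (j + 1)
      have h3 : (0 : ℝ) < dot2 (C.u (j + 1)) p * det2 (C.u j) p
        - dot2 (C.u j) p * det2 (C.u (j + 1)) p := by exact_mod_cast key j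
      rw [div_sub_div _ _ h2.ne' h1.ne']
      apply div_pos _ (by positivity)
      linarith
    · exact ⟨0, by simpa using C.n_pos⟩
  linarith

/-- The half-open unimodular cones of a lattice cycle cover the punctured lattice. -/
lemma exists_cone (C : LatticeCycle) (p : Fin 2 → ℤ) (hp : p ≠ 0) :
    ∃ j < C.n, ∃ i k : ℕ, p = ((i : ℤ) + 1) • C.u j + (k : ℤ) • C.u (j + 1) := by
  -- Without a sign change, one nonnegative determinant propagates around the whole cycle,
  -- contradicting `not_halfplane`; having none contradicts it for `-p`.
  have main : ∃ j, 0 ≤ det2 (C.u j) p ∧ 0 < det2 p (C.u (j + 1)) := by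
    by_contra hcon
    push Not at hcon
    have h1 : ∃ j, 0 ≤ det2 (C.u j) p := by
      by_contra hneg
      push Not at hneg
      refine C.not_halfplane (-p) (neg_ne_zero.mpr hp) fun j => ?_
      have := hneg j
      simp only [det2, Pi.neg_apply] at *; linarith
    obtain ⟨j0, hj0⟩ := h1
    have h2 : ∀ k, 0 ≤ det2 (C.u (j0 + k)) p := by
      intro k
      induction k with
      | zero => exact hj0
      | succ k ih =>
        have := hcon _ ih
        simp only [det2, ← add_assoc] at *; linarith
    refine C.not_halfplane p hp fun j => ?_
    have h3 := h2 (j + j0 * (C.n - 1))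
    rwa [show j0 + (j + j0 * (C.n - 1)) = j + j0 * C.n by
      obtain ⟨m, hm⟩ : ∃ m, C.n = m + 1 := ⟨C.n - 1, by have := C.n_pos; omega⟩
      rw [hm]; simp; ring, C.periodic_mul] at h3
  obtain ⟨j, h1, h2⟩ := main
  -- Cramer's rule in the basis `u j`, `u (j + 1)`. The first coefficient is positive, being the
  -- half-open side, so it is stored minus one.
  refine ⟨j % C.n, Nat.mod_lt _ C.n_pos, (det2 p (C.u (j + 1)) - 1).toNat,
    (det2 (C.u j) p).toNat, ?_⟩
  have e : C.u (j % C.n + 1) = C.u (j + 1) := by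
    rw [← C.u_mod (j % C.n + 1), ← C.u_mod (j + 1)]; simp
  rw [Int.toNat_of_nonneg h1, Int.toNat_of_nonneg (by omega), C.u_mod, e]
  have h := C.det_eq j
  simp only [det2] at *
  apply fin2_ext <;> simp
  · linear_combination -p 0 * h
  · linear_combination -p 1 * h

lemma u_add_one (C : LatticeCycle) (j : ℕ) :
    C.u (j + 1) = ![C.u j 0 + C.v j 1, C.u j 1 - C.v j 0] := by
  rw [v_eq]; apply fin2_ext <;> simp

lemma eq_zero_of_mul_add_eq {N t k k' : ℤ} (h : N * t + k = k') (hk : 0 ≤ k) (hkN : k < N)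
    (hk' : 0 ≤ k') (hkN' : k' < N) : t = 0 := by
  apply le_antisymm
  · by_contra hc
    nlinarith
  · by_contra hc
    nlinarith

/-- A lattice point lies in one half-open cone only. -/
lemma cone_unique (C : LatticeCycle) {j j' i k i' k' : ℕ} (hj : j < C.n) (hj' : j' < C.n)
    (h : ((i : ℤ) + 1) • C.u j + (k : ℤ) • C.u (j + 1)
      = ((i' : ℤ) + 1) • C.u j' + (k' : ℤ) • C.u (j' + 1)) : j = j' ∧ i = i' ∧ k = k' := by
  have h0 := congrFun h 0
  have h1 := congrFun h 1
  simp only [Pi.add_apply, Pi.smul_apply, smul_eq_mul] at h0 h1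
  have dl := C.dot_left j
  have dr := C.dot_right j
  have dl' := C.dot_left j'
  have dr' := C.dot_right j'
  have g1 := C.dot_ge j' j
  have g2 := C.dot_ge (j' + 1) j
  have g3 := C.dot_ge j j'
  have g4 := C.dot_ge (j + 1) j'
  have det := C.det_eq j
  have det' := C.det_eq j'
  -- pairing with the two supporting normals
  have e1 : ((i : ℤ) + 1) + k + (((i' : ℤ) + 1) * dot2 (C.u j') (C.v j)
      + k' * dot2 (C.u (j' + 1)) (C.v j)) = 0 := by
    simp only [dot2] at *
    linear_combination ((i : ℤ) + 1) * dl + k * dr - C.v j 0 * h0 - C.v j 1 * h1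
  have e2 : ((i' : ℤ) + 1) + k' + (((i : ℤ) + 1) * dot2 (C.u j) (C.v j')
      + k * dot2 (C.u (j + 1)) (C.v j')) = 0 := by
    simp only [dot2] at *
    linear_combination ((i' : ℤ) + 1) * dl' + k' * dr' + C.v j' 0 * h0 + C.v j' 1 * h1
  -- The level `i + 1 + k` is minus the pairing with `v j`. By `dot_ge` it is at most the level of
  -- the other representation, and conversely; equality then forces every vector with a positive
  -- coefficient to pair to -1 with the other normal.
  have a1 : (i : ℤ) + k = i' + k' := by
    apply le_antisymm <;> nlinarith
  have b1 : dot2 (C.u j') (C.v j) = -1 := by nlinarith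
  have b2 : dot2 (C.u j) (C.v j') = -1 := by nlinarith
  have b3 : (k' : ℤ) * (dot2 (C.u (j' + 1)) (C.v j) + 1) = 0 := by rw [b1] at e1; linarith
  have b4 : (k : ℤ) * (dot2 (C.u (j + 1)) (C.v j') + 1) = 0 := by rw [b2] at e2; linarith
  have fin : C.u j = C.u j' → j = j' ∧ i = i' ∧ k = k' := by
    intro e
    have hjj := C.inj _ _ hj hj' e
    subst hjj
    simp only [det2] at det
    have : (k : ℤ) = k' := by
      linear_combination C.u j 0 * h1 - C.u j 1 * h0 + ((k' : ℤ) - k) * det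
    refine ⟨rfl, ?_, ?_⟩ <;> omega
  by_cases hk : (k : ℤ) = 0
  · by_cases hk' : (k' : ℤ) = 0
    · apply fin
      have hi : (i : ℤ) = i' := by omega
      rw [hk, hk', hi] at h0 h1
      have : (i' : ℤ) + 1 ≠ 0 := by positivity
      apply fin2_ext <;> apply mul_left_cancel₀ this <;> linarith
    · exfalso
      rw [hk] at h0 h1
      simp only [det2] at det'
      -- The point is `(i + 1) • u j`, so its determinant with `u j'`, which is `k'`, is divisible
      -- by `i + 1`. But equal levels give `i + 1 = i' + 1 + k' > k'`.
      have hd : (i : ℤ) + 1 ∣ k' := by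
        refine ⟨det2 (C.u j') (C.u j), ?_⟩
        simp only [det2]
        linear_combination (-(k' : ℤ)) * det' - C.u j' 0 * h1 + C.u j' 1 * h0
      have := Int.le_of_dvd (by omega) hd
      omega
  · by_cases hk' : (k' : ℤ) = 0
    · exfalso
      rw [hk'] at h0 h1
      simp only [det2] at det
      have hd : (i' : ℤ) + 1 ∣ k := by
        refine ⟨det2 (C.u j) (C.u j'), ?_⟩
        simp only [det2]
        linear_combination (-(k : ℤ)) * det + C.u j 0 * h1 - C.u j 1 * h0
      have := Int.le_of_dvd (by omega) hd
      omega
    · have b3' : dot2 (C.u (j' + 1)) (C.v j) = -1 := by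
        have := (mul_eq_zero.mp b3).resolve_left hk'; linarith
      -- Both cones stand on the same edge line. There positions at level `N` are `N t + k` and `k'`
      -- with remainders below `N`, so uniqueness of division gives `t = 0`.
      have hv : C.v j = C.v j' := eq_of_dot det' (by rw [b1, dl']) (by rw [b3', dr'])
      have s1 := C.u_add_one j
      have s2 := C.u_add_one j'
      rw [← hv] at s2
      rw [s1, s2] at h0 h1
      simp at h0 h1
      have det0 : C.u j 0 * C.v j 0 + C.u j 1 * C.v j 1 = -1 := dl
      have det0' : C.u j' 0 * C.v j 0 + C.u j' 1 * C.v j 1 = -1 := b1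
      obtain ⟨N, hN⟩ : ∃ N : ℤ, N = i + k + 1 := ⟨_, rfl⟩
      have hN' : N = i' + k' + 1 := by omega
      -- `u j - u j' = t (v 1, -v 0)`
      obtain ⟨t, ht⟩ : ∃ t : ℤ, t = det2 (C.u j') (C.u j) := ⟨_, rfl⟩
      have t0 : C.u j 0 = C.u j' 0 + t * C.v j 1 := by
        rw [ht]; simp only [det2]
        linear_combination C.u j 0 * det0' - C.u j' 0 * det0
      have t1 : C.u j 1 = C.u j' 1 - t * C.v j 0 := by
        rw [ht]; simp only [det2]
        linear_combination C.u j 1 * det0' - C.u j' 1 * det0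
      have ek : N * t + k = k' := by
        have f0 : (N * t + k - k') * C.v j 1 = 0 := by
          rw [t0, show (i : ℤ) = N - k - 1 by omega, show (i' : ℤ) = N - k' - 1 by omega] at h0
          linear_combination h0
        have f1 : (N * t + k - k') * C.v j 0 = 0 := by
          rw [t1, show (i : ℤ) = N - k - 1 by omega, show (i' : ℤ) = N - k' - 1 by omega] at h1
          linear_combination -h1
        linear_combination (N * t + k - k') * det0 - C.u j 0 * f1 - C.u j 1 * f0
      have t_zero : t = 0 := eq_zero_of_mul_add_eq ek (by omega) (by omega) (by omega) (by omega)
      apply fin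
      apply fin2_ext
      · rw [t0, t_zero]; ring
      · rw [t1, t_zero]; ring

end LatticeCycle

/-! ### The lattice cycle of a reflexive polygon -/

lemma convexHull_linear_le {s : Set (Fin 2 → ℝ)} {c : Fin 2 → ℝ} {r : ℝ}
    (h : ∀ u ∈ s, c 0 * u 0 + c 1 * u 1 ≤ r) {x : Fin 2 → ℝ} (hx : x ∈ convexHull ℝ s) :
    c 0 * x 0 + c 1 * x 1 ≤ r := by
  have hconv : Convex ℝ {x : Fin 2 → ℝ | c 0 * x 0 + c 1 * x 1 ≤ r} := by
    apply convex_halfSpace_le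
    constructor
    · intro x y; simp; ring
    · intro a x; simp; ring
  exact convexHull_min (t := {x : Fin 2 → ℝ | c 0 * x 0 + c 1 * x 1 ≤ r}) h hconv hx

section Reflexive

variable {Δ : Set (Fin 2 → ℝ)} {V U : Finset (Fin 2 → ℤ)}

lemma mem_dual_iff (hV : Δ = convexHull ℝ (toReal '' (V : Set (Fin 2 → ℤ)))) (c : Fin 2 → ℝ) :
    c ∈ dualPolytope Δ ↔ ∀ v ∈ V, -1 ≤ c 0 * v 0 + c 1 * v 1 := by
  simp only [dualPolytope, Set.mem_ofPred_eq, Fin.sum_univ_two]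
  constructor
  · intro h v hv
    have := h (toReal v) (by rw [hV]; exact subset_convexHull ℝ _ ⟨v, hv, rfl⟩)
    simpa [toReal] using this
  · intro h x hx
    rw [hV] at hx
    have := convexHull_linear_le (c := fun i => -c i) (r := 1) (by
      rintro _ ⟨v, hv, rfl⟩
      have := h v hv
      simp [toReal]; linarith) hx
    linarith

lemma toReal_mem_dual_iff (hV : Δ = convexHull ℝ (toReal '' (V : Set (Fin 2 → ℤ))))
    (u : Fin 2 → ℤ) : toReal u ∈ dualPolytope Δ ↔ ∀ v ∈ V, -1 ≤ dot2 u v := by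
  rw [mem_dual_iff hV]
  simp only [toReal, dot2]
  constructor <;> intro h v hv <;> have := h v hv <;> exact_mod_cast this

lemma exists_bound (W : Finset (Fin 2 → ℤ)) : ∃ M : ℤ, 0 < M ∧ ∀ u ∈ W, ∀ i, |u i| ≤ M := by
  refine ⟨1 + ∑ u ∈ W, ∑ i, |u i|, by positivity, fun u hu i => ?_⟩
  have h1 : |u i| ≤ ∑ i, |u i| :=
    Finset.single_le_sum (f := fun i => |u i|) (fun _ _ => abs_nonneg _) (Finset.mem_univ i)
  have h2 : ∑ i, |u i| ≤ ∑ u ∈ W, ∑ i, |u i| :=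
    Finset.single_le_sum (f := fun u : Fin 2 → ℤ => ∑ i, |u i|)
      (fun _ _ => by positivity) hu
  linarith

lemma hull_bounded {P : Set (Fin 2 → ℝ)}
    (hU : P = convexHull ℝ (toReal '' (U : Set (Fin 2 → ℤ)))) :
    ∃ M : ℤ, 0 < M ∧ ∀ x ∈ P, ∀ i, |x i| ≤ M := by
  obtain ⟨M, hM, h⟩ := exists_bound U
  refine ⟨M, hM, fun x hx i => ?_⟩
  rw [hU] at hx
  have hb : ∀ u ∈ U, ∀ i, -(M : ℝ) ≤ u i ∧ (u i : ℝ) ≤ M := by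
    intro u hu i
    have := abs_le.mp (h u hu i)
    exact ⟨by exact_mod_cast this.1, by exact_mod_cast this.2⟩
  rw [abs_le]
  constructor
  · have := convexHull_linear_le (c := Pi.single i (-1)) (r := M) (by
      rintro _ ⟨u, hu, rfl⟩
      have := (hb u hu i).1
      fin_cases i <;> simp [toReal] at this ⊢ <;> linarith) hx
    fin_cases i <;> simp at this ⊢ <;> linarith
  · have := convexHull_linear_le (c := Pi.single i 1) (r := M) (by
      rintro _ ⟨u, hu, rfl⟩
      have := (hb u hu i).2
      fin_cases i <;> simp [toReal] at this ⊢ <;> linarith) hx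
    fin_cases i <;> simp at this ⊢ <;> linarith

/-- Otherwise every positive multiple of `c` would lie in the dual, which is bounded. -/
lemma exists_neg (hV : Δ = convexHull ℝ (toReal '' (V : Set (Fin 2 → ℤ))))
    (hU : dualPolytope Δ = convexHull ℝ (toReal '' (U : Set (Fin 2 → ℤ)))) (c : Fin 2 → ℝ)
    (hc : c ≠ 0) : ∃ v ∈ V, c 0 * (v 0 : ℝ) + c 1 * v 1 < 0 := by
  by_contra hcon
  push Not at hcon
  obtain ⟨M, hM, hb⟩ := hull_bounded hU
  have hMr : (0 : ℝ) < M := by exact_mod_cast hM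
  obtain ⟨i, hi⟩ : ∃ i, c i ≠ 0 := by
    by_contra h; push Not at h; exact hc (funext h)
  have hmem : (fun k => (2 * M / |c i|) * c k) ∈ dualPolytope Δ := by
    rw [mem_dual_iff hV]
    intro v hv
    have h1 := mul_nonneg (by positivity : 0 ≤ 2 * (M : ℝ) / |c i|) (hcon v hv)
    linarith
  have := hb _ hmem i
  simp only [abs_mul, abs_div, abs_abs] at this
  rw [div_mul_cancel₀ _ (abs_ne_zero.mpr hi), abs_of_pos hMr] at this
  norm_num at this
  linarith

/-- A small positive multiple of `c` lies in the dual and pairs positively with `c`; hence so does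
one of the lattice points spanning the dual. -/
lemma exists_pos (hV : Δ = convexHull ℝ (toReal '' (V : Set (Fin 2 → ℤ))))
    (hU : dualPolytope Δ = convexHull ℝ (toReal '' (U : Set (Fin 2 → ℤ)))) (c : Fin 2 → ℝ)
    (hc : c ≠ 0) : ∃ u : Fin 2 → ℤ, toReal u ∈ dualPolytope Δ ∧
      0 < c 0 * (u 0 : ℝ) + c 1 * u 1 := by
  by_contra hcon
  push Not at hcon
  obtain ⟨M, hM, hb⟩ := exists_bound V
  have hMr : (0 : ℝ) < M := by exact_mod_cast hM
  have hsq : 0 < c 0 * c 0 + c 1 * c 1 := by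
    rcases lt_or_eq_of_le (add_nonneg (mul_self_nonneg (c 0)) (mul_self_nonneg (c 1))) with h | h
    · exact h
    · exact absurd (fin2_ext (u := c) (v := 0) (by simp; nlinarith) (by simp; nlinarith)) hc
  have hK : 0 < |c 0| + |c 1| := by
    by_contra h
    have h0 : |c 0| = 0 := by linarith [abs_nonneg (c 0), abs_nonneg (c 1)]
    have h1 : |c 1| = 0 := by linarith [abs_nonneg (c 0), abs_nonneg (c 1)]
    rw [abs_eq_zero] at h0 h1
    rw [h0, h1] at hsq; simp at hsq
  set e : ℝ := 1 / (M * (|c 0| + |c 1|)) with he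
  have hepos : 0 < e := by positivity
  have hmem : (fun k => e * c k) ∈ dualPolytope Δ := by
    rw [mem_dual_iff hV]
    intro v hv
    have hv' : ∀ i, |(v i : ℝ)| ≤ M := fun i => by exact_mod_cast hb v hv i
    have h2 : |c 0 * v 0 + c 1 * v 1| ≤ M * (|c 0| + |c 1|) := by
      calc |c 0 * v 0 + c 1 * v 1| ≤ |c 0 * v 0| + |c 1 * v 1| := abs_add_le _ _
        _ = |c 0| * |(v 0 : ℝ)| + |c 1| * |(v 1 : ℝ)| := by rw [abs_mul, abs_mul]
        _ ≤ |c 0| * M + |c 1| * M := by gcongr <;> exact hv' _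
        _ = _ := by ring
    have h3 := neg_le_of_abs_le h2
    have h4 := mul_le_mul_of_nonneg_left h3 hepos.le
    have h5 : e * -(M * (|c 0| + |c 1|)) = -1 := by rw [he]; field_simp
    linarith
  rw [hU] at hmem
  have := convexHull_linear_le (c := c) (r := 0) (by
    rintro _ ⟨u, hu, rfl⟩
    exact hcon u (by rw [hU]; exact subset_convexHull ℝ _ ⟨u, hu, rfl⟩)) hmem
  nlinarith

lemma finite_dual (hU : dualPolytope Δ = convexHull ℝ (toReal '' (U : Set (Fin 2 → ℤ)))) :
    {u : Fin 2 → ℤ | toReal u ∈ dualPolytope Δ}.Finite := by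
  obtain ⟨M, hM, hb⟩ := hull_bounded hU
  apply (Set.finite_Icc (fun _ : Fin 2 => -M) (fun _ => M)).subset
  intro u hu
  have h : ∀ i, |u i| ≤ M := fun i => by
    have := hb _ hu i
    simp only [toReal] at this
    exact_mod_cast this
  exact ⟨fun i => (abs_le.mp (h i)).1, fun i => (abs_le.mp (h i)).2⟩

/-- The successor of `u` on the boundary of the dual: among the dual lattice points at determinant
one from `u`, the last one reached when moving in direction `u`. -/
lemma exists_next (hV : Δ = convexHull ℝ (toReal '' (V : Set (Fin 2 → ℤ))))
    (hU : dualPolytope Δ = convexHull ℝ (toReal '' (U : Set (Fin 2 → ℤ)))) {u : Fin 2 → ℤ}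
    (hu : toReal u ∈ dualPolytope Δ) (hu0 : u ≠ 0) :
    ∃ y : Fin 2 → ℤ, toReal y ∈ dualPolytope Δ ∧ det2 u y = 1 ∧ toReal (u + y) ∉ dualPolytope Δ := by
  have hur : toReal u ≠ 0 := by
    intro h; apply hu0; ext i
    have := congrFun h i; simpa [toReal] using this
  -- `u` is primitive
  obtain ⟨v, hv, hneg⟩ := exists_neg hV hU _ hur
  have hneg' : dot2 u v < 0 := by simp only [toReal, dot2] at *; exact_mod_cast hneg
  have hge := (toReal_mem_dual_iff hV u).mp hu
  have hm1 : dot2 u v = -1 := le_antisymm (by omega) (hge v hv)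
  set e : Fin 2 → ℤ := ![v 1, -v 0] with he
  have hde : det2 u e = 1 := by simp [det2, dot2, he] at *; linarith
  -- a point to the left of `u`
  obtain ⟨x, hx, hpos⟩ := exists_pos hV hU ![-(u 1 : ℝ), u 0] (by
    intro h
    apply hu0
    have h0 := congrFun h 0
    have h1 := congrFun h 1
    simp at h0 h1
    exact fin2_ext h1 h0)
  have hd : 0 < det2 u x := by
    simp at hpos
    have : (0 : ℝ) < u 0 * x 1 - u 1 * x 0 := by linarith
    simp only [det2]; exact_mod_cast this
  set d := det2 u x with hdd
  have hxge := (toReal_mem_dual_iff hV x).mp hx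
  set cc := det2 x e with hcc
  have hxe : ∀ w, dot2 x w = d * dot2 e w + cc * dot2 u w := by
    intro w
    simp only [dot2, det2] at hde hdd hcc ⊢
    rw [hdd, hcc]
    linear_combination (-(x 0 * w 0 + x 1 * w 1)) * hde
  -- reduce along `u` to determinant one
  set k0 := -((-cc) / d) with hk0
  -- Here `k0` is the ceiling of `cc / d`, so `d • (e + k0 • u) = x + r • u` with `0 ≤ r < d`. Its
  -- pairings are at least `-(1 + r) ≥ -d`.
  have hy0 : toReal (e + k0 • u) ∈ dualPolytope Δ := by
    rw [toReal_mem_dual_iff hV]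
    intro w hw
    have e1 : dot2 (e + k0 • u) w = dot2 e w + k0 * dot2 u w := by
      simp [dot2]; ring
    rw [e1]
    have h1 := hxge w hw
    rw [hxe w] at h1
    have h2 := hge w hw
    have h3 := Int.emod_nonneg (-cc) hd.ne'
    have h4 := Int.emod_lt_of_pos (-cc) hd
    have h5 := Int.emod_add_mul_ediv (-cc) d
    set r := (-cc) % d
    have h6 : d * k0 = cc + r := by rw [hk0]; linarith
    have h7 : d * (dot2 e w + k0 * dot2 u w) = d * dot2 e w + cc * dot2 u w + r * dot2 u w := by
      linear_combination dot2 u w * h6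
    have h8 : -r ≤ r * dot2 u w := by nlinarith
    by_contra hlt
    push Not at hlt
    nlinarith
  set y0 := e + k0 • u with hy0d
  have hdy0 : det2 u y0 = 1 := by
    rw [← hde]; simp [det2, hy0d]; ring
  -- go on along `u` as far as possible
  have hex : ∃ k : ℕ, toReal (y0 + (k : ℤ) • u) ∉ dualPolytope Δ := by
    by_contra hcon
    push Not at hcon
    refine Set.infinite_of_injective_forall_mem (f := fun k : ℕ => y0 + (k : ℤ) • u) ?_ hcon
      (finite_dual hU)
    intro a b hab
    simp only [add_right_inj] at hab
    have := smul_left_injective ℤ hu0 hab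
    exact_mod_cast this
  classical
  obtain ⟨k, hk⟩ : ∃ k, Nat.find hex = k + 1 := by
    apply Nat.exists_eq_succ_of_ne_zero
    intro h0
    have := Nat.find_spec hex
    rw [h0] at this
    simp at this
    exact this hy0
  refine ⟨y0 + (k : ℤ) • u, ?_, ?_, ?_⟩
  · have := Nat.find_min hex (m := k) (by omega)
    simpa using this
  · rw [← hdy0]; simp [det2]; ring
  · have := Nat.find_spec hex
    rw [hk] at this
    convert this using 3
    push_cast
    rw [add_smul, one_smul]; abel

/-- Some vertex pairs to at most -2 with `u + y` and to at least -1 with each summand. This is where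
integrality yields an edge at height exactly -1. -/
lemma exists_normal (hV : Δ = convexHull ℝ (toReal '' (V : Set (Fin 2 → ℤ)))) {u y : Fin 2 → ℤ}
    (hu : toReal u ∈ dualPolytope Δ) (hy : toReal y ∈ dualPolytope Δ)
    (h : toReal (u + y) ∉ dualPolytope Δ) : ∃ v ∈ V, dot2 u v = -1 ∧ dot2 y v = -1 := by
  rw [toReal_mem_dual_iff hV] at h hu hy
  push Not at h
  obtain ⟨v, hv, h⟩ := h
  have h1 := hu v hv
  have h2 := hy v hv
  have h3 : dot2 (u + y) v = dot2 u v + dot2 y v := by simp [dot2]; ring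
  exact ⟨v, hv, by omega, by omega⟩

/-- Two predecessors of `y` satisfy `u' = u + t • y` with `t = det2 u u'`. If `t > 0`, then `u + y`
lies between them, hence in the dual by convexity; symmetrically for `t < 0`. -/
lemma next_injective (hV : Δ = convexHull ℝ (toReal '' (V : Set (Fin 2 → ℤ))))
    {u u' y : Fin 2 → ℤ} (hu : toReal u ∈ dualPolytope Δ) (hu' : toReal u' ∈ dualPolytope Δ)
    (h : det2 u y = 1) (h' : det2 u' y = 1) (hn : toReal (u + y) ∉ dualPolytope Δ)
    (hn' : toReal (u' + y) ∉ dualPolytope Δ) : u = u' := by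
  have key : ∀ {u u' : Fin 2 → ℤ}, toReal u ∈ dualPolytope Δ → toReal u' ∈ dualPolytope Δ →
      det2 u y = 1 → det2 u' y = 1 → toReal (u + y) ∉ dualPolytope Δ → det2 u u' ≤ 0 := by
    intro u u' hu hu' h h' hn
    by_contra ht
    push Not at ht
    apply hn
    rw [toReal_mem_dual_iff hV] at hu hu' ⊢
    intro w hw
    have h1 := hu w hw
    have h2 := hu' w hw
    have e : dot2 u' w = dot2 u w + det2 u u' * dot2 y w := by
      simp only [det2, dot2] at *
      linear_combination (u 0 * w 0 + u 1 * w 1) * h' - (u' 0 * w 0 + u' 1 * w 1) * h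
    have e' : dot2 (u + y) w = dot2 u w + dot2 y w := by simp [dot2]; ring
    rw [e']
    by_contra hlt
    push Not at hlt
    nlinarith
  have h1 := key hu hu' h h' hn
  have h2 := key hu' hu h' h hn'
  have h0 : det2 u u' = 0 := by
    have : det2 u' u = -det2 u u' := by simp only [det2]; ring
    omega
  simp only [det2] at h h' h0
  apply fin2_ext
  · linear_combination (-u 0) * h' + u' 0 * h - y 0 * h0
  · linear_combination (-u 1) * h' + u' 1 * h - y 1 * h0

/-- The boundary lattice points of the dual polygon form a lattice cycle. -/
lemma exists_cycle_aux (hV : Δ = convexHull ℝ (toReal '' (V : Set (Fin 2 → ℤ))))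
    (hU : dualPolytope Δ = convexHull ℝ (toReal '' (U : Set (Fin 2 → ℤ)))) :
    ∃ C : LatticeCycle, (∀ j, toReal (C.u j) ∈ dualPolytope Δ) ∧ ∀ j, C.v j ∈ V := by
  let D := {u : Fin 2 → ℤ // toReal u ∈ dualPolytope Δ ∧ u ≠ 0}
  have hfin : Finite D := by
    apply Set.Finite.to_subtype
    exact (finite_dual hU).subset fun u hu => hu.1
  have hnext : ∀ u : D, ∃ y : D, det2 u.1 y.1 = 1 ∧ toReal (u.1 + y.1) ∉ dualPolytope Δ := by
    intro u
    obtain ⟨y, hy, h1, h2⟩ := exists_next hV hU u.2.1 u.2.2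
    refine ⟨⟨y, hy, ?_⟩, h1, h2⟩
    rintro rfl
    simp [det2] at h1
  choose next hn1 hn2 using hnext
  have hinj : Function.Injective next := by
    intro a b hab
    have h2 := hn1 b
    have h4 := hn2 b
    rw [← hab] at h2 h4
    exact Subtype.ext (next_injective hV a.2.1 b.2.1 (hn1 a) h2 (hn2 a) h4)
  have hnorm : ∀ u : D, ∃ v ∈ V, dot2 u.1 v = -1 ∧ dot2 (next u).1 v = -1 := fun u =>
    exists_normal hV u.2.1 (next u).2.1 (hn2 u)
  choose nv hv1 hv2 hv3 using hnorm
  obtain ⟨x, hx, hx0⟩ := exists_pos hV hU ![1, 0] (by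
    intro h; have := congrFun h 0; simp at this)
  -- An injective self-map of a finite set has periodic orbits, so the orbit of any starting point
  -- closes up. That it meets every nonzero lattice point of the dual is not needed here and comes
  -- out of `exists_cone`.
  let u0 : D := ⟨x, hx, by rintro rfl; simp at hx0⟩
  refine ⟨{
    n := Function.minimalPeriod next u0
    n_pos := Function.minimalPeriod_pos_of_mem_periodicPts (hinj.mem_periodicPts u0)
    u := fun j => (next^[j] u0).1
    v := fun j => nv (next^[j] u0)
    periodic := fun j => by
      rw [Function.iterate_add_apply, Function.iterate_minimalPeriod]
    inj := fun i j hi hj h =>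
      Function.iterate_injOn_Iio_minimalPeriod hi hj (Subtype.ext h)
    det_eq := fun j => by
      rw [Function.iterate_succ_apply']; exact hn1 _
    dot_left := fun j => hv2 _
    dot_right := fun j => by
      rw [Function.iterate_succ_apply']; exact hv3 _
    dot_ge := fun i j => (toReal_mem_dual_iff hV _).mp (next^[i] u0).2.1 _ (hv1 _) }, ?_, ?_⟩
  · exact fun j => (next^[j] u0).2.1
  · exact fun j => hv1 _

lemma linear_eq_sum (f : (Fin 2 → ℝ) →L[ℝ] ℝ) (x : Fin 2 → ℝ) :
    f x = f (Pi.single 0 1) * x 0 + f (Pi.single 1 1) * x 1 := by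
  have : x = x 0 • Pi.single 0 1 + x 1 • Pi.single 1 1 := by
    apply fin2_ext <;> simp
  conv_lhs => rw [this]
  simp [mul_comm]

/-- A reflexive polygon is cut out by a lattice cycle. -/
theorem IsReflexivePolygon.exists_cycle (hΔ : IsReflexivePolygon Δ) :
    ∃ C : LatticeCycle, Δ = C.polygon := by
  obtain ⟨⟨V, hV⟩, ⟨U, hU⟩⟩ := hΔ
  obtain ⟨C, hC, hCV⟩ := exists_cycle_aux hV hU
  refine ⟨C, Set.Subset.antisymm ?_ ?_⟩
  · intro x hx j
    have := hC j x hx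
    simpa [toReal, Fin.sum_univ_two] using this
  have hcl : IsClosed Δ := by
    rw [hV]
    exact ((V.finite_toSet.image _).isCompact_convexHull ℝ).isClosed
  have hconv : Convex ℝ Δ := by rw [hV]; exact convex_convexHull ℝ _
  have hsub : ∀ v ∈ V, toReal v ∈ Δ := fun v hv => by
    rw [hV]; exact subset_convexHull ℝ _ ⟨v, hv, rfl⟩
  have h0 : (0 : Fin 2 → ℝ) ∈ Δ := by
    by_contra h0
    obtain ⟨f, r, hf0, hf⟩ := geometric_hahn_banach_point_closed hconv hcl h0
    rw [map_zero] at hf0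
    have hv0 := hf _ (hsub _ (hCV 0))
    have hc : (![f (Pi.single 0 1), f (Pi.single 1 1)] : Fin 2 → ℝ) ≠ 0 := by
      intro h
      have e0 := congrFun h 0
      have e1 := congrFun h 1
      simp at e0 e1
      rw [linear_eq_sum, e0, e1] at hv0
      linarith
    obtain ⟨v, hv, hneg⟩ := exists_neg hV hU _ hc
    have := hf _ (hsub v hv)
    rw [linear_eq_sum] at this
    simp [toReal] at hneg this
    linarith
  intro x hx
  by_contra hxn
  obtain ⟨f, r, hfx, hf⟩ := geometric_hahn_banach_point_closed hconv hcl hxn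
  have hr : r < 0 := by simpa using hf 0 h0
  have hmem : (fun i => -r⁻¹ * f (Pi.single i 1)) ∈ dualPolytope Δ := by
    intro y hy
    have h1 := hf y hy
    rw [linear_eq_sum] at h1
    have h2 := mul_lt_mul_of_neg_left h1 (inv_neg''.mpr hr)
    rw [inv_mul_cancel₀ hr.ne] at h2
    rw [Fin.sum_univ_two]
    linarith
  -- The normalised separating functional lies in the dual and is below -1 at `x`. The spanning
  -- lattice points are zero or on the cycle, since one in cone `(j, i, k)` pairs to `-(i + 1 + k) ≥
  -- -1` with `v j`; on all of these `x` obeys the polygon inequalities.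
  rw [hU] at hmem
  have := convexHull_linear_le (c := fun i => -x i) (r := 1) (by
    rintro _ ⟨u, hu, rfl⟩
    have huD : toReal u ∈ dualPolytope Δ := by rw [hU]; exact subset_convexHull ℝ _ ⟨u, hu, rfl⟩
    by_cases hu0 : u = 0
    · simp [hu0, toReal]
    obtain ⟨j, -, i, k, hjk⟩ := C.exists_cone u hu0
    have h1 := (toReal_mem_dual_iff hV u).mp huD _ (hCV j)
    have h2 : dot2 u (C.v j) = -(i + 1 + k) := by
      have hl := C.dot_left j
      have hr := C.dot_right j
      rw [hjk]
      simp [dot2] at *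
      linear_combination (i + 1 : ℤ) * hl + (k : ℤ) * hr
    have hi : i = 0 := by omega
    have hk : k = 0 := by omega
    subst hi hk
    simp at hjk
    have := hx j
    rw [← hjk] at this
    simp [toReal]
    linarith) hmem
  rw [linear_eq_sum] at hfx
  have h2 := mul_lt_mul_of_neg_left hfx (inv_neg''.mpr hr)
  rw [inv_mul_cancel₀ hr.ne] at h2
  linarith

end Reflexive

/-! ### Hilbert series of central fibres -/

section InitialIdeal

variable {ι M : Type*} [AddCommMonoid M]

/-- The ideal of relations between the elements `gen i` of a monoid. -/
noncomputable def relationIdeal (gen : ι → M) : Ideal (MvPolynomial ι ℂ) :=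
  RingHom.ker (MvPolynomial.aeval (R := ℂ)
    (fun i : ι => (AddMonoidAlgebra.single (gen i) 1 : AddMonoidAlgebra ℂ M)))

lemma aeval_single_monomial (gen : ι → M) (a : ι →₀ ℕ) (c : ℂ) :
    MvPolynomial.aeval (R := ℂ)
      (fun i : ι => (AddMonoidAlgebra.single (gen i) 1 : AddMonoidAlgebra ℂ M))
      (MvPolynomial.monomial a c) = AddMonoidAlgebra.single (Finsupp.weight gen a) c := by
  rw [MvPolynomial.aeval_monomial]
  have : ∀ a : ι →₀ ℕ, (a.prod fun i k => (AddMonoidAlgebra.single (gen i) 1 :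
      AddMonoidAlgebra ℂ M) ^ k) = AddMonoidAlgebra.single (Finsupp.weight gen a) 1 := by
    intro a
    induction a using Finsupp.induction_linear with
    | zero => simp [AddMonoidAlgebra.one_def]
    | add f g hf hg =>
      rw [Finsupp.prod_add_index' (by simp) (by intros; rw [pow_add]), hf, hg, map_add,
        AddMonoidAlgebra.single_mul_single, one_mul]
    | single i k => simp [AddMonoidAlgebra.single_pow, Finsupp.weight_single]
  rw [this, ← Algebra.smul_def, AddMonoidAlgebra.smul_single, smul_eq_mul, mul_one]

open Classical in
/-- The projection of the polynomial ring to the central fibre, identified with the free module on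
the monoid: monomials of less than maximal `η`-weight in their fibre are killed. -/
noncomputable def fibreMap (gen : ι → M) (η : ι → ℕ) (φ : M → ℕ) : MvPolynomial ι ℂ →ₗ[ℂ] (M →₀ ℂ) :=
  (MvPolynomial.basisMonomials ι ℂ).constr ℂ fun a =>
    if Finsupp.weight η a = φ (Finsupp.weight gen a) then
      Finsupp.single (Finsupp.weight gen a) 1 else 0

open Classical in
lemma fibreMap_monomial (gen : ι → M) (η : ι → ℕ) (φ : M → ℕ) (a : ι →₀ ℕ) (c : ℂ) :
    fibreMap gen η φ (MvPolynomial.monomial a c) =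
      if Finsupp.weight η a = φ (Finsupp.weight gen a) then
        Finsupp.single (Finsupp.weight gen a) c else 0 := by
  have h : MvPolynomial.monomial a c = c • MvPolynomial.basisMonomials ι ℂ a := by
    simp [MvPolynomial.smul_monomial]
  rw [h, map_smul, fibreMap, Module.Basis.constr_basis]
  split_ifs <;> simp

variable {gen : ι → M} {η : ι → ℕ} {φ : M → ℕ}

/-- The kernel is an ideal because multiplication keeps a monomial non-maximal in its fibre:
exchanging the factor for a heavier one over the same element makes the product heavier too. -/
lemma fibreMap_mul (hle : ∀ a : ι →₀ ℕ, Finsupp.weight η a ≤ φ (Finsupp.weight gen a))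
    (hmax : ∀ m, ∃ a : ι →₀ ℕ, Finsupp.weight gen a = m ∧ Finsupp.weight η a = φ m)
    (p q : MvPolynomial ι ℂ) (hq : fibreMap gen η φ q = 0) : fibreMap gen η φ (p * q) = 0 := by
  classical
  induction p using MvPolynomial.induction_on' with
  | add p1 p2 h1 h2 => rw [add_mul, map_add, h1, h2, add_zero]
  | monomial a c =>
    let T : (M →₀ ℂ) →ₗ[ℂ] (M →₀ ℂ) := Finsupp.lsum ℂ fun m =>
      if Finsupp.weight η a + φ m = φ (Finsupp.weight gen a + m) then
        c • Finsupp.lsingle (Finsupp.weight gen a + m) else 0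
    have key : fibreMap gen η φ ∘ₗ LinearMap.mulLeft ℂ (MvPolynomial.monomial a c)
        = T ∘ₗ fibreMap gen η φ := by
      refine (MvPolynomial.basisMonomials ι ℂ).ext fun b => ?_
      simp only [MvPolynomial.coe_basisMonomials, LinearMap.comp_apply, LinearMap.mulLeft_apply,
        MvPolynomial.monomial_mul, fibreMap_monomial, map_add, mul_one]
      by_cases hb : Finsupp.weight η b = φ (Finsupp.weight gen b)
      · rw [if_pos hb]
        simp only [T, Finsupp.lsum_single]
        rw [hb]
        split_ifs <;> simp
      · rw [if_neg hb, map_zero, if_neg]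
        intro hab
        obtain ⟨b', hb1, hb2⟩ := hmax (Finsupp.weight gen b)
        have h1 := hle (a + b')
        have h2 := hle b
        rw [map_add, map_add, hb1, hb2] at h1
        omega
    have := LinearMap.congr_fun key q
    simp only [LinearMap.comp_apply, LinearMap.mulLeft_apply] at this
    rw [this, hq, map_zero]

/-- In a fibre whose maximal weight is `k`, all monomials of `f` have weight exactly `k`, and their
coefficients sum to zero because `f` is a relation. In any other fibre the part of weight `k` is not
maximal and is killed. -/
lemma fibreMap_lowest (hle : ∀ a : ι →₀ ℕ, Finsupp.weight η a ≤ φ (Finsupp.weight gen a))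
    {f : MvPolynomial ι ℂ} (hf : f ∈ relationIdeal gen) {k : ℕ}
    (hk : ∀ j < k, MvPolynomial.weightedHomogeneousComponent η j f = 0) :
    fibreMap gen η φ (MvPolynomial.weightedHomogeneousComponent η k f) = 0 := by
  classical
  have hcoeff : ∀ b, Finsupp.weight η b < k → MvPolynomial.coeff b f = 0 := by
    intro b hb
    have := congrArg (MvPolynomial.coeff b) (hk _ hb)
    simpa [MvPolynomial.coeff_weightedHomogeneousComponent] using this
  have hp : MvPolynomial.weightedHomogeneousComponent η k f = ∑ b ∈ f.support,
      MvPolynomial.monomial b (if Finsupp.weight η b = k then MvPolynomial.coeff b f else 0) := by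
    ext d
    rw [MvPolynomial.coeff_weightedHomogeneousComponent, MvPolynomial.coeff_sum]
    simp only [MvPolynomial.coeff_monomial]
    rw [Finset.sum_ite_eq']
    by_cases hd : d ∈ f.support
    · rw [if_pos hd]
    · rw [if_neg hd, MvPolynomial.notMem_support_iff.mp hd, ite_self]
  have hz : ∀ m, ∑ b ∈ f.support,
      (if Finsupp.weight gen b = m then MvPolynomial.coeff b f else 0) = 0 := by
    intro m
    have h1 : MvPolynomial.aeval (R := ℂ)
      (fun i : ι => (AddMonoidAlgebra.single (gen i) 1 : AddMonoidAlgebra ℂ M)) f = 0 := hf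
    rw [f.as_sum, map_sum] at h1
    simp only [aeval_single_monomial] at h1
    have h2 := congrArg (fun x => AddMonoidAlgebra.coeff x m) h1
    simpa [Finsupp.single_apply] using h2
  rw [hp, map_sum]
  ext m
  rw [Finsupp.finsetSum_apply, Finsupp.zero_apply]
  by_cases hm : φ m = k
  · rw [← hz m]
    refine Finset.sum_congr rfl fun b hb => ?_
    have hb' : k ≤ Finsupp.weight η b := by
      by_contra h
      exact MvPolynomial.mem_support_iff.mp hb (hcoeff b (by omega))
    have hl := hle b
    rw [fibreMap_monomial]
    by_cases hbm : Finsupp.weight gen b = m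
    · rw [hbm] at hl
      rw [if_pos hbm, hbm, if_pos (by omega), if_pos (by omega), Finsupp.single_eq_same]
    · rw [if_neg hbm]
      split_ifs <;> simp [hbm]
  · refine Finset.sum_eq_zero fun b hb => ?_
    rw [fibreMap_monomial]
    by_cases hbm : Finsupp.weight gen b = m
    · rw [hbm]
      by_cases h : Finsupp.weight η b = k
      · rw [if_neg (by omega)]; simp
      · rw [if_neg h]; split_ifs <;> simp
    · split_ifs <;> simp [hbm]

/-- The kernel of `fibreMap` is the initial ideal. -/
lemma mem_initialIdeal_iff (hle : ∀ a : ι →₀ ℕ, Finsupp.weight η a ≤ φ (Finsupp.weight gen a))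
    (hmax : ∀ m, ∃ a : ι →₀ ℕ, Finsupp.weight gen a = m ∧ Finsupp.weight η a = φ m)
    (p : MvPolynomial ι ℂ) :
    p ∈ initialIdeal (relationIdeal gen) η ↔ fibreMap gen η φ p = 0 := by
  classical
  constructor
  · let K : Ideal (MvPolynomial ι ℂ) :=
      { carrier := {p | fibreMap gen η φ p = 0}
        add_mem' := fun {a b} ha hb => by
          change fibreMap gen η φ (a + b) = 0
          rw [map_add, ha, hb, add_zero]
        zero_mem' := map_zero _
        smul_mem' := fun c x hx => fibreMap_mul hle hmax c x hx }
    have : initialIdeal (relationIdeal gen) η ≤ K := by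
      rw [initialIdeal, Ideal.span_le]
      rintro _ ⟨f, hf, k, hk, rfl⟩
      exact fibreMap_lowest hle hf hk
    exact fun hp => this hp
  · intro hp
    choose β hβ1 hβ2 using hmax
    let σ : (M →₀ ℂ) →ₗ[ℂ] MvPolynomial ι ℂ := Finsupp.lsum ℂ fun m =>
      MvPolynomial.monomial (β m)
    -- `σ` picks one maximal monomial per fibre. A monomial minus the chosen one over the same
    -- element is a relation; its lowest part is the lighter monomial alone, or the whole binomial
    -- if the weights agree.
    have key : ∀ p, p - σ (fibreMap gen η φ p) ∈ initialIdeal (relationIdeal gen) η := by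
      intro p
      induction p using MvPolynomial.induction_on' with
      | add p q hp hq =>
        rw [map_add, map_add, add_sub_add_comm]
        exact Ideal.add_mem _ hp hq
      | monomial b c =>
        rw [fibreMap_monomial]
        set m := Finsupp.weight gen b with hm
        have hrel : MvPolynomial.monomial b c - MvPolynomial.monomial (β m) c
            ∈ relationIdeal gen := by
          rw [relationIdeal, RingHom.mem_ker, map_sub, aeval_single_monomial,
            aeval_single_monomial, hβ1, sub_self]
        apply Ideal.subset_span
        refine ⟨_, hrel, Finsupp.weight η b, ?_, ?_⟩
        · intro j hj
          have := hle b
          rw [← hm] at this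
          ext d
          simp only [MvPolynomial.coeff_weightedHomogeneousComponent, MvPolynomial.coeff_sub,
            MvPolynomial.coeff_monomial, MvPolynomial.coeff_zero]
          by_cases h1 : b = d
          · subst h1; rw [if_neg (by omega)]
          by_cases h2 : β m = d
          · subst h2; rw [hβ2, if_neg (by omega)]
          · simp [h1, h2]
        · by_cases hb : Finsupp.weight η b = φ m
          · rw [if_pos hb]
            simp only [σ, Finsupp.lsum_single]
            ext d
            simp only [MvPolynomial.coeff_weightedHomogeneousComponent, MvPolynomial.coeff_sub,
              MvPolynomial.coeff_monomial]
            by_cases h1 : b = d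
            · subst h1; simp
            by_cases h2 : β m = d
            · subst h2; rw [hβ2, if_pos hb.symm]
            · simp [h1, h2]
          · rw [if_neg hb, map_zero, sub_zero]
            ext d
            simp only [MvPolynomial.coeff_weightedHomogeneousComponent, MvPolynomial.coeff_sub,
              MvPolynomial.coeff_monomial]
            by_cases h2 : β m = d
            · subst h2
              have n1 : ¬ b = β m := fun h => hb (by rw [h]; exact hβ2 m)
              have n2 : ¬ φ m = Finsupp.weight η b := fun h => hb h.symm
              simp [n1, n2, hβ2]
            · by_cases h1 : b = d
              · subst h1; simp [h2]
              · simp [h1, h2]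
    have := key p
    rwa [hp, map_zero, sub_zero] at this

lemma finrank_map_eq_of_ker {E F G : Type*} [AddCommGroup E] [Module ℂ E] [AddCommGroup F]
    [Module ℂ F] [AddCommGroup G] [Module ℂ G] (f : E →ₗ[ℂ] F) (g : E →ₗ[ℂ] G)
    (h : ∀ x, f x = 0 ↔ g x = 0) (W : Submodule ℂ E) :
    Module.finrank ℂ (W.map f) = Module.finrank ℂ (W.map g) := by
  have hker : LinearMap.ker (f.domRestrict W) = LinearMap.ker (g.domRestrict W) := by
    ext x; simp [h]
  rw [← LinearMap.range_domRestrict, ← LinearMap.range_domRestrict]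
  exact ((LinearMap.quotKerEquivRange _).symm.trans ((Submodule.quotEquivOfEq _ _ hker).trans
    (LinearMap.quotKerEquivRange _))).finrank_eq

lemma finrank_supported {N : Type*} (s : Set N) :
    Module.finrank ℂ (Finsupp.supported ℂ ℂ s) = Nat.card s := by
  rw [(Finsupp.supportedEquivFinsupp s).finrank_eq, Module.finrank, rank_finsupp_self]
  simp [Nat.card]

/-- Regroups the sum over the monoid by weight, so that the real-indexed sum defining
`hilbertSeries` becomes a sum over monoid elements. -/
lemma tsum_fibres {N : Type*} {f : N → ℝ} {s : ℝ} (hs : Summable fun m => Real.exp (-(s * f m))) :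
    ∑' r : ℝ, (Nat.card {m | f m = r} : ℝ) * Real.exp (-(s * r))
      = ∑' m, Real.exp (-(s * f m)) := by
  rw [← (Equiv.sigmaFiberEquiv f).tsum_eq, Summable.tsum_sigma]
  · refine tsum_congr fun r => ?_
    have : ∀ c : {m // f m = r}, Real.exp (-(s * f (Equiv.sigmaFiberEquiv f ⟨r, c⟩)))
        = Real.exp (-(s * r)) := fun c => by
      simp [Equiv.sigmaFiberEquiv, c.2]
    rw [tsum_congr this, tsum_const, nsmul_eq_mul]
    rfl
  · exact (Equiv.sigmaFiberEquiv f).summable_iff.mpr hs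

/-- The Hilbert series of the central fibre is a sum over the monoid, where each element has the
weight of any monomial of maximal `η`-weight over it. -/
theorem hilbertSeries_initialIdeal
    (hle : ∀ a : ι →₀ ℕ, Finsupp.weight η a ≤ φ (Finsupp.weight gen a))
    (hmax : ∀ m, ∃ a : ι →₀ ℕ, Finsupp.weight gen a = m ∧ Finsupp.weight η a = φ m)
    (w : ι → ℝ) (ω : M → ℝ)
    (hω : ∀ a : ι →₀ ℕ, Finsupp.weight η a = φ (Finsupp.weight gen a) →
      Finsupp.weight w a = ω (Finsupp.weight gen a)) {s : ℝ}
    (hs : Summable fun m => Real.exp (-(s * ω m))) :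
    hilbertSeries (initialIdeal (relationIdeal gen) η) w s = ∑' m, Real.exp (-(s * ω m)) := by
  classical
  rw [← tsum_fibres hs, hilbertSeries]
  refine tsum_congr fun r => ?_
  congr 2
  -- The dimension of an image depends only on the kernel, so the quotient map may be replaced by
  -- `fibreMap`, whose image of the weight `r` part has a basis of monoid elements.
  rw [finrank_map_eq_of_ker _ (fibreMap gen η φ), ← finrank_supported]
  · have hmap : (MvPolynomial.weightedHomogeneousSubmodule ℂ w r).map (fibreMap gen η φ)
        = Finsupp.supported ℂ ℂ {m | ω m = r} := ?_
    · rw [hmap]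
    apply le_antisymm
    · rw [Submodule.map_le_iff_le_comap]
      intro p hp
      rw [Submodule.mem_comap, p.as_sum, map_sum]
      refine Submodule.sum_mem _ fun b hb => ?_
      rw [fibreMap_monomial]
      split_ifs with h
      · apply Finsupp.single_mem_supported
        rw [MvPolynomial.mem_weightedHomogeneousSubmodule] at hp
        have := hp (MvPolynomial.mem_support_iff.mp hb)
        change ω _ = r
        rw [← hω b h, this]
      · exact Submodule.zero_mem _
    · rw [Finsupp.supported_eq_span_single, Submodule.span_le]
      rintro _ ⟨m, hm, rfl⟩
      obtain ⟨a, ha1, ha2⟩ := hmax m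
      refine ⟨MvPolynomial.monomial a 1, ?_, ?_⟩
      · rw [SetLike.mem_coe, MvPolynomial.mem_weightedHomogeneousSubmodule]
        apply MvPolynomial.isWeightedHomogeneous_monomial
        rw [hω a (by rw [ha1, ha2]), ha1]
        exact hm
      · rw [fibreMap_monomial, ha1, if_pos ha2]
  · intro p
    rw [← mem_initialIdeal_iff hle hmax]
    simp [Ideal.Quotient.eq_zero_iff_mem]

/-- Lets the Hilbert series of the toric ring itself be read off from `hilbertSeries_initialIdeal`,
as the trivial degeneration. -/
lemma initialIdeal_zero (I : Ideal (MvPolynomial ι ℂ)) : initialIdeal I (fun _ => 0) = I := by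
  classical
  have h : ∀ (f : MvPolynomial ι ℂ) (k : ℕ),
      MvPolynomial.weightedHomogeneousComponent (fun _ : ι => 0) k f = if k = 0 then f else 0 := by
    intro f k
    ext d
    have : Finsupp.weight (fun _ : ι => 0) d = 0 := by simp [Finsupp.weight_apply]
    rw [MvPolynomial.coeff_weightedHomogeneousComponent, this]
    by_cases hk : k = 0
    · simp [hk]
    · simp [hk, Ne.symm hk]
  apply le_antisymm
  · rw [initialIdeal, Ideal.span_le]
    rintro _ ⟨f, hf, k, hk, rfl⟩
    rw [h]
    split_ifs
    · exact hf
    · exact Ideal.zero_mem _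
  · intro f hf
    apply Ideal.subset_span
    exact ⟨f, hf, 0, by simp, by rw [h, if_pos rfl]⟩

end InitialIdeal

/-! ### First-order expansions at `0⁺` -/

/-- `f s = c₀ + c₁ s + O(s²)` as `s → 0⁺`. -/
def HasJet (f : ℝ → ℝ) (c₀ c₁ : ℝ) : Prop :=
  (fun s => f s - (c₀ + c₁ * s)) =O[𝓝[>] (0 : ℝ)] (fun s => s ^ 2)

namespace HasJet

variable {f g : ℝ → ℝ} {c₀ c₁ d₀ d₁ : ℝ}

lemma congr (h : HasJet f c₀ c₁) (hfg : ∀ s, 0 < s → g s = f s) : HasJet g c₀ c₁ := by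
  refine IsBigO.congr' h ?_ (EventuallyEq.refl _ _)
  filter_upwards [self_mem_nhdsWithin] with s hs
  rw [hfg s hs]

lemma affine (c₀ c₁ : ℝ) : HasJet (fun s => c₀ + c₁ * s) c₀ c₁ := by
  simp only [HasJet, sub_self]; exact isBigO_zero _ _

lemma add (hf : HasJet f c₀ c₁) (hg : HasJet g d₀ d₁) :
    HasJet (fun s => f s + g s) (c₀ + d₀) (c₁ + d₁) := by
  refine (IsBigO.add hf hg).congr_left fun s => ?_
  ring

lemma sum {ι : Type*} (t : Finset ι) {F : ι → ℝ → ℝ} {c d : ι → ℝ}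
    (h : ∀ i ∈ t, HasJet (F i) (c i) (d i)) :
    HasJet (fun s => ∑ i ∈ t, F i s) (∑ i ∈ t, c i) (∑ i ∈ t, d i) := by
  refine (IsBigO.sum h).congr_left fun s => ?_
  simp only [Finset.sum_apply]
  rw [Finset.sum_sub_distrib, Finset.sum_add_distrib, Finset.sum_mul]

lemma tendsto_id : Tendsto (fun s : ℝ => s) (𝓝[>] 0) (𝓝 0) :=
  tendsto_nhdsWithin_of_tendsto_nhds Filter.tendsto_id

lemma tendsto (hf : HasJet f c₀ c₁) : Tendsto f (𝓝[>] 0) (𝓝 c₀) := by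
  have h1 : Tendsto (fun s : ℝ => s ^ 2) (𝓝[>] 0) (𝓝 0) := by
    simpa using tendsto_id.pow 2
  have h2 := IsBigO.trans_tendsto hf h1
  have h3 : Tendsto (fun s : ℝ => c₀ + c₁ * s) (𝓝[>] 0) (𝓝 c₀) := by
    simpa using tendsto_const_nhds.add (tendsto_id.const_mul c₁)
  have := h2.add h3
  simpa using this

lemma isBigO_one (hf : HasJet f c₀ c₁) : f =O[𝓝[>] (0 : ℝ)] (fun _ => (1 : ℝ)) :=
  hf.tendsto.isBigO_one ℝ

lemma mul (hf : HasJet f c₀ c₁) (hg : HasJet g d₀ d₁) :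
    HasJet (fun s => f s * g s) (c₀ * d₀) (c₀ * d₁ + c₁ * d₀) := by
  have h1 := IsBigO.mul hf hg.isBigO_one
  have h2 := IsBigO.mul (affine c₀ c₁).isBigO_one hg
  have h3 : (fun s : ℝ => c₁ * d₁ * s ^ 2) =O[𝓝[>] (0 : ℝ)] (fun s => s ^ 2) :=
    isBigO_const_mul_self _ _ _
  simp only [mul_one, one_mul] at h1 h2
  refine ((h1.add h2).add h3).congr_left fun s => ?_
  ring

/-- For `f = c₀ + c₁ s + e` one has `c₀² - f (c₀ - c₁ s) = c₁² s² + e (c₁ s - c₀)`; then divide by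
`c₀² f`. -/
lemma inv (hf : HasJet f c₀ c₁) (hc : c₀ ≠ 0) :
    HasJet (fun s => (f s)⁻¹) c₀⁻¹ (-c₁ / c₀ ^ 2) := by
  have h0 : ∀ᶠ s in 𝓝[>] (0 : ℝ), f s ≠ 0 := hf.tendsto.eventually_ne hc
  have hi : (fun s => (f s)⁻¹) =O[𝓝[>] (0 : ℝ)] (fun _ => (1 : ℝ)) :=
    (hf.tendsto.inv₀ hc).isBigO_one ℝ
  have h1 := (IsBigO.mul hf (affine (-c₀) c₁).isBigO_one).mul hi
  have h2 : (fun s : ℝ => c₁ ^ 2 * s ^ 2) =O[𝓝[>] (0 : ℝ)] (fun s => s ^ 2) :=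
    isBigO_const_mul_self _ _ _
  have h3 := h2.mul hi
  simp only [mul_one] at h1 h3
  refine ((h1.add h3).const_mul_left (c₀ ^ 2)⁻¹).congr' ?_ (EventuallyEq.refl _ _)
  filter_upwards [h0] with s hs
  field_simp
  ring

end HasJet

lemma hasLaurentCoeffs_of_hasJet {g : ℝ → ℝ} {A₀ A₁ : ℝ}
    (h : HasJet (fun s => s ^ 3 * g s) (2 * A₀) A₁) : HasLaurentCoeffs g A₀ A₁ := by
  have h1 := IsBigO.mul h (isBigO_refl (fun s : ℝ => (s ^ 3)⁻¹) _)
  refine h1.congr' ?_ ?_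
  · filter_upwards [self_mem_nhdsWithin] with s hs
    have : s ≠ 0 := ne_of_gt hs
    field_simp
  · filter_upwards [self_mem_nhdsWithin] with s hs
    have : s ≠ 0 := ne_of_gt hs
    field_simp

/-- The sum of the geometric series `1 + t + t² + ⋯` at `t = e^{-sw}`. -/
noncomputable def geom (s w : ℝ) : ℝ := (1 - Real.exp (-(s * w)))⁻¹

lemma one_sub_exp_pos {s w : ℝ} (hs : 0 < s) (hw : 0 < w) : 0 < 1 - Real.exp (-(s * w)) := by
  have : Real.exp (-(s * w)) < 1 := by
    rw [← Real.exp_zero]; exact Real.exp_lt_exp.mpr (by linarith [mul_pos hs hw])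
  linarith

lemma exp_mul_geom {s w : ℝ} (hs : 0 < s) (hw : 0 < w) :
    Real.exp (-(s * w)) * geom s w = geom s w - 1 := by
  have := (one_sub_exp_pos hs hw).ne'
  rw [geom]; field_simp; ring

lemma hasJet_one_sub_exp (w : ℝ) :
    HasJet (fun s => (1 - Real.exp (-(s * w))) / s) w (-w ^ 2 / 2) := by
  have h : (fun s : ℝ => Real.exp (-(s * w)) - (1 - s * w + (s * w) ^ 2 / 2)) =O[𝓝[>] (0 : ℝ)]
      (fun s => s ^ 3) := by
    apply IsBigO.of_bound (|w| ^ 3)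
    have hsmall : ∀ᶠ s in 𝓝[>] (0 : ℝ), |-(s * w)| ≤ 1 := by
      have : Tendsto (fun s : ℝ => |-(s * w)|) (𝓝[>] 0) (𝓝 0) := by
        have := ((HasJet.tendsto_id.mul_const w).neg).abs
        simpa using this
      exact (this.eventually (gt_mem_nhds one_pos)).mono fun _ h => h.le
    filter_upwards [hsmall] with s hs
    have := Real.exp_bound hs (n := 3) (by norm_num)
    rw [Real.norm_eq_abs, Real.norm_eq_abs, ← abs_pow, ← abs_mul]
    simp [Finset.sum_range_succ, Nat.factorial] at this
    rw [show |w ^ 3 * s ^ 3| = |s * w| ^ 3 by rw [← abs_pow]; congr 1; ring]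
    have e : Real.exp (-(s * w)) - (1 - s * w + (s * w) ^ 2 / 2)
        = Real.exp (-(s * w)) - (1 + -(s * w) + (s * w) ^ 2 / 2) := by ring
    rw [e]
    refine this.trans ?_
    rw [abs_mul]
    nlinarith [pow_nonneg (mul_nonneg (abs_nonneg s) (abs_nonneg w)) 3]
  have h1 := (h.neg_left).mul (isBigO_refl (fun s : ℝ => s⁻¹) _)
  refine h1.congr' ?_ ?_
  · filter_upwards [self_mem_nhdsWithin] with s hs
    have : s ≠ 0 := ne_of_gt hs
    field_simp
    ring
  · filter_upwards [self_mem_nhdsWithin] with s hs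
    have : s ≠ 0 := ne_of_gt hs
    field_simp

lemma hasJet_geom {w : ℝ} (hw : 0 < w) : HasJet (fun s => s * geom s w) w⁻¹ (1 / 2) := by
  have h := (hasJet_one_sub_exp w).inv hw.ne'
  rw [show -(-w ^ 2 / 2) / w ^ 2 = 1 / 2 by field_simp] at h
  refine h.congr fun s hs => ?_
  rw [geom, inv_div, div_eq_mul_inv]

lemma hasJet_exp_geom {w : ℝ} (hw : 0 < w) :
    HasJet (fun s => s * (Real.exp (-(s * w)) * geom s w)) w⁻¹ (-(1 / 2)) := by
  have h := (hasJet_geom hw).add (HasJet.affine 0 (-1))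
  rw [add_zero, show (1 / 2 : ℝ) + -1 = -(1 / 2) by norm_num] at h
  refine h.congr fun s hs => ?_
  rw [exp_mul_geom hs hw]; ring

/-- The Hilbert series of a cone that is a cyclic union of unimodular half-open cones. -/
noncomputable def cycleSeries (n : ℕ) (w : ℕ → ℝ) (s : ℝ) : ℝ :=
  geom s 2 * (1 + ∑ j ∈ Finset.range n,
    Real.exp (-(s * w j)) * geom s (w j) * geom s (w (j + 1)))

/-- The leading coefficient of `cycleSeries`. -/
noncomputable def leadingCoeff (n : ℕ) (w : ℕ → ℝ) : ℝ :=
  1 / 2 * ∑ j ∈ Finset.range n, 1 / (w j * w (j + 1))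

/-- In a half-open cone the two geometric factors have next-order terms -1/2 and +1/2, so the cyclic
sum of next-order terms telescopes to zero. What remains comes from (0,0,1), whose weight 2 makes
both coefficients equal. -/
lemma hasJet_cycleSeries {n : ℕ} {w : ℕ → ℝ} (hw : ∀ j, 0 < w j) (hn : w n = w 0) :
    HasJet (fun s => s ^ 3 * cycleSeries n w s) (leadingCoeff n w) (leadingCoeff n w) := by
  have h1 : HasJet (fun s : ℝ => s ^ 2) 0 0 := by
    simp only [HasJet, zero_mul, add_zero, sub_zero]; exact isBigO_refl _ _
  have h2 := HasJet.sum (Finset.range n) fun j _ =>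
    (hasJet_exp_geom (hw j)).mul (hasJet_geom (hw (j + 1)))
  have h3 := (hasJet_geom (w := 2) (by norm_num)).mul (h1.add h2)
  have htel : ∑ j ∈ Finset.range n, ((w j)⁻¹ * (1 / 2) + -(1 / 2) * (w (j + 1))⁻¹) = 0 := by
    have : ∑ j ∈ Finset.range n, ((w (j + 1))⁻¹ - (w j)⁻¹) = 0 := by
      rw [Finset.sum_range_sub (fun j => (w j)⁻¹), hn, sub_self]
    calc _ = ∑ j ∈ Finset.range n, (-(1 / 2)) * ((w (j + 1))⁻¹ - (w j)⁻¹) :=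
        Finset.sum_congr rfl fun j _ => by ring
      _ = 0 := by rw [← Finset.mul_sum, this, mul_zero]
  have hlead : leadingCoeff n w = 1 / 2 * ∑ j ∈ Finset.range n, (w j)⁻¹ * (w (j + 1))⁻¹ := by
    rw [leadingCoeff]; congr 1
    exact Finset.sum_congr rfl fun j _ => by rw [one_div, mul_inv]
  rw [htel] at h3
  simp only [zero_add, add_zero, mul_zero] at h3
  rw [show (2 : ℝ)⁻¹ = 1 / 2 by norm_num, ← hlead] at h3
  refine h3.congr fun s hs => ?_
  rw [cycleSeries, show s ^ 3 * (geom s 2 * (1 + ∑ j ∈ Finset.range n,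
    Real.exp (-(s * w j)) * geom s (w j) * geom s (w (j + 1)))) = s * geom s 2 * (s ^ 2 +
    s ^ 2 * ∑ j ∈ Finset.range n,
    Real.exp (-(s * w j)) * geom s (w j) * geom s (w (j + 1))) by ring, Finset.mul_sum]
  congr 2
  exact Finset.sum_congr rfl fun j _ => by ring

/-- The effect on the Hilbert series of moving the weight `w` of one generator to `w'`. -/
lemma hasJet_shifted {g : ℝ → ℝ} {a w w' : ℝ} (hg : HasJet (fun s => s ^ 3 * g s) a a)
    (hw' : 0 < w') :
    HasJet (fun s => s ^ 3 * (g s * (1 - Real.exp (-(s * w))) * geom s w')) (a * w / w')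
      (a * w / w' * (1 + (w' - w) / 2)) := by
  have h := (hg.mul (hasJet_one_sub_exp w)).mul (hasJet_geom hw')
  rw [show a * w * w'⁻¹ = a * w / w' by ring,
    show a * w * (1 / 2) + (a * (-w ^ 2 / 2) + a * w) * w'⁻¹ = a * w / w' * (1 + (w' - w) / 2) by
      field_simp; ring] at h
  refine h.congr fun s hs => ?_
  have : s ≠ 0 := ne_of_gt hs
  field_simp

/-! ### The monoid of a lattice cycle and its Hilbert series -/

lemma pairing_add (m m' : Fin 3 → ℤ) (b : Fin 3 → ℝ) :
    pairing (m + m') b = pairing m b + pairing m' b := by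
  simp [pairing, Fin.sum_univ_three]; ring

lemma pairing_zero (b : Fin 3 → ℝ) : pairing 0 b = 0 := by simp [pairing]

/-- The integer pairing of `m` with `(v, 1)`. -/
def height (m : Fin 3 → ℤ) (v : Fin 2 → ℤ) : ℤ := m 0 * v 0 + m 1 * v 1 + m 2

lemma pairing_lift (m : Fin 3 → ℤ) (x : Fin 2 → ℝ) :
    pairing m (lift x) = m 0 * x 0 + m 1 * x 1 + m 2 := by
  simp [pairing, lift, Fin.sum_univ_three]

lemma pairing_lift_toReal (m : Fin 3 → ℤ) (v : Fin 2 → ℤ) :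
    pairing m (lift (toReal v)) = height m v := by
  simp [pairing_lift, height, toReal]

namespace LatticeCycle

variable (C : LatticeCycle)

/-- The weight of the lattice point `(u j, 1)` under `b`. -/
noncomputable def wt (b : Fin 3 → ℝ) (j : ℕ) : ℝ := C.u j 0 * b 0 + C.u j 1 * b 1 + b 2

/-- The point `(i + 1) (u j, 1) + k (u (j + 1), 1)` on the boundary of the dual cone. -/
def sheet (j i k : ℕ) : Fin 3 → ℤ :=
  ![(i + 1) * C.u j 0 + k * C.u (j + 1) 0, (i + 1) * C.u j 1 + k * C.u (j + 1) 1, i + 1 + k]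

lemma pairing_sheet (b : Fin 3 → ℝ) (j i k : ℕ) :
    pairing (C.sheet j i k) b = (i + 1) * C.wt b j + k * C.wt b (j + 1) := by
  simp [pairing, sheet, wt, Fin.sum_univ_three]; ring

lemma height_sheet (v : Fin 2 → ℤ) (j i k : ℕ) : height (C.sheet j i k) v
    = (i + 1) * (dot2 (C.u j) v + 1) + k * (dot2 (C.u (j + 1)) v + 1) := by
  simp [height, sheet, dot2]; ring

lemma height_sheet_self (j i k : ℕ) : height (C.sheet j i k) (C.v j) = 0 := by
  rw [height_sheet, C.dot_left, C.dot_right]; ring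

lemma height_sheet_nonneg (j' j i k : ℕ) : 0 ≤ height (C.sheet j i k) (C.v j') := by
  rw [height_sheet]
  have h1 := C.dot_ge j j'
  have h2 := C.dot_ge (j + 1) j'
  exact add_nonneg (mul_nonneg (by positivity) (by linarith))
    (mul_nonneg (by positivity) (by linarith))

lemma sheet_inj {j j' i i' k k' : ℕ} (hj : j < C.n) (hj' : j' < C.n)
    (h0 : C.sheet j i k 0 = C.sheet j' i' k' 0) (h1 : C.sheet j i k 1 = C.sheet j' i' k' 1) :
    j = j' ∧ i = i' ∧ k = k' := by
  apply C.cone_unique hj hj'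
  apply fin2_ext
  · simpa [sheet] using h0
  · simpa [sheet] using h1

lemma sheet_ne_zero (j i k : ℕ) : ¬ (C.sheet j i k 0 = 0 ∧ C.sheet j i k 1 = 0) := by
  rintro ⟨h0, h1⟩
  have h := C.height_sheet_self j i k
  rw [height, h0, h1] at h
  simp [sheet] at h
  omega

/-- A lattice vector of `ℤ³` off the third axis lies over a unique half-open cone. -/
lemma exists_sheet (m : Fin 3 → ℤ) (hm : ¬ (m 0 = 0 ∧ m 1 = 0)) :
    ∃ j < C.n, ∃ i k : ℕ, m = C.sheet j i k + ![0, 0, height m (C.v j)] := by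
  obtain ⟨j, hj, i, k, h⟩ := C.exists_cone ![m 0, m 1] (by
    intro h
    exact hm ⟨by simpa using congrFun h 0, by simpa using congrFun h 1⟩)
  refine ⟨j, hj, i, k, ?_⟩
  have h0 : m 0 = (i + 1) * C.u j 0 + k * C.u (j + 1) 0 := by simpa using congrFun h 0
  have h1 : m 1 = (i + 1) * C.u j 1 + k * C.u (j + 1) 1 := by simpa using congrFun h 1
  have hs := C.height_sheet_self j i k
  funext t
  fin_cases t
  · simp [sheet, h0]
  · simp [sheet, h1]
  · simp only [height, sheet] at hs ⊢
    simp at hs ⊢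
    rw [h0, h1]; linarith

lemma toReal_v_mem (j : ℕ) : toReal (C.v j) ∈ C.polygon := by
  intro i
  have := C.dot_ge i j
  simp only [dot2] at this
  simp only [toReal]
  exact_mod_cast this

lemma mem_polygon_iff (v : Fin 2 → ℤ) : toReal v ∈ C.polygon ↔ ∀ j, -1 ≤ dot2 (C.u j) v := by
  refine forall_congr' fun j => ?_
  simp only [toReal, dot2]
  norm_cast

/-- Nonnegativity at the normals suffices: over the cone `j` containing its projection, `m` is a
sheet point plus its height at `v j` times (0,0,1), and both are nonnegative on the polygon. -/
lemma mem_dualMonoid_iff (m : Fin 3 → ℤ) :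
    m ∈ dualMonoid C.polygon ↔ ∀ j, 0 ≤ height m (C.v j) := by
  constructor
  · intro h j
    have := h (lift (toReal (C.v j))) ⟨1, zero_le_one, _, C.toReal_v_mem j, by simp⟩
    rw [pairing_lift_toReal] at this
    exact_mod_cast this
  · rintro h _ ⟨c, hc, x, hx, rfl⟩
    have hsm : pairing m (c • lift x) = c * pairing m (lift x) := by
      simp [pairing, Fin.sum_univ_three]; ring
    rw [hsm]
    refine mul_nonneg hc ?_
    rw [pairing_lift]
    by_cases hm : m 0 = 0 ∧ m 1 = 0
    · have := h 0
      rw [height, hm.1, hm.2] at this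
      rw [hm.1, hm.2]
      simp at this ⊢
      exact_mod_cast this
    · obtain ⟨j, -, i, k, hjk⟩ := C.exists_sheet m hm
      have hl : (0 : ℝ) ≤ height m (C.v j) := by exact_mod_cast h j
      set l := height m (C.v j)
      have h1 := hx j
      have h2 := hx (j + 1)
      rw [hjk]
      simp [sheet]
      have e1 := mul_nonneg (by positivity : (0 : ℝ) ≤ i + 1) (neg_le_iff_add_nonneg.mp h1)
      have e2 := mul_nonneg (by positivity : (0 : ℝ) ≤ k) (neg_le_iff_add_nonneg.mp h2)
      linarith

/-- The elements of the monoid: `l (0,0,1)`, or a boundary point plus `l (0,0,1)`. -/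
def param (x : ℕ × (Unit ⊕ (Fin C.n × (ℕ × ℕ)))) : dualMonoid C.polygon :=
  ⟨Sum.elim (fun _ => 0) (fun y => C.sheet y.1 y.2.1 y.2.2) x.2 + ![0, 0, (x.1 : ℤ)], by
    rw [mem_dualMonoid_iff]
    intro j
    rcases x with ⟨l, _ | ⟨j', i, k⟩⟩
    · simp [height]
    · have := C.height_sheet_nonneg j j' i k
      simp [height] at this ⊢
      linarith⟩

lemma param_bijective : Function.Bijective C.param := by
  constructor
  · rintro ⟨l, x⟩ ⟨l', x'⟩ h
    have h := congrArg Subtype.val h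
    have h0 := congrFun h 0
    have h1 := congrFun h 1
    have h2 := congrFun h 2
    rcases x with _ | ⟨j, i, k⟩ <;> rcases x' with _ | ⟨j', i', k'⟩
    · simp [param] at h2
      rw [h2]
    · simp [param] at h0 h1
      exact absurd ⟨h0.symm, h1.symm⟩ (C.sheet_ne_zero j' i' k')
    · simp [param] at h0 h1
      exact absurd ⟨h0, h1⟩ (C.sheet_ne_zero j i k)
    · simp [param] at h0 h1
      obtain ⟨hj, rfl, rfl⟩ := C.sheet_inj j.2 j'.2 h0 h1
      obtain rfl := Fin.ext hj
      simp [param] at h2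
      rw [h2]
  · rintro ⟨m, hm⟩
    have hm' := (C.mem_dualMonoid_iff m).mp hm
    by_cases h : m 0 = 0 ∧ m 1 = 0
    · have h2 : 0 ≤ m 2 := by
        have := hm' 0
        rw [height, h.1, h.2] at this
        simpa using this
      refine ⟨((m 2).toNat, Sum.inl ()), Subtype.ext ?_⟩
      funext t
      fin_cases t
      · simp [param, h.1]
      · simp [param, h.2]
      · simp [param, h2]
    · obtain ⟨j, hj, i, k, hjk⟩ := C.exists_sheet m h
      refine ⟨((height m (C.v j)).toNat, Sum.inr (⟨j, hj⟩, (i, k))), Subtype.ext ?_⟩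
      simp only [param, Sum.elim_inr]
      rw [Int.toNat_of_nonneg (hm' j)]
      exact hjk.symm

end LatticeCycle

lemma hasSum_geom {s w : ℝ} (hs : 0 < s) (hw : 0 < w) :
    HasSum (fun k : ℕ => Real.exp (-(s * (k * w)))) (geom s w) := by
  have h := hasSum_geometric_of_lt_one (Real.exp_pos (-(s * w))).le
    (by linarith [one_sub_exp_pos hs hw])
  refine h.congr_fun fun k => ?_
  rw [← Real.exp_nat_mul]
  congr 1; ring

lemma hasSum_fintype_prod {κ X : Type*} [Fintype κ] {F : κ × X → ℝ} {a : κ → ℝ}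
    (h : ∀ j, HasSum (fun x => F (j, x)) (a j)) (hF : 0 ≤ F) : HasSum F (∑ j, a j) := by
  have hs : Summable F := by
    rw [summable_prod_of_nonneg hF]
    exact ⟨fun j => (h j).summable, (hasSum_fintype _).summable⟩
  have h1 := hs.hasSum.prod_fiberwise h
  rw [← h1.unique (hasSum_fintype a)]
  exact hs.hasSum

lemma HasSum.mul_nonneg' {X Y : Type*} {f : X → ℝ} {g : Y → ℝ} {a c : ℝ} (hf : HasSum f a)
    (hg : HasSum g c) (hf0 : 0 ≤ f) (hg0 : 0 ≤ g) :
    HasSum (fun x : X × Y => f x.1 * g x.2) (a * c) :=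
  hf.mul hg (hf.summable.mul_of_nonneg hg.summable hf0 hg0)

namespace LatticeCycle

variable (C : LatticeCycle) {b : Fin 3 → ℝ} {s : ℝ}

lemma hasSum_sheet (hw : ∀ j, 0 < C.wt b j) (hs : 0 < s) (j : ℕ) :
    HasSum (fun x : ℕ × ℕ => Real.exp (-(s * pairing (C.sheet j x.1 x.2) b)))
      (Real.exp (-(s * C.wt b j)) * geom s (C.wt b j) * geom s (C.wt b (j + 1))) := by
  have h := HasSum.mul_nonneg' ((hasSum_geom hs (hw j)).mul_left (Real.exp (-(s * C.wt b j))))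
    (hasSum_geom hs (hw (j + 1))) (fun _ => by positivity) (fun _ => by positivity)
  refine h.congr_fun fun x => ?_
  rw [← Real.exp_add, ← Real.exp_add, C.pairing_sheet]
  congr 1; ring

/-- The Hilbert series of the monoid of a lattice cycle. -/
theorem hasSum_dualMonoid (hw : ∀ j, 0 < C.wt b j) (hb : b 2 = 2) (hs : 0 < s) :
    HasSum (fun m : dualMonoid C.polygon => Real.exp (-(s * pairing (m : Fin 3 → ℤ) b)))
      (cycleSeries C.n (C.wt b) s) := by
  rw [← (Equiv.ofBijective _ C.param_bijective).hasSum_iff]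
  have h1 : HasSum (fun x : Unit ⊕ (Fin C.n × (ℕ × ℕ)) => Real.exp (-(s * pairing
      (Sum.elim (fun _ => 0) (fun y => C.sheet y.1 y.2.1 y.2.2) x) b)))
      (1 + ∑ j ∈ Finset.range C.n, Real.exp (-(s * C.wt b j)) * geom s (C.wt b j)
        * geom s (C.wt b (j + 1))) := by
    apply HasSum.sum
    · convert hasSum_fintype _ using 1
      · simp [pairing_zero]
      · infer_instance
    · rw [Finset.sum_range]
      exact hasSum_fintype_prod (fun j => C.hasSum_sheet hw hs j) (fun _ => (Real.exp_pos _).le)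
  have h2 := HasSum.mul_nonneg' (hasSum_geom hs (w := 2) (by norm_num)) h1
    (fun _ => (Real.exp_pos _).le) (fun _ => (Real.exp_pos _).le)
  rw [cycleSeries]
  refine h2.congr_fun fun x => ?_
  simp only [Function.comp, Equiv.ofBijective_apply, param]
  rw [pairing_add, ← Real.exp_add]
  congr 1
  simp only [pairing, Fin.sum_univ_three]
  simp [hb]
  ring

/-! ### Generators -/

lemma one_le_of_ne_zero (m : dualMonoid C.polygon) (hm : m ≠ 0) : 1 ≤ (m : Fin 3 → ℤ) 2 := by
  obtain ⟨⟨l, x⟩, rfl⟩ := C.param_bijective.2 m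
  rcases x with _ | ⟨j, i, k⟩
  · have : l ≠ 0 := by
      rintro rfl
      apply hm
      apply Subtype.ext
      simp [param]
    simp [param]; omega
  · simp [param, sheet]; omega

/-- Induction on the third coordinate, which is additive and at least 1 on nonzero elements, so that
decompositions terminate. -/
lemma exists_monomial (m : dualMonoid C.polygon) :
    ∃ a : generators C.polygon →₀ ℕ, Finsupp.weight (fun h => h.1) a = m := by
  induction hN : ((m : Fin 3 → ℤ) 2).toNat using Nat.strong_induction_on generalizing m with
  | _ N ih =>
    by_cases h0 : m = 0
    · exact ⟨0, by simp [h0]⟩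
    by_cases hg : m ∈ generators C.polygon
    · exact ⟨Finsupp.single ⟨m, hg⟩ 1, by simp [Finsupp.weight_single]⟩
    · have : ∃ a b : dualMonoid C.polygon, m = a + b ∧ a ≠ 0 ∧ b ≠ 0 := by
        by_contra hcon
        push Not at hcon
        exact hg ⟨h0, fun a b hab => or_iff_not_imp_left.mpr (hcon a b hab)⟩
      obtain ⟨a, b, hab, ha, hb⟩ := this
      have h1 := C.one_le_of_ne_zero a ha
      have h2 := C.one_le_of_ne_zero b hb
      have h3 : (m : Fin 3 → ℤ) 2 = (a : Fin 3 → ℤ) 2 + (b : Fin 3 → ℤ) 2 := by rw [hab]; rfl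
      obtain ⟨x, hx⟩ := ih _ (by omega) a rfl
      obtain ⟨y, hy⟩ := ih _ (by omega) b rfl
      exact ⟨x + y, by rw [map_add, hx, hy, hab]⟩

end LatticeCycle
namespace LatticeCycle

variable (C : LatticeCycle) {b : Fin 3 → ℝ} {s : ℝ}

/-! ### Volumes and Futaki invariants -/

lemma wt_periodic (b : Fin 3 → ℝ) (j : ℕ) : C.wt b (j + C.n) = C.wt b j := by
  simp only [wt, C.periodic]

/-- The leading coefficient of the Hilbert series at the Reeb vector `b`. -/
noncomputable def vol (b : Fin 3 → ℝ) : ℝ := leadingCoeff C.n (C.wt b)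

lemma vol_pos (hw : ∀ j, 0 < C.wt b j) : 0 < C.vol b := by
  rw [vol, leadingCoeff]
  refine mul_pos (by norm_num) (Finset.sum_pos (fun j _ => ?_) ⟨0, by simpa using C.n_pos⟩)
  exact one_div_pos.mpr (mul_pos (hw _) (hw _))

lemma pairing_pos (hw : ∀ j, 0 < C.wt b j) (hb : b 2 = 2) (m : dualMonoid C.polygon)
    (hm : m ≠ 0) : 0 < pairing (m : Fin 3 → ℤ) b := by
  obtain ⟨⟨l, x⟩, rfl⟩ := C.param_bijective.2 m
  have h0 : pairing ![0, 0, (l : ℤ)] b = 2 * l := by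
    simp [pairing, Fin.sum_univ_three, hb]; ring
  simp only [param]
  rw [pairing_add, h0]
  rcases x with _ | ⟨j, i, k⟩
  · have : l ≠ 0 := by
      rintro rfl
      apply hm
      apply Subtype.ext
      simp [param]
    simp [pairing_zero]; omega
  · simp only [Sum.elim_inr]
    rw [C.pairing_sheet]
    have h1 := hw j
    have h2 := hw (j + 1)
    positivity

lemma weight_shift {q : generators C.polygon → ℝ} {η : generators C.polygon → ℕ} {ε : ℝ}
    (hq : ∀ h, q h = pairing (h.1 : Fin 3 → ℤ) b) (a : generators C.polygon →₀ ℕ) :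
    Finsupp.weight (fun i => q i + ε * (η i : ℝ)) a
      = pairing (Finsupp.weight (fun h : generators C.polygon => h.1) a : dualMonoid C.polygon) b
        + ε * (Finsupp.weight η a : ℕ) := by
  induction a using Finsupp.induction_linear with
  | zero => simp [pairing_zero]
  | add f g hf hg =>
    simp only [map_add, AddSubmonoid.coe_add, pairing_add]
    rw [hf, hg]; push_cast; ring
  | single h k =>
    simp only [Finsupp.weight_single]
    have : ∀ k : ℕ, pairing ((k • h.1 : dualMonoid C.polygon) : Fin 3 → ℤ) b
        = k * pairing (h.1 : Fin 3 → ℤ) b := by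
      intro k
      induction k with
      | zero => simp [pairing_zero]
      | succ k ih => rw [succ_nsmul, AddSubmonoid.coe_add, pairing_add, ih]; push_cast; ring
    rw [this, hq]
    simp
    ring

lemma hilbertSeries_toricIdeal (hw : ∀ j, 0 < C.wt b j) (hb : b 2 = 2) (hs : 0 < s) :
    hilbertSeries (toricIdeal C.polygon) (reebWeights C.polygon b) s
      = cycleSeries C.n (C.wt b) s := by
  have hsum := C.hasSum_dualMonoid hw hb hs
  rw [← hsum.tsum_eq, ← initialIdeal_zero (toricIdeal C.polygon)]
  refine hilbertSeries_initialIdeal (gen := fun h : generators C.polygon => h.1) (φ := fun _ => 0)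
    ?_ ?_ _ (fun m => pairing (m : Fin 3 → ℤ) b) ?_ hsum.summable
  · intro a; simp [Finsupp.weight_apply]
  · intro m
    obtain ⟨a, ha⟩ := C.exists_monomial m
    exact ⟨a, ha, by simp [Finsupp.weight_apply]⟩
  · intro a _
    have := C.weight_shift (b := b) (q := reebWeights C.polygon b) (η := fun _ => 0) (ε := 0)
      (fun _ => rfl) a
    simpa using this

lemma hasVolume (hw : ∀ j, 0 < C.wt b j) (hb : b 2 = 2) :
    HasVolume C.polygon b (8 / 27 * C.vol b) := by
  have hper := C.wt_periodic b 0
  rw [zero_add] at hper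
  have h := ((hasJet_cycleSeries hw hper).tendsto).const_mul (8 / 27)
  refine h.congr' ?_
  filter_upwards [self_mem_nhdsWithin] with s hs
  rw [C.hilbertSeries_toricIdeal hw hb hs]

section Futaki

variable (h : generators C.polygon)

/-- The highest power of the generator `h` in a monomial over `m`. -/
noncomputable def order (m : dualMonoid C.polygon) : ℕ :=
  sSup {k | ∃ a : generators C.polygon →₀ ℕ, Finsupp.weight (fun h => h.1) a = m ∧ a h = k}

/-- Bounds the set defining `order`, so its supremum is attained instead of being the default value
0. -/
lemma exponent_le (a : generators C.polygon →₀ ℕ) :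
    (a h : ℤ) ≤ ((Finsupp.weight (fun h => h.1) a : dualMonoid C.polygon) : Fin 3 → ℤ) 2 := by
  induction a using Finsupp.induction_linear with
  | zero => simp
  | add f g hf hg =>
    rw [map_add, AddSubmonoid.coe_add, Finsupp.add_apply, Pi.add_apply]
    push_cast; linarith
  | single h' k =>
    rw [Finsupp.weight_single]
    have h1 := C.one_le_of_ne_zero h'.1 h'.2.1
    have h2 : ((k • h'.1 : dualMonoid C.polygon) : Fin 3 → ℤ) 2
        = k * ((h'.1 : dualMonoid C.polygon) : Fin 3 → ℤ) 2 := by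
      rw [AddSubmonoidClass.coe_nsmul, Pi.smul_apply, nsmul_eq_mul]
    rw [h2]
    have h3 : (Finsupp.single h' k) h ≤ k := by
      classical
      rw [Finsupp.single_apply]; split_ifs <;> simp
    have h4 : (((Finsupp.single h' k) h : ℕ) : ℤ) ≤ k := by exact_mod_cast h3
    nlinarith

lemma order_bddAbove (m : dualMonoid C.polygon) : BddAbove
    {k | ∃ a : generators C.polygon →₀ ℕ, Finsupp.weight (fun h => h.1) a = m ∧ a h = k} := by
  refine ⟨((m : Fin 3 → ℤ) 2).toNat, ?_⟩
  rintro k ⟨a, rfl, rfl⟩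
  have := C.exponent_le h a
  omega

lemma le_order (a : generators C.polygon →₀ ℕ) :
    a h ≤ C.order h (Finsupp.weight (fun h => h.1) a) :=
  le_csSup (C.order_bddAbove h _) ⟨a, rfl, rfl⟩

lemma exists_order (m : dualMonoid C.polygon) :
    ∃ a : generators C.polygon →₀ ℕ, Finsupp.weight (fun h => h.1) a = m ∧ a h = C.order h m := by
  obtain ⟨a, ha⟩ := C.exists_monomial m
  have hne : {k | ∃ a : generators C.polygon →₀ ℕ,
      Finsupp.weight (fun h => h.1) a = m ∧ a h = k}.Nonempty := ⟨_, a, ha, rfl⟩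
  exact Nat.sSup_mem hne (C.order_bddAbove h m)

lemma exists_sub {m : dualMonoid C.polygon} {k : ℕ} (hk : C.order h m = k + 1) :
    ∃ m' : dualMonoid C.polygon, m = m' + h.1 := by
  obtain ⟨a, ha, hak⟩ := C.exists_order h m
  refine ⟨Finsupp.weight (fun h => h.1) (a - Finsupp.single h 1), ?_⟩
  have hle : Finsupp.single h 1 ≤ a := by
    rw [Finsupp.single_le_iff]; omega
  conv_lhs => rw [← ha, ← tsub_add_cancel_of_le hle, map_add, Finsupp.weight_single, one_smul]

/-- If a monomial over `m + h` attains the order, which is positive, one factor `h` can be removed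
to give a monomial over `m`, by cancellation in ℤ³. -/
lemma order_add (m : dualMonoid C.polygon) : C.order h (m + h.1) = C.order h m + 1 := by
  obtain ⟨a, ha, hak⟩ := C.exists_order h m
  have h1 := C.le_order h (a + Finsupp.single h 1)
  rw [map_add, ha, Finsupp.weight_single, one_smul, Finsupp.add_apply, Finsupp.single_eq_same,
    hak] at h1
  refine le_antisymm ?_ h1
  obtain ⟨a', ha', hak'⟩ := C.exists_order h (m + h.1)
  have hle : Finsupp.single h 1 ≤ a' := by
    rw [Finsupp.single_le_iff]; omega
  have h2 := C.le_order h (a' - Finsupp.single h 1)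
  have h3 : Finsupp.weight (fun h => h.1) (a' - Finsupp.single h 1) = m := by
    have h4 : Finsupp.weight (fun h : generators C.polygon => h.1) (a' - Finsupp.single h 1) + h.1
        = m + h.1 := by
      conv_rhs => rw [← ha', ← tsub_add_cancel_of_le hle, map_add, Finsupp.weight_single,
        one_smul]
    have h5 := congrArg Subtype.val h4
    simp only [AddSubmonoid.coe_add] at h5
    exact Subtype.ext (add_right_cancel h5)
  rw [h3] at h2
  simp at h2
  omega

lemma order_add_nsmul (m : dualMonoid C.polygon) (k : ℕ) :
    C.order h (m + k • h.1) = C.order h m + k := by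
  induction k with
  | zero => simp
  | succ k ih => rw [succ_nsmul, ← add_assoc, order_add, ih]; ring

/-- Each element is a multiple of `h` plus an element not divisible by `h`. -/
lemma order_decomposition : Function.Bijective
    (fun x : {m : dualMonoid C.polygon // C.order h m = 0} × ℕ => x.1.1 + x.2 • h.1) := by
  constructor
  · rintro ⟨⟨m, hm⟩, k⟩ ⟨⟨m', hm'⟩, k'⟩ hx
    simp only at hx
    have h1 := C.order_add_nsmul h m k
    rw [hx, C.order_add_nsmul, hm, hm'] at h1
    have hk : k = k' := by omega
    subst hk
    have h5 := congrArg Subtype.val hx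
    simp only [AddSubmonoid.coe_add] at h5
    have := Subtype.ext (add_right_cancel h5)
    subst this
    rfl
  · intro m
    induction hk : C.order h m generalizing m with
    | zero => exact ⟨(⟨m, hk⟩, 0), by simp⟩
    | succ k ih =>
      obtain ⟨m', rfl⟩ := C.exists_sub h hk
      rw [order_add] at hk
      obtain ⟨⟨x, l⟩, hx⟩ := ih m' (by omega)
      refine ⟨(x, l + 1), ?_⟩
      rw [← hx]
      simp only [succ_nsmul, add_assoc]

lemma pairing_add_nsmul (m : dualMonoid C.polygon) (k : ℕ) :
    pairing ((m + k • h.1 : dualMonoid C.polygon) : Fin 3 → ℤ) b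
      = pairing (m : Fin 3 → ℤ) b + k * pairing (h.1 : Fin 3 → ℤ) b := by
  induction k with
  | zero => simp
  | succ k ih =>
    rw [succ_nsmul, ← add_assoc, AddSubmonoid.coe_add, pairing_add, ih]; push_cast; ring

/-- By `order_decomposition` the sum is `B * geom s (w + ε)`, with `w` the weight of `h` and `B` the
series of the elements of order zero. Taking `ε = 0` recovers the known series and determines `B`.
-/
lemma hasSum_shifted (hw : ∀ j, 0 < C.wt b j) (hb : b 2 = 2) (hs : 0 < s) {ε : ℝ}
    (hε : 0 < pairing (h.1 : Fin 3 → ℤ) b + ε) :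
    HasSum (fun m : dualMonoid C.polygon =>
        Real.exp (-(s * (pairing (m : Fin 3 → ℤ) b + ε * C.order h m))))
      (cycleSeries C.n (C.wt b) s * (1 - Real.exp (-(s * pairing (h.1 : Fin 3 → ℤ) b)))
        * geom s (pairing (h.1 : Fin 3 → ℤ) b + ε)) := by
  have hp := C.pairing_pos hw hb h.1 h.2.1
  have hsum := C.hasSum_dualMonoid hw hb hs
  obtain ⟨B, hB⟩ : Summable (fun m : {m : dualMonoid C.polygon // C.order h m = 0} =>
      Real.exp (-(s * pairing (m.1 : Fin 3 → ℤ) b))) :=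
    hsum.summable.subtype {m | C.order h m = 0}
  have key : ∀ ε : ℝ, 0 < pairing (h.1 : Fin 3 → ℤ) b + ε →
      HasSum (fun m : dualMonoid C.polygon =>
        Real.exp (-(s * (pairing (m : Fin 3 → ℤ) b + ε * C.order h m))))
      (B * geom s (pairing (h.1 : Fin 3 → ℤ) b + ε)) := by
    intro ε hε
    rw [← (Equiv.ofBijective _ (C.order_decomposition h)).hasSum_iff]
    have h1 := HasSum.mul_nonneg' hB (hasSum_geom hs hε) (fun _ => (Real.exp_pos _).le)
      (fun _ => (Real.exp_pos _).le)
    refine h1.congr_fun fun x => ?_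
    simp only [Function.comp, Equiv.ofBijective_apply]
    rw [pairing_add_nsmul, order_add_nsmul, x.1.2, ← Real.exp_add]
    congr 1; push_cast; ring
  have h0 := key 0 (by simpa using hp)
  simp only [zero_mul, add_zero] at h0
  have hG := h0.unique hsum
  have hpos := one_sub_exp_pos hs hp
  have hBv : B = cycleSeries C.n (C.wt b) s
      * (1 - Real.exp (-(s * pairing (h.1 : Fin 3 → ℤ) b))) := by
    rw [← hG, geom, mul_assoc, inv_mul_cancel₀ hpos.ne', mul_one]
  rw [← hBv]
  exact key ε hε

lemma weight_testSymmetry (a : generators C.polygon →₀ ℕ) :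
    Finsupp.weight (testSymmetry C.polygon h) a = a h := by
  classical
  induction a using Finsupp.induction_linear with
  | zero => simp
  | add f g hf hg => rw [map_add, hf, hg, Finsupp.add_apply]
  | single h' k =>
    rw [Finsupp.weight_single, testSymmetry, Pi.single_apply, Finsupp.single_apply]
    split_ifs <;> simp

lemma hilbertSeries_centralFibre (hw : ∀ j, 0 < C.wt b j) (hb : b 2 = 2) (hs : 0 < s) {ε : ℝ}
    (hε : 0 < pairing (h.1 : Fin 3 → ℤ) b + ε) :
    hilbertSeries (initialIdeal (toricIdeal C.polygon) (testSymmetry C.polygon h))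
      (fun i => reebWeights C.polygon b i + ε * (testSymmetry C.polygon h i : ℝ)) s
      = cycleSeries C.n (C.wt b) s * (1 - Real.exp (-(s * pairing (h.1 : Fin 3 → ℤ) b)))
        * geom s (pairing (h.1 : Fin 3 → ℤ) b + ε) := by
  have hsum := C.hasSum_shifted h hw hb hs hε
  rw [← hsum.tsum_eq]
  refine hilbertSeries_initialIdeal (gen := fun h : generators C.polygon => h.1)
    (φ := C.order h) ?_ ?_ _
    (fun m => pairing (m : Fin 3 → ℤ) b + ε * C.order h m) ?_ hsum.summable
  · intro a
    rw [weight_testSymmetry]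
    exact C.le_order h a
  · intro m
    obtain ⟨a, ha, hk⟩ := C.exists_order h m
    exact ⟨a, ha, by rw [weight_testSymmetry, hk]⟩
  · intro a ha
    rw [C.weight_shift (b := b) (q := reebWeights C.polygon b) (η := testSymmetry C.polygon h)
      (fun _ => rfl), ha]

/-- The Futaki invariant of the test symmetry of a generator. -/
theorem hasFutaki (hw : ∀ j, 0 < C.wt b j) (hb : b 2 = 2) :
    HasFutaki (toricIdeal C.polygon) (reebWeights C.polygon b) (testSymmetry C.polygon h)
      (C.vol b / 4 - C.vol b / (6 * pairing (h.1 : Fin 3 → ℤ) b)) := by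
  have hp := C.pairing_pos hw hb h.1 h.2.1
  have ha := C.vol_pos hw
  set w := pairing (h.1 : Fin 3 → ℤ) b with hwdef
  set a := C.vol b with hadef
  have hper := C.wt_periodic b 0
  rw [zero_add] at hper
  have hjet : HasJet (fun s => s ^ 3 * cycleSeries C.n (C.wt b) s) a a :=
    hasJet_cycleSeries hw hper
  have hε : ∀ᶠ ε in 𝓝 (0 : ℝ), 0 < w + ε := by
    have : Tendsto (fun ε : ℝ => w + ε) (𝓝 0) (𝓝 (w + 0)) := tendsto_const_nhds.add tendsto_id
    rw [add_zero] at this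
    exact this.eventually (lt_mem_nhds hp)
  -- From `hasJet_shifted` with `w' = w + ε`. The ratio `A₁ / A₀` is `2 + ε`, of derivative 1, and
  -- `A₀` has derivative `-a / (2w)` at 0.
  refine ⟨a / 2, a, fun ε => a * w / (w + ε) / 2, fun ε => a * w / (w + ε) * (1 + ε / 2),
    -(a / (2 * w)), 1, ?_, ?_, by positivity, ?_, ?_, ?_⟩
  · apply hasLaurentCoeffs_of_hasJet
    rw [mul_div_cancel₀ _ (two_ne_zero)]
    refine hjet.congr fun s hs => ?_
    rw [C.hilbertSeries_toricIdeal hw hb hs]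
  · filter_upwards [hε] with ε hε
    apply hasLaurentCoeffs_of_hasJet
    rw [mul_div_cancel₀ _ (two_ne_zero)]
    have h1 := hasJet_shifted (w := w) hjet hε
    rw [add_sub_cancel_left] at h1
    refine h1.congr fun s hs => ?_
    rw [C.hilbertSeries_centralFibre h hw hb hs hε]
  · have h1 : HasDerivAt (fun ε : ℝ => 2 + ε) 1 0 := (hasDerivAt_id (0 : ℝ)).const_add 2
    refine h1.congr_of_eventuallyEq ?_
    filter_upwards [hε] with ε hε
    field_simp
  · have h1 : HasDerivAt (fun ε : ℝ => w + ε) 1 0 := (hasDerivAt_id (0 : ℝ)).const_add w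
    have h2 := ((h1.inv (by simpa using hp.ne')).const_mul (a * w)).div_const 2
    simp only [add_zero] at h2
    refine (h2.congr_deriv ?_).congr_of_eventuallyEq (Eventually.of_forall fun ε => ?_)
    · field_simp
    · simp [div_eq_mul_inv]
  · field_simp
    ring

end Futaki
end LatticeCycle
namespace LatticeCycle

variable (C : LatticeCycle) {b : Fin 3 → ℝ} {s : ℝ}

/-! ### Divisor volumes -/

lemma exists_v_ne (v : Fin 2 → ℤ) : ∃ j, C.v j ≠ v := by
  by_contra hcon
  push Not at hcon
  have hd : ∀ j, dot2 (C.u j) v = -1 := fun j => by rw [← hcon j]; exact C.dot_left j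
  have hdet : ∀ j, det2 (C.u j) ![v 1, -v 0] = 1 := fun j => by
    have := hd j
    simp [dot2, det2] at *; linarith
  refine C.not_halfplane ![v 1, -v 0] ?_ fun j => by rw [hdet j]; norm_num
  intro h
  have := hdet 0
  rw [h] at this
  simp [det2] at this

lemma v_mod (j : ℕ) : C.v (j % C.n) = C.v j := by
  have h : ∀ k, C.v (j % C.n + k * C.n) = C.v (j % C.n) := by
    intro k
    induction k with
    | zero => simp
    | succ k ih => rw [Nat.succ_mul, ← add_assoc, v_periodic, ih]
  conv_rhs => rw [← Nat.mod_add_div j C.n, mul_comm]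
  rw [h]

/-- The lattice points of `D_v` that are not in the monoid. -/
def polePoints (v : Fin 2 → ℤ) : Set (Fin 3 → ℤ) :=
  {m | height m v = -1 ∧ ∀ w : Fin 2 → ℤ, toReal w ∈ C.polygon → w ≠ v → 0 ≤ height m w}

lemma height_nonneg {m : Fin 3 → ℤ} (hm : m ∈ dualMonoid C.polygon) {v : Fin 2 → ℤ}
    (hv : toReal v ∈ C.polygon) : 0 ≤ height m v := by
  have := hm (lift (toReal v)) ⟨1, zero_le_one, _, hv, by simp⟩
  rw [pairing_lift_toReal] at this
  exact_mod_cast this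

lemma divisorPoints_eq {v : Fin 2 → ℤ} (hv : toReal v ∈ C.polygon) :
    divisorPoints C.polygon v = (dualMonoid C.polygon : Set (Fin 3 → ℤ)) ∪ C.polePoints v := by
  have hdef : ∀ m, m ∈ divisorPoints C.polygon v ↔ -1 ≤ height m v ∧
      ∀ w : Fin 2 → ℤ, toReal w ∈ C.polygon → w ≠ v → 0 ≤ height m w := by
    intro m
    change (_ ∧ _) ↔ _
    simp only [pairing_lift_toReal]
    norm_cast
  ext m
  rw [hdef]
  constructor
  · rintro ⟨h1, h2⟩
    rcases lt_or_ge (height m v) 0 with h | h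
    · exact Or.inr ⟨by omega, h2⟩
    · left
      rw [SetLike.mem_coe, mem_dualMonoid_iff]
      intro j
      by_cases hj : C.v j = v
      · rw [hj]; exact h
      · exact h2 _ (C.toReal_v_mem j) hj
  · rintro (h | h)
    · exact ⟨by linarith [C.height_nonneg h hv], fun w hw _ => C.height_nonneg h hw⟩
    · exact ⟨h.1.ge, h.2⟩

lemma disjoint_polePoints {v : Fin 2 → ℤ} (hv : toReal v ∈ C.polygon) :
    Disjoint (dualMonoid C.polygon : Set (Fin 3 → ℤ)) (C.polePoints v) := by
  rw [Set.disjoint_left]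
  intro m hm hm'
  have := C.height_nonneg hm hv
  rw [hm'.1] at this
  omega

/-- The translate by `-(0,0,1)` of a boundary point of the dual cone. -/
def shiftedSheet (x : Fin C.n × (ℕ × ℕ)) : Fin 3 → ℤ := C.sheet x.1 x.2.1 x.2.2 + ![0, 0, -1]

lemma height_add_vertical (m : Fin 3 → ℤ) (l : ℤ) (v : Fin 2 → ℤ) :
    height (m + ![0, 0, l]) v = height m v + l := by
  simp [height]; ring

lemma shiftedSheet_injective : Function.Injective C.shiftedSheet := by
  rintro ⟨j, i, k⟩ ⟨j', i', k'⟩ h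
  have h0 := congrFun h 0
  have h1 := congrFun h 1
  simp [shiftedSheet] at h0 h1
  obtain ⟨hj, rfl, rfl⟩ := C.sheet_inj j.2 j'.2 h0 h1
  rw [Fin.ext hj]

/-- Such a point is a sheet point plus its height at `v j` along (0,0,1). If `v j ≠ v`, that height
is nonnegative and so would be the height at `v`; hence `v j = v` and the shift is -1. -/
lemma polePoints_subset_range {v : Fin 2 → ℤ} (hv' : toReal v ∈ C.polygon) :
    C.polePoints v ⊆ C.shiftedSheet '' {x | C.v x.1 = v} := by
  intro m hm
  have key : ∀ j, C.v j ≠ v → 0 ≤ height m (C.v j) := fun j hj => hm.2 _ (C.toReal_v_mem j) hj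
  have hne : ¬ (m 0 = 0 ∧ m 1 = 0) := by
    rintro ⟨h0, h1⟩
    obtain ⟨j, hj⟩ := C.exists_v_ne v
    have h2 := key j hj
    have h3 := hm.1
    simp only [height, h0, h1] at h2 h3
    omega
  obtain ⟨j, hj, i, k, hjk⟩ := C.exists_sheet m hne
  by_cases hv : C.v j = v
  · refine ⟨(⟨j, hj⟩, (i, k)), hv, ?_⟩
    rw [shiftedSheet]
    conv_rhs => rw [hjk, hv, hm.1]
  · exfalso
    have h1 := key j hv
    have h2 : 0 ≤ height (C.sheet j i k) v := by
      rw [mem_polygon_iff] at hv'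
      rw [height_sheet]
      have h1 := hv' j
      have h2 := hv' (j + 1)
      exact add_nonneg (mul_nonneg (by positivity) (by linarith))
        (mul_nonneg (by positivity) (by linarith))
    have h3 := hm.1
    rw [hjk, height_add_vertical] at h3
    omega

/-- A lattice point `w` other than the normal pairs to at least 0 with one of the two boundary
vectors. Both coefficients being positive, the height there is at least 1 before the shift. -/
lemma shiftedSheet_mem (x : Fin C.n × (ℕ × ℕ)) (hx : x.2.2 ≠ 0) :
    C.shiftedSheet x ∈ C.polePoints (C.v x.1) := by
  obtain ⟨j, i, k⟩ := x
  simp only at hx ⊢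
  refine ⟨?_, ?_⟩
  · rw [shiftedSheet, height_add_vertical, C.height_sheet_self]; norm_num
  · intro w hw hne
    rw [mem_polygon_iff] at hw
    rw [shiftedSheet, height_add_vertical, C.height_sheet]
    have h1 := hw j
    have h2 := hw (j + 1)
    have hk : (1 : ℤ) ≤ k := by omega
    by_cases h3 : dot2 (C.u j) w = -1
    · have h4 : dot2 (C.u (j + 1)) w ≠ -1 := by
        intro h4
        apply hne
        exact eq_of_dot (C.det_eq j) (by rw [h3, C.dot_left]) (by rw [h4, C.dot_right])
      have h5 : 0 ≤ dot2 (C.u (j + 1)) w := by omega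
      rw [h3]
      simp only
      nlinarith
    · have h5 : 0 ≤ dot2 (C.u j) w := by omega
      simp only
      nlinarith [mul_nonneg (by omega : (0 : ℤ) ≤ k)
        (by omega : 0 ≤ dot2 (C.u (j + 1)) w + 1), mul_nonneg (by omega : (0 : ℤ) ≤ i) h5]

/-- The leading coefficient of the Hilbert series of the facet of the dual cone normal to `v`. -/
noncomputable def facetVol (b : Fin 3 → ℝ) (v : Fin 2 → ℤ) : ℝ :=
  ∑ j ∈ Finset.range C.n, if C.v j = v then 1 / (C.wt b j * C.wt b (j + 1)) else 0

lemma pairing_shiftedSheet (hb : b 2 = 2) (x : Fin C.n × (ℕ × ℕ)) :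
    pairing (C.shiftedSheet x) b = pairing (C.sheet x.1 x.2.1 x.2.2) b - 2 := by
  rw [shiftedSheet, pairing_add]
  simp [pairing, Fin.sum_univ_three, hb]; ring

lemma hasSum_sheet_interior (hw : ∀ j, 0 < C.wt b j) (hs : 0 < s) (j : ℕ) :
    HasSum (fun x : ℕ × ℕ => if x.2 = 0 then 0 else
        Real.exp (-(s * pairing (C.sheet j x.1 x.2) b)))
      (Real.exp (-(s * C.wt b j)) * geom s (C.wt b j)
        * (Real.exp (-(s * C.wt b (j + 1))) * geom s (C.wt b (j + 1)))) := by
  have h0 : HasSum (fun k : ℕ => if k = 0 then 0 else Real.exp (-(s * (k * C.wt b (j + 1)))))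
      (Real.exp (-(s * C.wt b (j + 1))) * geom s (C.wt b (j + 1))) := by
    rw [exp_mul_geom hs (hw _)]
    have h := (hasSum_geom hs (hw (j + 1))).sub (hasSum_ite_eq (0 : ℕ) (1 : ℝ))
    refine h.congr_fun fun k => ?_
    by_cases hk : k = 0 <;> simp [hk]
  have h := HasSum.mul_nonneg' ((hasSum_geom hs (hw j)).mul_left (Real.exp (-(s * C.wt b j))))
    h0 (fun _ => by positivity) (fun k => by dsimp only; split_ifs <;> positivity)
  refine h.congr_fun fun x => ?_
  split_ifs
  · simp
  · rw [← Real.exp_add, ← Real.exp_add, C.pairing_sheet]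
    congr 1; ring

open Classical in
/-- The sum over the lattice points of `D_v` off the monoid, as a sum over sheets. -/
lemma hasSum_polePoints (hw : ∀ j, 0 < C.wt b j) (hb : b 2 = 2) (hs : 0 < s) {v : Fin 2 → ℤ}
    (hv : toReal v ∈ C.polygon) : ∃ P : ℝ,
      HasSum (fun m : C.polePoints v => Real.exp (-(s * pairing (m : Fin 3 → ℤ) b)))
        (Real.exp (2 * s) * P) ∧
      (∑ j ∈ Finset.range C.n, if C.v j = v then
        Real.exp (-(s * C.wt b j)) * geom s (C.wt b j)
        * (Real.exp (-(s * C.wt b (j + 1))) * geom s (C.wt b (j + 1))) else 0) ≤ P ∧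
      P ≤ ∑ j ∈ Finset.range C.n, if C.v j = v then
        Real.exp (-(s * C.wt b j)) * geom s (C.wt b j) * geom s (C.wt b (j + 1)) else 0 := by
  -- Which shifted points with `k = 0` belong to `polePoints` is left undecided: they form rays and
  -- do not affect the leading term, so a sandwich is enough.
  let A : Set (Fin C.n × (ℕ × ℕ)) := {x | C.shiftedSheet x ∈ C.polePoints v}
  have hA : ∀ x ∈ A, C.v x.1 = v := by
    intro x hx
    obtain ⟨y, hy, hyx⟩ := C.polePoints_subset_range hv hx
    rw [← C.shiftedSheet_injective hyx]; exact hy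
  let g : Fin C.n × (ℕ × ℕ) → ℝ := fun x =>
    Real.exp (-(s * pairing (C.sheet x.1 x.2.1 x.2.2) b))
  have hg : ∀ x, 0 < g x := fun x => Real.exp_pos _
  have h1 : HasSum (fun x : Fin C.n × (ℕ × ℕ) => if C.v x.1 = v then g x else 0)
      (∑ j ∈ Finset.range C.n, if C.v j = v then
        Real.exp (-(s * C.wt b j)) * geom s (C.wt b j) * geom s (C.wt b (j + 1)) else 0) := by
    rw [Finset.sum_range]
    refine hasSum_fintype_prod (fun j => ?_) (fun x => ?_)
    · simp only
      split_ifs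
      · exact C.hasSum_sheet hw hs j
      · exact hasSum_zero
    · dsimp only; split_ifs
      · exact (hg _).le
      · exact le_rfl
  have h0 : HasSum (fun x : Fin C.n × (ℕ × ℕ) => if C.v x.1 = v then
        (if x.2.2 = 0 then 0 else g x) else 0)
      (∑ j ∈ Finset.range C.n, if C.v j = v then
        Real.exp (-(s * C.wt b j)) * geom s (C.wt b j)
        * (Real.exp (-(s * C.wt b (j + 1))) * geom s (C.wt b (j + 1))) else 0) := by
    rw [Finset.sum_range]
    refine hasSum_fintype_prod (fun j => ?_) (fun x => ?_)
    · simp only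
      split_ifs
      · exact C.hasSum_sheet_interior hw hs j
      · exact hasSum_zero
    · dsimp only; split_ifs
      · exact le_rfl
      · exact (hg _).le
      · exact le_rfl
  have hle1 : ∀ x, A.indicator g x ≤ if C.v x.1 = v then g x else 0 := by
    intro x
    by_cases hx : x ∈ A
    · rw [Set.indicator_of_mem hx, if_pos (hA x hx)]
    · rw [Set.indicator_of_notMem hx]
      split_ifs
      · exact (hg x).le
      · exact le_rfl
  have hle0 : ∀ x : Fin C.n × (ℕ × ℕ), (if C.v x.1 = v then
      (if x.2.2 = 0 then 0 else g x) else 0) ≤ A.indicator g x := by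
    intro x
    split_ifs with hx hk
    · exact Set.indicator_nonneg (fun _ _ => (hg _).le) x
    · rw [Set.indicator_of_mem]
      change C.shiftedSheet x ∈ C.polePoints v
      rw [← hx]
      exact C.shiftedSheet_mem x hk
    · exact Set.indicator_nonneg (fun _ _ => (hg _).le) x
  have hsumA : Summable (A.indicator g) :=
    Summable.of_nonneg_of_le (fun x => Set.indicator_nonneg (fun _ _ => (hg _).le) x) hle1
      h1.summable
  refine ⟨∑' x, A.indicator g x, ?_, hasSum_le hle0 h0 hsumA.hasSum,
    hasSum_le hle1 hsumA.hasSum h1⟩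
  have himg : C.polePoints v = C.shiftedSheet '' A := by
    apply Set.Subset.antisymm
    · intro m hm
      obtain ⟨x, -, rfl⟩ := C.polePoints_subset_range hv hm
      exact ⟨x, hm, rfl⟩
    · rintro _ ⟨x, hx, rfl⟩; exact hx
  rw [himg, ← (Equiv.Set.image C.shiftedSheet A C.shiftedSheet_injective).hasSum_iff]
  have h2 : HasSum (fun x : A => g x) (∑' x, A.indicator g x) := by
    rw [← tsum_subtype]
    exact (summable_subtype_iff_indicator.mpr hsumA).hasSum
  refine (h2.mul_left (Real.exp (2 * s))).congr_fun fun x => ?_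
  simp only [Function.comp, Equiv.Set.image_apply, g]
  rw [C.pairing_shiftedSheet hb, ← Real.exp_add]
  congr 1; ring

/-- The volume of the submanifold of a lattice point of the polygon. -/
theorem hasDivisorVolume (hw : ∀ j, 0 < C.wt b j) (hb : b 2 = 2) {v : Fin 2 → ℤ}
    (hv : toReal v ∈ C.polygon) :
    HasDivisorVolume C.polygon b v (4 / 9 * C.facetVol b v) := by
  classical
  have hper := C.wt_periodic b 0
  rw [zero_add] at hper
  have ha := C.vol_pos hw
  have hjet : HasJet (fun s => s ^ 3 * cycleSeries C.n (C.wt b) s) (C.vol b) (C.vol b) :=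
    hasJet_cycleSeries hw hper
  have hex : ∀ s : ℝ, ∃ P : ℝ, 0 < s →
      (HasSum (fun m : C.polePoints v => Real.exp (-(s * pairing (m : Fin 3 → ℤ) b)))
        (Real.exp (2 * s) * P) ∧
      (∑ j ∈ Finset.range C.n, if C.v j = v then
        Real.exp (-(s * C.wt b j)) * geom s (C.wt b j)
        * (Real.exp (-(s * C.wt b (j + 1))) * geom s (C.wt b (j + 1))) else 0) ≤ P ∧
      P ≤ ∑ j ∈ Finset.range C.n, if C.v j = v then
        Real.exp (-(s * C.wt b j)) * geom s (C.wt b j) * geom s (C.wt b (j + 1)) else 0) := by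
    intro s
    by_cases hs : 0 < s
    · obtain ⟨P, hP⟩ := C.hasSum_polePoints hw hb hs hv
      exact ⟨P, fun _ => hP⟩
    · exact ⟨0, fun h => absurd h hs⟩
  choose P hP using hex
  have hlim : Tendsto (fun s => s ^ 2 * P s) (𝓝[>] 0) (𝓝 (C.facetVol b v)) := by
    have hform : C.facetVol b v = ∑ j ∈ Finset.range C.n,
        if C.v j = v then (C.wt b j)⁻¹ * (C.wt b (j + 1))⁻¹ else 0 := by
      rw [facetVol]
      refine Finset.sum_congr rfl fun j _ => ?_
      rw [one_div, mul_inv]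
    have hlow : Tendsto (fun s => ∑ j ∈ Finset.range C.n, if C.v j = v then
        (s * (Real.exp (-(s * C.wt b j)) * geom s (C.wt b j)))
        * (s * (Real.exp (-(s * C.wt b (j + 1))) * geom s (C.wt b (j + 1)))) else 0)
        (𝓝[>] 0) (𝓝 (C.facetVol b v)) := by
      rw [hform]
      refine tendsto_finsetSum _ fun j _ => ?_
      split_ifs
      · exact ((hasJet_exp_geom (hw j)).tendsto).mul ((hasJet_exp_geom (hw (j + 1))).tendsto)
      · exact tendsto_const_nhds
    have hupp : Tendsto (fun s => ∑ j ∈ Finset.range C.n, if C.v j = v then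
        (s * (Real.exp (-(s * C.wt b j)) * geom s (C.wt b j)))
        * (s * geom s (C.wt b (j + 1))) else 0)
        (𝓝[>] 0) (𝓝 (C.facetVol b v)) := by
      rw [hform]
      refine tendsto_finsetSum _ fun j _ => ?_
      split_ifs
      · exact ((hasJet_exp_geom (hw j)).tendsto).mul ((hasJet_geom (hw (j + 1))).tendsto)
      · exact tendsto_const_nhds
    refine tendsto_of_tendsto_of_tendsto_of_le_of_le' hlow hupp ?_ ?_
    · filter_upwards [self_mem_nhdsWithin] with s hs
      refine le_trans (le_of_eq ?_) (mul_le_mul_of_nonneg_left (hP s hs).2.1 (sq_nonneg s))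
      rw [Finset.mul_sum]
      refine Finset.sum_congr rfl fun j _ => ?_
      split_ifs <;> ring
    · filter_upwards [self_mem_nhdsWithin] with s hs
      refine le_trans (mul_le_mul_of_nonneg_left (hP s hs).2.2 (sq_nonneg s)) (le_of_eq ?_)
      rw [Finset.mul_sum]
      refine Finset.sum_congr rfl fun j _ => ?_
      split_ifs <;> ring
  -- The difference quotient equals `exp (2 * s) * (s ^ 2 * P s) / (s ^ 3 * g s)`, with `g` the
  -- series of the monoid. The constant 4/9 is `3/2 * 8/27`.
  refine ⟨_, C.facetVol b v / C.vol b, C.hasVolume hw hb, ?_, ?_⟩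
  · have hexp : Tendsto (fun s : ℝ => Real.exp (2 * s)) (𝓝[>] 0) (𝓝 1) := by
      have h1 : Tendsto (fun s : ℝ => Real.exp (2 * s)) (𝓝 0) (𝓝 (Real.exp (2 * 0))) :=
        (by fun_prop : Continuous fun s : ℝ => Real.exp (2 * s)).tendsto 0
      rw [mul_zero, Real.exp_zero] at h1
      exact tendsto_nhdsWithin_of_tendsto_nhds h1
    have h := (hexp.mul hlim).div hjet.tendsto ha.ne'
    rw [one_mul] at h
    have hne := hjet.tendsto.eventually_ne ha.ne'
    refine h.congr' ?_
    filter_upwards [self_mem_nhdsWithin, hne] with s hs hne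
    have hs' : s ≠ 0 := ne_of_gt hs
    have hG : cycleSeries C.n (C.wt b) s ≠ 0 := right_ne_zero_of_mul hne
    have hsum := C.hasSum_dualMonoid hw hb hs
    have hser : divisorSeries C.polygon v b s
        = cycleSeries C.n (C.wt b) s + Real.exp (2 * s) * P s := by
      rw [divisorSeries, ← hsum.tsum_eq, ← (hP s hs).1.tsum_eq, C.divisorPoints_eq hv]
      exact Summable.tsum_union_disjoint (C.disjoint_polePoints hv)
        (f := fun m : Fin 3 → ℤ => Real.exp (-(s * pairing m b))) hsum.summable
        (hP s hs).1.summable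
    rw [hser, C.hilbertSeries_toricIdeal hw hb hs]
    simp only [Pi.div_apply]
    field_simp
    ring
  · have := ha.ne'
    field_simp
    ring

end LatticeCycle

/-! ### Polygons with a prescribed centroid -/

section Polygon

variable {n : ℕ} {X Y : ℕ → ℝ}

/-- Twice the signed area of the triangle spanned by `(x, y)` and the `j`-th edge. -/
def edgeArea (X Y : ℕ → ℝ) (x y : ℝ) (j : ℕ) : ℝ :=
  (X j - x) * (Y (j + 1) - y) - (Y j - y) * (X (j + 1) - x)

/-- Moving the apex of a fan changes its signed area by a term depending only on the endpoints of
the path, hence by nothing for a closed path. -/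
lemma sum_Ico_edgeArea {k n : ℕ} (hk : k ≤ n) (x y : ℝ) :
    ∑ j ∈ Finset.Ico k n, edgeArea X Y x y j
      = ∑ j ∈ Finset.Ico k n, edgeArea X Y 0 0 j
        - (x * (Y n - Y k) - y * (X n - X k)) := by
  rw [← Finset.sum_Ico_sub Y hk, ← Finset.sum_Ico_sub X hk, Finset.mul_sum, Finset.mul_sum,
    ← Finset.sum_sub_distrib, ← Finset.sum_sub_distrib]
  refine Finset.sum_congr rfl fun j _ => ?_
  simp only [edgeArea]; ring

lemma sum_edgeArea (hX : X n = X 0) (hY : Y n = Y 0) (x y : ℝ) :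
    ∑ j ∈ Finset.range n, edgeArea X Y x y j = ∑ j ∈ Finset.range n, edgeArea X Y 0 0 j := by
  have := sum_Ico_edgeArea (X := X) (Y := Y) (Nat.zero_le n) x y
  rw [hX, hY, sub_self, sub_self, mul_zero, mul_zero, sub_self, sub_zero] at this
  rw [Finset.range_eq_Ico, this]

/-- Both sides are six times the integral of the affine function `γ + α x + β y` over the polygon:
on a triangle it is the area times the mean of the vertex values. -/
lemma sum_edgeArea_moment (hX : X n = X 0) (hY : Y n = Y 0) (x y α β γ : ℝ) :
    ∑ j ∈ Finset.range n, edgeArea X Y x y j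
        * (3 * γ + α * (x + X j + X (j + 1)) + β * (y + Y j + Y (j + 1)))
      = ∑ j ∈ Finset.range n, edgeArea X Y 0 0 j
        * (3 * γ + α * (X j + X (j + 1)) + β * (Y j + Y (j + 1))) := by
  have htel := Finset.sum_range_sub (fun j => -(x * Y j - y * X j)
    * (3 * γ + α * (x + X j) + β * (y + Y j))) n
  rw [hX, hY, sub_self] at htel
  refine sub_eq_zero.mp (Eq.trans ?_ htel)
  rw [← Finset.sum_sub_distrib]
  refine Finset.sum_congr rfl fun j _ => ?_
  simp only [edgeArea]; ring

end Polygon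

lemma sum_range_shift {f : ℕ → ℝ} {n : ℕ} (hf : ∀ j, f (j + n) = f j) (r : ℕ) :
    ∑ j ∈ Finset.range n, f (j + r) = ∑ j ∈ Finset.range n, f j := by
  induction r with
  | zero => simp
  | succ r ih =>
    rw [← ih]
    have h := Finset.sum_range_sub (fun j => f (j + r)) n
    rw [Finset.sum_sub_distrib, show n + r = r + n by ring, hf, zero_add, sub_self] at h
    rw [← sub_eq_zero, ← h]
    congr 1
    exact Finset.sum_congr rfl fun j _ => by congr 1; ring

/-! ### The centroid condition and the two extremal bounds. -/

namespace LatticeCycle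

variable (C : LatticeCycle) {b : Fin 3 → ℝ}

/-- Criticality of `b` for the volume: the polygon with vertices `u j / wt b j` has its centroid at
the origin. -/
def Critical (b : Fin 3 → ℝ) : Prop := ∀ d₀ d₁ : ℝ,
  ∑ j ∈ Finset.range C.n, 1 / (C.wt b j * C.wt b (j + 1)) *
    ((C.u j 0 * d₀ + C.u j 1 * d₁) / C.wt b j
      + (C.u (j + 1) 0 * d₀ + C.u (j + 1) 1 * d₁) / C.wt b (j + 1)) = 0

lemma det_real (j : ℕ) : (C.u j 0 : ℝ) * C.u (j + 1) 1 - C.u j 1 * C.u (j + 1) 0 = 1 := by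
  have := C.det_eq j
  simp only [det2] at this
  exact_mod_cast this

lemma edgeArea_zero (hw : ∀ j, 0 < C.wt b j) (j : ℕ) :
    edgeArea (fun j => C.u j 0 / C.wt b j) (fun j => C.u j 1 / C.wt b j) 0 0 j
      = 1 / (C.wt b j * C.wt b (j + 1)) := by
  have h1 := (hw j).ne'
  have h2 := (hw (j + 1)).ne'
  rw [← C.det_real j]
  simp only [edgeArea]
  field_simp
  ring

/-- Turns heights into areas: the height of `m` at `v j` over its weight is, up to the factor `b 2 =
2`, the area of the triangle seen from `m` relative to that seen from the origin. -/
lemma edgeArea_eq (hw : ∀ j, 0 < C.wt b j) (hb : b 2 = 2) (m : Fin 3 → ℤ)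
    (hm : 0 < pairing m b) (j : ℕ) :
    edgeArea (fun j => C.u j 0 / C.wt b j) (fun j => C.u j 1 / C.wt b j)
      (m 0 / pairing m b) (m 1 / pairing m b) j
      = 2 * height m (C.v j) / pairing m b * (1 / (C.wt b j * C.wt b (j + 1))) := by
  have h1 := (hw j).ne'
  have h2 := (hw (j + 1)).ne'
  have h3 := hm.ne'
  have hh : (height m (C.v j) : ℝ) = m 0 * (C.u j 1 - C.u (j + 1) 1)
      + m 1 * (C.u (j + 1) 0 - C.u j 0)
      + m 2 * ((C.u j 0 : ℝ) * C.u (j + 1) 1 - C.u j 1 * C.u (j + 1) 0) := by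
    rw [C.det_real, height, C.v_eq]; simp
  rw [hh]
  have e1 : edgeArea (fun j => C.u j 0 / C.wt b j) (fun j => C.u j 1 / C.wt b j)
      (m 0 / pairing m b) (m 1 / pairing m b) j = 1 / (pairing m b * C.wt b j * C.wt b (j + 1)) *
      (C.u j 0 * C.u (j + 1) 1 * pairing m b - C.u j 1 * C.u (j + 1) 0 * pairing m b
        - m 0 * (C.u (j + 1) 1 * C.wt b j - C.u j 1 * C.wt b (j + 1))
        + m 1 * (C.u (j + 1) 0 * C.wt b j - C.u j 0 * C.wt b (j + 1))) := by
    simp only [edgeArea]; field_simp; ring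
  rw [e1]
  have e2 : (C.u j 0 * C.u (j + 1) 1 * pairing m b - C.u j 1 * C.u (j + 1) 0 * pairing m b
        - m 0 * (C.u (j + 1) 1 * C.wt b j - C.u j 1 * C.wt b (j + 1))
        + m 1 * (C.u (j + 1) 0 * C.wt b j - C.u j 0 * C.wt b (j + 1)))
      = 2 * (m 0 * (C.u j 1 - C.u (j + 1) 1)
      + m 1 * (C.u (j + 1) 0 - C.u j 0)
      + m 2 * ((C.u j 0 : ℝ) * C.u (j + 1) 1 - C.u j 1 * C.u (j + 1) 0)) := by
    simp only [pairing, wt, Fin.sum_univ_three, hb]; ring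
  rw [e2]
  field_simp

lemma two_vol : 2 * C.vol b = ∑ j ∈ Finset.range C.n, 1 / (C.wt b j * C.wt b (j + 1)) := by
  rw [vol, leadingCoeff]; ring

/-- The facet normals, weighted by the facet volumes, add up to a multiple of `b`. -/
lemma sum_height (hw : ∀ j, 0 < C.wt b j) (hb : b 2 = 2) (m : Fin 3 → ℤ) (hm : 0 < pairing m b) :
    ∑ j ∈ Finset.range C.n, height m (C.v j) * (1 / (C.wt b j * C.wt b (j + 1)))
      = C.vol b * pairing m b := by
  have hper := C.wt_periodic b 0
  have hu := C.periodic 0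
  rw [zero_add] at hper hu
  have h := sum_edgeArea (n := C.n) (X := fun j => C.u j 0 / C.wt b j)
    (Y := fun j => C.u j 1 / C.wt b j) (by simp only [hper, hu]) (by simp only [hper, hu])
    (m 0 / pairing m b) (m 1 / pairing m b)
  simp only [C.edgeArea_zero hw, C.edgeArea_eq hw hb m hm] at h
  rw [← two_vol] at h
  have h2 : ∑ j ∈ Finset.range C.n, 2 * height m (C.v j) / pairing m b
      * (1 / (C.wt b j * C.wt b (j + 1))) = 2 / pairing m b *
      ∑ j ∈ Finset.range C.n, height m (C.v j) * (1 / (C.wt b j * C.wt b (j + 1))) := by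
    rw [Finset.mul_sum]; exact Finset.sum_congr rfl fun j _ => by ring
  rw [h2, div_mul_eq_mul_div, div_eq_iff hm.ne'] at h
  linarith

/-- On the section of weight one the third coordinate is `(1 - b 0 x - b 1 y) / 2`, so the
normalised height is affine in the plane, with value 1/2 at the origin. -/
lemma height_div (hb : b 2 = 2) (m : Fin 3 → ℤ) (v : Fin 2 → ℤ) (hm : 0 < pairing m b) :
    1 / 2 + (v 0 - b 0 / 2) * (m 0 / pairing m b) + (v 1 - b 1 / 2) * (m 1 / pairing m b)
      = height m v / pairing m b := by
  have h := hm.ne'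
  field_simp
  simp only [pairing, Fin.sum_univ_three, height, hb]
  push_cast
  ring

/-- The point `(u j, 1)`. -/
lemma pairing_sheet_zero (b : Fin 3 → ℝ) (j : ℕ) : pairing (C.sheet j 0 0) b = C.wt b j := by
  rw [pairing_sheet]; simp

/-- The first moment of a height function on the polygon, computed from any apex. -/
lemma sum_moment (hw : ∀ j, 0 < C.wt b j) (hb : b 2 = 2) (hc : C.Critical b) (v : Fin 2 → ℤ)
    (m : Fin 3 → ℤ) (hm : 0 < pairing m b) :
    ∑ j ∈ Finset.range C.n, 2 * height m (C.v j) / pairing m b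
      * (1 / (C.wt b j * C.wt b (j + 1)))
      * (height m v / pairing m b + height (C.sheet j 0 0) v / C.wt b j
        + height (C.sheet (j + 1) 0 0) v / C.wt b (j + 1)) = 3 * C.vol b := by
  have hper := C.wt_periodic b 0
  have hu := C.periodic 0
  rw [zero_add] at hper hu
  have h := sum_edgeArea_moment (n := C.n) (X := fun j => C.u j 0 / C.wt b j)
    (Y := fun j => C.u j 1 / C.wt b j) (by simp only [hper, hu]) (by simp only [hper, hu])
    (m 0 / pairing m b) (m 1 / pairing m b) (v 0 - b 0 / 2) (v 1 - b 1 / 2) (1 / 2)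
  simp only [C.edgeArea_zero hw, C.edgeArea_eq hw hb m hm] at h
  -- The gradient of the normalised height: as the centroid is the origin, only the constant 1/2
  -- contributes to its first moment.
  have hcr := hc (v 0 - b 0 / 2) (v 1 - b 1 / 2)
  have hR : ∑ j ∈ Finset.range C.n, 1 / (C.wt b j * C.wt b (j + 1)) *
      (3 * (1 / 2) + (v 0 - b 0 / 2) * (C.u j 0 / C.wt b j + C.u (j + 1) 0 / C.wt b (j + 1))
        + (v 1 - b 1 / 2) * (C.u j 1 / C.wt b j + C.u (j + 1) 1 / C.wt b (j + 1)))
      = 3 * C.vol b := by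
    have : 3 * C.vol b = 3 / 2 * (2 * C.vol b) := by ring
    rw [this, two_vol, ← add_zero (3 / 2 * _), ← hcr, Finset.mul_sum, ← Finset.sum_add_distrib]
    refine Finset.sum_congr rfl fun j _ => ?_
    ring
  rw [hR] at h
  rw [← h]
  refine Finset.sum_congr rfl fun j _ => ?_
  have hd : ∀ j, (height (C.sheet j 0 0) v : ℝ) / C.wt b j = 1 / 2
      + (v 0 - b 0 / 2) * (C.u j 0 / C.wt b j) + (v 1 - b 1 / 2) * (C.u j 1 / C.wt b j) := by
    intro j
    have := height_div hb (C.sheet j 0 0) v (by rw [C.pairing_sheet_zero]; exact hw j)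
    rw [C.pairing_sheet_zero] at this
    rw [← this]
    simp [sheet]
  rw [hd, hd, ← height_div hb m v hm]
  ring

lemma height_sheet_nonneg' {v : Fin 2 → ℤ} (hv : toReal v ∈ C.polygon) (j : ℕ) :
    0 ≤ height (C.sheet j 0 0) v := by
  rw [mem_polygon_iff] at hv
  rw [height_sheet]
  have h1 := hv j
  simp; linarith

/-- At a critical Reeb vector every height is at most `3/2` of the weight. -/
theorem height_le (hw : ∀ j, 0 < C.wt b j) (hb : b 2 = 2) (hc : C.Critical b) {v : Fin 2 → ℤ}
    (hv : toReal v ∈ C.polygon) (m : dualMonoid C.polygon) (hm : m ≠ 0) :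
    height m v ≤ 3 / 2 * pairing (m : Fin 3 → ℤ) b := by
  have hp := C.pairing_pos hw hb m hm
  have hvol := C.vol_pos hw
  have h1 := C.sum_moment hw hb hc v m hp
  have h2 := C.sum_height hw hb m hp
  -- In the fan with apex `m` the other two vertex values are nonnegative and can be dropped. The
  -- remaining sum of areas is evaluated by `sum_height`.
  have h3 : ∑ j ∈ Finset.range C.n, 2 * height m (C.v j) / pairing (m : Fin 3 → ℤ) b
      * (1 / (C.wt b j * C.wt b (j + 1))) * (height m v / pairing (m : Fin 3 → ℤ) b)
      ≤ 3 * C.vol b := by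
    rw [← h1]
    refine Finset.sum_le_sum fun j _ => mul_le_mul_of_nonneg_left ?_ ?_
    · have e1 : (0 : ℝ) ≤ height (C.sheet j 0 0) v := by exact_mod_cast C.height_sheet_nonneg' hv j
      have e2 : (0 : ℝ) ≤ height (C.sheet (j + 1) 0 0) v := by
        exact_mod_cast C.height_sheet_nonneg' hv (j + 1)
      have := div_nonneg e1 (hw j).le
      have := div_nonneg e2 (hw (j + 1)).le
      linarith
    · have e1 : (0 : ℝ) ≤ height m (C.v j) := by
        exact_mod_cast (C.mem_dualMonoid_iff _).mp m.2 j
      have := hw j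
      have := hw (j + 1)
      positivity
  have h4 : ∑ j ∈ Finset.range C.n, 2 * height m (C.v j) / pairing (m : Fin 3 → ℤ) b
      * (1 / (C.wt b j * C.wt b (j + 1))) * (height m v / pairing (m : Fin 3 → ℤ) b)
      = 2 / pairing (m : Fin 3 → ℤ) b * (height m v / pairing (m : Fin 3 → ℤ) b)
        * (C.vol b * pairing (m : Fin 3 → ℤ) b) := by
    rw [← h2, Finset.mul_sum]; exact Finset.sum_congr rfl fun j _ => by ring
  rw [h4] at h3
  field_simp at h3
  linarith

/-! ### The volume of a facet -/

/-- The lattice cycle started at its `r`-th point. -/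
def rotate (r : ℕ) : LatticeCycle where
  n := C.n
  n_pos := C.n_pos
  u := fun j => C.u (j + r)
  v := fun j => C.v (j + r)
  periodic := fun j => by rw [show j + C.n + r = j + r + C.n by ring, C.periodic]
  inj := fun i j hi hj h => by
    rw [← C.u_mod, ← C.u_mod (j + r)] at h
    have h1 := C.inj _ _ (Nat.mod_lt _ C.n_pos) (Nat.mod_lt _ C.n_pos) h
    have h2 : i ≡ j [MOD C.n] := Nat.ModEq.add_right_cancel' r h1
    rwa [Nat.ModEq, Nat.mod_eq_of_lt hi, Nat.mod_eq_of_lt hj] at h2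
  det_eq := fun j => by rw [show j + 1 + r = j + r + 1 by ring]; exact C.det_eq _
  dot_left := fun j => C.dot_left _
  dot_right := fun j => by rw [show j + 1 + r = j + r + 1 by ring]; exact C.dot_right _
  dot_ge := fun i j => C.dot_ge _ _

lemma wt_rotate (r j : ℕ) : (C.rotate r).wt b j = C.wt b (j + r) := rfl

lemma vol_rotate (r : ℕ) : (C.rotate r).vol b = C.vol b := by
  simp only [vol, leadingCoeff, wt_rotate]
  have := sum_range_shift (f := fun j => 1 / (C.wt b j * C.wt b (j + 1))) (n := C.n) (fun j => by
    simp only [show j + C.n + 1 = j + 1 + C.n by ring, C.wt_periodic]) r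
  rw [← this]
  congr 1
  refine Finset.sum_congr rfl fun j _ => ?_
  rw [show j + 1 + r = j + r + 1 by ring]

lemma facetVol_rotate (r : ℕ) (v : Fin 2 → ℤ) : (C.rotate r).facetVol b v = C.facetVol b v := by
  simp only [facetVol, wt_rotate]
  have := sum_range_shift (f := fun j => if C.v j = v then 1 / (C.wt b j * C.wt b (j + 1)) else 0)
    (n := C.n) (fun j => by
    simp only [show j + C.n + 1 = j + 1 + C.n by ring, C.wt_periodic, C.v_periodic]) r
  rw [← this]
  refine Finset.sum_congr rfl fun j _ => ?_
  rw [show j + 1 + r = j + r + 1 by ring]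
  rfl

lemma critical_rotate (r : ℕ) (hc : C.Critical b) : (C.rotate r).Critical b := by
  intro d₀ d₁
  rw [← hc d₀ d₁]
  have := sum_range_shift (f := fun j => 1 / (C.wt b j * C.wt b (j + 1)) *
    ((C.u j 0 * d₀ + C.u j 1 * d₁) / C.wt b j
      + (C.u (j + 1) 0 * d₀ + C.u (j + 1) 1 * d₁) / C.wt b (j + 1)))
    (n := C.n) (fun j => by
    simp only [show j + C.n + 1 = j + 1 + C.n by ring, C.wt_periodic, C.periodic]) r
  rw [← this]
  refine Finset.sum_congr rfl fun j _ => ?_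
  change 1 / (C.wt b (j + r) * C.wt b (j + 1 + r)) *
    ((C.u (j + r) 0 * d₀ + C.u (j + r) 1 * d₁) / C.wt b (j + r)
      + (C.u (j + 1 + r) 0 * d₀ + C.u (j + 1 + r) 1 * d₁) / C.wt b (j + 1 + r)) = _
  rw [show j + 1 + r = j + r + 1 by ring]

/-- The edges with a given normal that ends at the base point form a final segment. -/
lemma v_succ_eq {v : Fin 2 → ℤ} (hlast : C.v (C.n - 1) = v) (h0 : C.v 0 ≠ v) {j : ℕ}
    (hj : C.v j = v) (hjn : j + 1 < C.n) : C.v (j + 1) = v := by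
  by_contra hne
  have hn : C.n - 1 + 1 = C.n := by omega
  have hun : C.u (C.n - 1 + 1) = C.u 0 := by
    rw [hn]; have := C.periodic 0; rwa [zero_add] at this
  -- Where the path leaves an edge with normal `v`, the normal turns strictly counterclockwise.
  have key : ∀ i i', C.v i = v → C.u (i + 1) = C.u i' → C.v i' ≠ v →
      v 1 * C.v i' 0 - v 0 * C.v i' 1 < 0 := by
    intro i i' hi hii hne
    have h1 := C.u_add_one i
    rw [hi, hii] at h1
    have g0 := congrFun h1 0
    have g1 := congrFun h1 1
    simp at g0 g1
    have h2 := C.dot_ge i i'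
    have h3 := C.dot_left i'
    have h4 : dot2 (C.u i) (C.v i') = -1 - (v 1 * C.v i' 0 - v 0 * C.v i' 1) := by
      rw [← h3]; simp only [dot2]; rw [g0, g1]; ring
    rcases lt_or_eq_of_le (by linarith : v 1 * C.v i' 0 - v 0 * C.v i' 1 ≤ 0) with h | h
    · exact h
    · exfalso
      apply hne
      rw [← hi]
      apply eq_of_dot (C.det_eq i)
      · rw [h4, h, C.dot_left]; ring
      · rw [C.dot_right, hii, h3]
  have k1 := key j (j + 1) hj rfl hne
  have k2 := key (C.n - 1) 0 hlast hun h0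
  have d1 : dot2 (C.u (j + 1)) v = -1 := by rw [← hj]; exact C.dot_right j
  have d2 : dot2 (C.u 0) v = -1 := by rw [← hun, ← hlast]; exact C.dot_right _
  obtain ⟨t, ht⟩ : ∃ t, t = det2 (C.u (j + 1)) (C.u 0) := ⟨_, rfl⟩
  simp only [dot2, det2] at d1 d2 ht
  have t0 : C.u 0 0 = C.u (j + 1) 0 + t * v 1 := by
    rw [ht]; linear_combination C.u 0 0 * d1 - C.u (j + 1) 0 * d2
  have t1 : C.u 0 1 = C.u (j + 1) 1 - t * v 0 := by
    rw [ht]; linear_combination C.u 0 1 * d1 - C.u (j + 1) 1 * d2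
  have e1 := C.dot_ge 0 (j + 1)
  have e2 := C.dot_ge (j + 1) 0
  have f1 := C.dot_left (j + 1)
  have f2 := C.dot_left 0
  simp only [dot2] at e1 e2 f1 f2
  have g1 : 0 ≤ t * (v 1 * C.v (j + 1) 0 - v 0 * C.v (j + 1) 1) := by
    rw [t0, t1] at e1; linarith
  have g2 : t * (v 1 * C.v 0 0 - v 0 * C.v 0 1) ≤ 0 := by
    rw [t0, t1] at f2; linarith
  -- Both `u (j + 1)` and `u 0` are final endpoints of the same edge line, so neither lies beyond
  -- the other; injectivity within the period then gives a contradiction.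
  have tz : t = 0 := by
    apply le_antisymm
    · by_contra h; nlinarith
    · by_contra h; nlinarith
  have : C.u 0 = C.u (j + 1) := by
    apply fin2_ext
    · rw [t0, tz]; ring
    · rw [t1, tz]; ring
  have := C.inj _ _ C.n_pos hjn this
  omega

/-- With base point at the end of the edge normal to `v`, let `R k` be twice the area of the part of
the polygon from vertex `k` onwards and `ξ` the normalised height over that edge. The part contains
the triangle from vertex `k` to the edge, whence `2 c ξ k ≤ R k`. Inserting this into the first
moment of `ξ` gives a telescoping sum of squares. -/
lemma facetVol_le_aux (hw : ∀ j, 0 < C.wt b j) (hb : b 2 = 2) (hc : C.Critical b)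
    {v : Fin 2 → ℤ} (hlast : C.v (C.n - 1) = v) (h0 : C.v 0 ≠ v) :
    C.facetVol b v ≤ 2 / 3 * C.vol b := by
  have hv : toReal v ∈ C.polygon := by rw [← hlast]; exact C.toReal_v_mem _
  have hn : C.n - 1 + 1 = C.n := by have := C.n_pos; omega
  have hun : C.u C.n = C.u 0 := by have := C.periodic 0; rwa [zero_add] at this
  have hwn : C.wt b C.n = C.wt b 0 := by have := C.wt_periodic b 0; rwa [zero_add] at this
  have hvol := C.vol_pos hw
  set t : ℕ → ℝ := fun j => 1 / (C.wt b j * C.wt b (j + 1)) with ht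
  have htpos : ∀ j, 0 < t j := fun j => one_div_pos.mpr (mul_pos (hw _) (hw _))
  set ξ : ℕ → ℝ := fun j => height (C.sheet j 0 0) v / C.wt b j with hξ
  have hξ0 : ∀ j, 0 ≤ ξ j := fun j =>
    div_nonneg (by exact_mod_cast C.height_sheet_nonneg' hv j) (hw j).le
  set X : ℕ → ℝ := fun j => C.u j 0 / C.wt b j with hX
  set Y : ℕ → ℝ := fun j => C.u j 1 / C.wt b j with hY
  have hA : ∀ k j, edgeArea X Y (X k) (Y k) j
      = 2 * height (C.sheet k 0 0) (C.v j) / C.wt b k * t j := by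
    intro k j
    have := C.edgeArea_eq hw hb (C.sheet k 0 0) (by rw [C.pairing_sheet_zero]; exact hw k) j
    rw [C.pairing_sheet_zero] at this
    rw [← this]
    simp [hX, hY, sheet]
  have hA0 : ∀ k j, 0 ≤ edgeArea X Y (X k) (Y k) j := by
    intro k j
    rw [hA]
    have e1 : (0 : ℝ) ≤ height (C.sheet k 0 0) (C.v j) := by
      exact_mod_cast C.height_sheet_nonneg' (C.toReal_v_mem j) k
    have := hw k
    have := htpos j
    positivity
  set R : ℕ → ℝ := fun k => ∑ j ∈ Finset.Ico k C.n, edgeArea X Y (X 0) (Y 0) j with hR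
  have hRk : ∀ k ≤ C.n, R k = ∑ j ∈ Finset.Ico k C.n, edgeArea X Y (X k) (Y k) j := by
    intro k hk
    simp only [hR]
    rw [sum_Ico_edgeArea hk (X 0), sum_Ico_edgeArea hk (X k)]
    have e1 : X C.n = X 0 := by simp only [hX, hun, hwn]
    have e2 : Y C.n = Y 0 := by simp only [hY, hun, hwn]
    rw [e1, e2]; ring
  have hfin : ∀ j, C.v j = v → ∀ d, j + d < C.n → C.v (j + d) = v := by
    intro j hj d
    induction d with
    | zero => intro _; exact hj
    | succ d ih => intro hd; exact C.v_succ_eq hlast h0 (ih (by omega)) hd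
  set c := C.facetVol b v with hcdef
  -- If `ξ k ≠ 0`, the edges normal to `v`, a final segment, all come after vertex `k`. The
  -- remainder is a closed polygon, so `hRk` allows `k` as apex, and these edges contribute exactly
  -- `2 c ξ k`.
  have hmain : ∀ k ≤ C.n, 2 * c * ξ k ≤ R k := by
    intro k hk
    by_cases hz : ξ k = 0
    · rw [hz, mul_zero, hRk k hk]
      exact Finset.sum_nonneg fun j _ => hA0 k j
    · have hI : ∀ j < k, C.v j ≠ v := by
        intro j hj hjv
        apply hz
        have hhz : height (C.sheet k 0 0) v = 0 := by
          rcases Nat.lt_or_ge k C.n with hkn | hkn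
          · have := hfin j hjv (k - j) (by omega)
            rw [show j + (k - j) = k by omega] at this
            rw [← this]
            exact C.height_sheet_self k 0 0
          · obtain rfl : k = C.n := le_antisymm hk hkn
            rw [height_sheet]
            have := C.dot_right (C.n - 1)
            rw [hn, hlast] at this
            rw [this]; simp
        simp only [hξ, hhz]; simp
      rw [hRk k hk, hcdef, facetVol, Finset.range_eq_Ico,
        ← Finset.sum_Ico_consecutive _ (Nat.zero_le k) hk]
      rw [Finset.sum_eq_zero (s := Finset.Ico 0 k) (fun j hj => by
        rw [if_neg (hI j (Finset.mem_Ico.mp hj).2)]), zero_add, Finset.mul_sum, Finset.sum_mul]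
      refine Finset.sum_le_sum fun j _ => ?_
      split_ifs with hj
      · rw [hA, hj]
        apply le_of_eq
        simp only [hξ, ht]; ring
      · simpa using hA0 k j
  have hmom := C.sum_moment hw hb hc v (C.sheet 0 0 0) (by
    rw [C.pairing_sheet_zero]; exact hw 0)
  rw [C.pairing_sheet_zero] at hmom
  have hξp : (height (C.sheet 0 0 0) v : ℝ) = 0 := by
    have h1 := C.dot_right (C.n - 1)
    rw [hn, hlast, hun] at h1
    rw [height_sheet, h1]; simp
  have hmom' : ∑ j ∈ Finset.range C.n, edgeArea X Y (X 0) (Y 0) j * (ξ j + ξ (j + 1))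
      = 3 * C.vol b := by
    rw [← hmom]
    refine Finset.sum_congr rfl fun j _ => ?_
    rw [hA, hξp]
    simp only [hξ, ht]
    ring
  have hR0 : R 0 = 2 * C.vol b := by
    have := sum_edgeArea (n := C.n) (X := X) (Y := Y) (by simp only [hX, hun, hwn])
      (by simp only [hY, hun, hwn]) (X 0) (Y 0)
    rw [two_vol]
    simp only [hR]
    rw [← Finset.range_eq_Ico, this]
    exact Finset.sum_congr rfl fun j _ => C.edgeArea_zero hw j
  have hRn : R C.n = 0 := by simp [hR]
  have hstep : ∀ j < C.n, R j = edgeArea X Y (X 0) (Y 0) j + R (j + 1) := fun j hj =>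
    Finset.sum_eq_sum_Ico_succ_bot hj _
  have hsq : ∑ j ∈ Finset.range C.n, edgeArea X Y (X 0) (Y 0) j * (R j + R (j + 1))
      = R 0 ^ 2 := by
    have htel := Finset.sum_range_sub (fun j => R j ^ 2) C.n
    simp only [hRn] at htel
    have : R 0 ^ 2 = -∑ j ∈ Finset.range C.n, (R (j + 1) ^ 2 - R j ^ 2) := by rw [htel]; ring
    rw [this, ← Finset.sum_neg_distrib]
    refine Finset.sum_congr rfl fun j hj => ?_
    rw [hstep j (Finset.mem_range.mp hj)]; ring
  -- The edge areas are `R j - R (j + 1)`, so weighting by `R j + R (j + 1)` sums to `R 0 ^ 2`, the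
  -- square of twice the total area.
  have hle : 2 * c * (3 * C.vol b) ≤ (2 * C.vol b) ^ 2 := by
    rw [← hR0, ← hsq, ← hmom', Finset.mul_sum]
    refine Finset.sum_le_sum fun j hj => ?_
    have hj' := Finset.mem_range.mp hj
    have e1 := hmain j hj'.le
    have e2 := hmain (j + 1) hj'
    have e3 := mul_le_mul_of_nonneg_left (add_le_add e1 e2) (hA0 0 j)
    linarith
  nlinarith

/-- At a critical Reeb vector no facet carries more than a third of the boundary volume. -/
theorem facetVol_le (hw : ∀ j, 0 < C.wt b j) (hb : b 2 = 2) (hc : C.Critical b)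
    (v : Fin 2 → ℤ) : C.facetVol b v ≤ 2 / 3 * C.vol b := by
  have hvol := C.vol_pos hw
  by_cases hex : ∃ j, C.v j = v
  -- Rotating the cycle to start right after such an `i` produces the base point required by
  -- `facetVol_le_aux`.
  · have hend : ∃ i, C.v i = v ∧ C.v (i + 1) ≠ v := by
      by_contra hcon
      push Not at hcon
      obtain ⟨j, hj⟩ := hex
      have hall : ∀ d, C.v (j + d) = v := by
        intro d
        induction d with
        | zero => exact hj
        | succ d ih => exact hcon _ ih
      obtain ⟨k, hk⟩ := C.exists_v_ne v
      apply hk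
      rw [← C.v_mod k, ← hall (k + j * (C.n - 1)), ← C.v_mod (j + _)]
      congr 1
      obtain ⟨m, hm⟩ : ∃ m, C.n = m + 1 := ⟨C.n - 1, by have := C.n_pos; omega⟩
      rw [hm, show j + (k + j * (m + 1 - 1)) = k + j * (m + 1) by simp; ring]
      simp
    obtain ⟨i, hi, hi'⟩ := hend
    rw [← C.facetVol_rotate (i + 1), ← C.vol_rotate (i + 1)]
    apply (C.rotate (i + 1)).facetVol_le_aux (fun j => hw _) hb (C.critical_rotate _ hc)
    · change C.v (C.n - 1 + (i + 1)) = v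
      rw [show C.n - 1 + (i + 1) = i + C.n by have := C.n_pos; omega, C.v_periodic, hi]
    · change C.v (0 + (i + 1)) ≠ v
      rwa [zero_add]
  · push Not at hex
    have : C.facetVol b v = 0 := by
      rw [facetVol]
      exact Finset.sum_eq_zero fun j _ => by rw [if_neg (hex j)]
    rw [this]; positivity

end LatticeCycle
namespace LatticeCycle

variable (C : LatticeCycle) {b : Fin 3 → ℝ}

/-! ### The volume minimizing Reeb vector -/

lemma continuous_wt (j : ℕ) : Continuous fun b => C.wt b j := by
  unfold wt; fun_prop

lemma wt_mod (b : Fin 3 → ℝ) (j : ℕ) : C.wt b (j % C.n) = C.wt b j := by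
  simp only [wt, C.u_mod]

lemma wt_nonneg_of_mem_cone {x : Fin 3 → ℝ} (hx : x ∈ cone C.polygon) (j : ℕ) :
    0 ≤ C.wt x j := by
  obtain ⟨c, hc, y, hy, rfl⟩ := hx
  have h := hy j
  have : C.wt (c • lift y) j = c * (C.u j 0 * y 0 + C.u j 1 * y 1 + 1) := by
    simp [wt, lift]; ring
  rw [this]
  exact mul_nonneg hc (by linarith)

lemma mem_reebVectors_iff : b ∈ reebVectors C.polygon ↔ b 2 = 2 ∧ ∀ j, 0 < C.wt b j := by
  constructor
  · rintro ⟨hint, h2⟩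
    refine ⟨h2, fun j => ?_⟩
    -- Subtracting a small multiple of `(u j, 1)` from an interior point stays in the cone and
    -- strictly lowers the weight of `u j`, which must therefore be positive.
    let y : Fin 3 → ℝ := ![C.u j 0, C.u j 1, 1]
    have hcont : Tendsto (fun t : ℝ => b - t • y) (𝓝[>] 0) (𝓝 (b - (0 : ℝ) • y)) :=
      tendsto_nhdsWithin_of_tendsto_nhds
        ((by fun_prop : Continuous fun t : ℝ => b - t • y).tendsto 0)
    rw [zero_smul, sub_zero] at hcont
    have hev := hcont.eventually (mem_interior_iff_mem_nhds.mp hint)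
    obtain ⟨t, ht, htpos⟩ := (hev.and self_mem_nhdsWithin).exists
    have h := C.wt_nonneg_of_mem_cone ht j
    have he : C.wt (b - t • y) j
        = C.wt b j - t * ((C.u j 0 : ℝ) * C.u j 0 + C.u j 1 * C.u j 1 + 1) := by
      simp [wt, y]; ring
    rw [he] at h
    have htpos' : (0 : ℝ) < t := htpos
    have : 0 < t * ((C.u j 0 : ℝ) * C.u j 0 + C.u j 1 * C.u j 1 + 1) :=
      mul_pos htpos' (by nlinarith [mul_self_nonneg (C.u j 0 : ℝ), mul_self_nonneg (C.u j 1 : ℝ)])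
    linarith
  · rintro ⟨h2, hw⟩
    refine ⟨?_, h2⟩
    let O : Set (Fin 3 → ℝ) := {x | 0 < x 2} ∩ ⋂ j ∈ Finset.range C.n, {x | 0 < C.wt x j}
    have hO : IsOpen O := by
      refine (isOpen_lt continuous_const (continuous_apply 2)).inter ?_
      exact isOpen_biInter_finset fun j _ => isOpen_lt continuous_const (C.continuous_wt j)
    refine mem_interior.mpr ⟨O, ?_, hO, ?_, ?_⟩
    · rintro x ⟨hx2, hx⟩
      have hx2' : 0 < x 2 := hx2
      refine ⟨x 2, hx2'.le, ![x 0 / x 2, x 1 / x 2], ?_, ?_⟩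
      · intro j
        have h1 : 0 < C.wt x (j % C.n) := by
          have := Set.mem_iInter₂.mp hx (j % C.n) (Finset.mem_range.mpr (Nat.mod_lt _ C.n_pos))
          exact this
        rw [C.wt_mod] at h1
        have h3 : C.u j 0 * (x 0 / x 2) + C.u j 1 * (x 1 / x 2) + 1 = C.wt x j / x 2 := by
          rw [wt]; field_simp
        have := div_pos h1 hx2'
        simp
        linarith
      · funext i
        have := hx2'.ne'
        fin_cases i <;> simp [lift] <;> field_simp
    · change 0 < b 2
      rw [h2]; norm_num
    · exact Set.mem_iInter₂.mpr fun j _ => hw j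

/-- The Reeb vectors lie in a box. -/
lemma exists_box : ∃ K : ℝ, ∀ b : Fin 3 → ℝ, b 2 = 2 → (∀ j, 0 ≤ C.wt b j) → ∀ i, |b i| ≤ K := by
  -- Every lattice direction is a nonnegative combination of cycle vectors, each bounded below on
  -- Reeb vectors by -2. The four coordinate directions then give a box.
  have hlow : ∀ p : Fin 2 → ℤ, p ≠ 0 → ∃ K : ℝ, ∀ b : Fin 3 → ℝ, b 2 = 2 → (∀ j, 0 ≤ C.wt b j) →
      -K ≤ p 0 * b 0 + p 1 * b 1 := by
    intro p hp
    obtain ⟨j, -, i, k, hjk⟩ := C.exists_cone p hp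
    refine ⟨2 * (i + 1 + k), fun b hb hw => ?_⟩
    have h1 := mul_nonneg (by positivity : (0 : ℝ) ≤ i + 1) (hw j)
    have h2 := mul_nonneg (by positivity : (0 : ℝ) ≤ k) (hw (j + 1))
    simp only [wt, hb] at h1 h2
    rw [hjk]
    simp
    linarith
  obtain ⟨K1, h1⟩ := hlow ![1, 0] (by intro h; simpa using congrFun h 0)
  obtain ⟨K2, h2⟩ := hlow ![-1, 0] (by intro h; simpa using congrFun h 0)
  obtain ⟨K3, h3⟩ := hlow ![0, 1] (by intro h; simpa using congrFun h 1)
  obtain ⟨K4, h4⟩ := hlow ![0, -1] (by intro h; simpa using congrFun h 1)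
  refine ⟨|K1| + |K2| + |K3| + |K4| + 2, fun b hb hw i => ?_⟩
  have g1 := h1 b hb hw
  have g2 := h2 b hb hw
  have g3 := h3 b hb hw
  have g4 := h4 b hb hw
  simp at g1 g2 g3 g4
  have a1 := le_abs_self K1
  have a2 := le_abs_self K2
  have a3 := le_abs_self K3
  have a4 := le_abs_self K4
  have b1 := abs_nonneg K1
  have b2 := abs_nonneg K2
  have b3 := abs_nonneg K3
  have b4 := abs_nonneg K4
  rw [abs_le]
  fin_cases i
  · constructor <;> simp <;> linarith
  · constructor <;> simp <;> linarith
  · constructor <;> simp [hb] <;> linarith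

lemma continuousOn_vol {s : Set (Fin 3 → ℝ)} (hs : ∀ b ∈ s, ∀ j, 0 < C.wt b j) :
    ContinuousOn C.vol s := by
  unfold vol leadingCoeff
  refine continuousOn_const.mul (continuousOn_finsetSum _ fun j _ => ?_)
  refine continuousOn_const.div
    ((C.continuous_wt j).mul (C.continuous_wt (j + 1))).continuousOn fun b hb => ?_
  exact (mul_pos (hs b hb _) (hs b hb _)).ne'

theorem exists_minimizer : ∃ b, (b 2 = 2 ∧ ∀ j, 0 < C.wt b j) ∧
    ∀ b' : Fin 3 → ℝ, b' 2 = 2 → (∀ j, 0 < C.wt b' j) → C.vol b ≤ C.vol b' := by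
  obtain ⟨K, hK⟩ := C.exists_box
  let B : Set (Fin 3 → ℝ) := Set.Icc (fun _ => -K) (fun _ => K)
  have hB : IsCompact B := isCompact_Icc
  obtain ⟨M, hM⟩ := hB.bddAbove_image (f := fun b => ∑ j ∈ Finset.range C.n, |C.wt b j|)
    (continuous_finsetSum _ fun j _ => (C.continuous_wt j).abs).continuousOn
  have hMw : ∀ b ∈ B, ∀ j, C.wt b j ≤ M := by
    intro b hb j
    rw [← C.wt_mod]
    refine (le_abs_self _).trans ((Finset.single_le_sum (f := fun j => |C.wt b j|)
      (fun _ _ => abs_nonneg _) (Finset.mem_range.mpr (Nat.mod_lt j C.n_pos))).trans ?_)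
    exact hM ⟨b, hb, rfl⟩
  have hinB : ∀ b : Fin 3 → ℝ, b 2 = 2 → (∀ j, 0 < C.wt b j) → b ∈ B := by
    intro b h2 hw
    have := hK b h2 fun j => (hw j).le
    exact ⟨fun i => (abs_le.mp (this i)).1, fun i => (abs_le.mp (this i)).2⟩
  let b₀ : Fin 3 → ℝ := ![0, 0, 2]
  have hb₀ : ∀ j, C.wt b₀ j = 2 := fun j => by simp [wt, b₀]
  have hb₀' : ∀ j, 0 < C.wt b₀ j := fun j => by rw [hb₀]; norm_num
  have hc0 := C.vol_pos hb₀'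
  have hMpos : 0 < M := by
    have := hMw b₀ (hinB b₀ (by simp [b₀]) hb₀') 0
    rw [hb₀] at this; linarith
  -- points with small volume stay away from the boundary
  set δ : ℝ := min 2 (1 / (2 * C.vol b₀ * M)) with hδ
  have hδpos : 0 < δ := lt_min two_pos (by positivity)
  have hfar : ∀ b : Fin 3 → ℝ, b 2 = 2 → (∀ j, 0 < C.wt b j) → C.vol b ≤ C.vol b₀ →
      ∀ j, δ ≤ C.wt b j := by
    intro b h2 hw hle j
    rw [← C.wt_mod]
    set i := j % C.n with hi
    -- One summand is at most the whole sum; with its other factor at most `M`, small volume keeps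
    -- `C.wt b i` away from zero.
    have h1 : 1 / (C.wt b i * C.wt b (i + 1)) ≤ 2 * C.vol b := by
      rw [two_vol]
      exact Finset.single_le_sum (f := fun i => 1 / (C.wt b i * C.wt b (i + 1)))
        (fun j _ => (one_div_pos.mpr (mul_pos (hw _) (hw _))).le)
        (Finset.mem_range.mpr (Nat.mod_lt j C.n_pos))
    have h3 := hMw b (hinB b h2 hw) (i + 1)
    have h4 := hw i
    have h5 := hw (i + 1)
    refine (min_le_right _ _).trans ?_
    rw [div_le_iff₀ (by positivity)] at h1 ⊢
    calc 1 ≤ 2 * C.vol b * (C.wt b i * C.wt b (i + 1)) := h1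
      _ ≤ 2 * C.vol b₀ * (C.wt b i * M) := by gcongr
      _ = C.wt b i * (2 * C.vol b₀ * M) := by ring
  let Kδ : Set (Fin 3 → ℝ) := B ∩ ({b | b 2 = 2} ∩ ⋂ j, {b | δ ≤ C.wt b j})
  have hKc : IsCompact Kδ := by
    refine hB.inter_right (IsClosed.inter ?_ ?_)
    · exact isClosed_eq (continuous_apply 2) continuous_const
    · exact isClosed_iInter fun j => isClosed_le continuous_const (C.continuous_wt j)
  have hKmem : ∀ b : Fin 3 → ℝ, b 2 = 2 → (∀ j, 0 < C.wt b j) → (∀ j, δ ≤ C.wt b j) → b ∈ Kδ :=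
    fun b h2 hw hd => ⟨hinB b h2 hw, h2, Set.mem_iInter.mpr hd⟩
  have hKw : ∀ b ∈ Kδ, ∀ j, 0 < C.wt b j := fun b hb j =>
    lt_of_lt_of_le hδpos (Set.mem_iInter.mp hb.2.2 j)
  -- All weights of `b₀` equal 2, which is why `δ` was capped at 2.
  have hb₀K : b₀ ∈ Kδ := hKmem b₀ (by simp [b₀]) hb₀' fun j => by
    rw [hb₀]; exact min_le_left _ _
  obtain ⟨b, hb, hmin⟩ := hKc.exists_isMinOn ⟨b₀, hb₀K⟩ (C.continuousOn_vol hKw)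
  refine ⟨b, ⟨hb.2.1, hKw b hb⟩, fun b' h2 hw => ?_⟩
  rcases le_total (C.vol b') (C.vol b₀) with h | h
  · exact hmin (hKmem b' h2 hw (hfar b' h2 hw h))
  · exact (hmin hb₀K).trans h

/-- Strict midpoint convexity of 1/(xy) on the positive quadrant, the source of uniqueness of the
minimizer. -/
lemma inv_mul_midpoint {x y x' y' : ℝ} (hx : 0 < x) (hy : 0 < y) (hx' : 0 < x') (hy' : 0 < y') :
    1 / ((x + x') / 2 * ((y + y') / 2)) ≤ (1 / (x * y) + 1 / (x' * y')) / 2 ∧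
      ((x, y) ≠ (x', y') →
        1 / ((x + x') / 2 * ((y + y') / 2)) < (1 / (x * y) + 1 / (x' * y')) / 2) := by
  have e : (1 / (x * y) + 1 / (x' * y')) / 2 - 1 / ((x + x') / 2 * ((y + y') / 2))
      = ((x + x') * (y + y') * (x * y + x' * y') - 8 * (x * y * x' * y'))
        / (2 * (x * y) * (x' * y') * ((x + x') * (y + y'))) := by
    field_simp
    ring
  have hden : 0 < 2 * (x * y) * (x' * y') * ((x + x') * (y + y')) := by positivity
  -- the numerator as a sum of squares
  have hnum : (x + x') * (y + y') * (x * y + x' * y') - 8 * (x * y * x' * y')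
      = (x * y - x' * y') ^ 2 + (x * x') * (y - y') ^ 2 + (y * y') * (x - x') ^ 2 := by ring
  have hxx := mul_pos hx hx'
  have hyy := mul_pos hy hy'
  constructor
  · rw [← sub_nonneg, e, hnum]
    positivity
  · intro hne
    rw [← sub_pos, e, hnum]
    apply div_pos _ hden
    by_cases h : x = x'
    · have hyne : y - y' ≠ 0 := fun h' => hne (by rw [h, sub_eq_zero.mp h'])
      have : 0 < (y - y') ^ 2 := by positivity
      positivity
    · have hxne : x - x' ≠ 0 := fun h' => h (sub_eq_zero.mp h')
      have : 0 < (x - x') ^ 2 := by positivity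
      positivity

theorem minimizer_unique {b b' : Fin 3 → ℝ} (h2 : b 2 = 2) (hw : ∀ j, 0 < C.wt b j)
    (h2' : b' 2 = 2) (hw' : ∀ j, 0 < C.wt b' j)
    (hmin : ∀ c : Fin 3 → ℝ, c 2 = 2 → (∀ j, 0 < C.wt c j) → C.vol b ≤ C.vol c)
    (hle : C.vol b' ≤ C.vol b) : b = b' := by
  by_contra hne
  have hwc : ∀ j, C.wt (fun i => (b i + b' i) / 2) j = (C.wt b j + C.wt b' j) / 2 := by
    intro j; simp only [wt]; ring
  have hc := hmin (fun i => (b i + b' i) / 2) (by simp only [h2, h2']; norm_num) (fun j => by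
    rw [hwc]; exact div_pos (add_pos (hw j) (hw' j)) two_pos)
  have hlt : 2 * C.vol (fun i => (b i + b' i) / 2) < (2 * C.vol b + 2 * C.vol b') / 2 := by
    rw [two_vol, two_vol, two_vol, ← Finset.sum_add_distrib, Finset.sum_div]
    apply Finset.sum_lt_sum
    · intro j _
      rw [hwc, hwc]
      exact (inv_mul_midpoint (hw j) (hw (j + 1)) (hw' j) (hw' (j + 1))).1
    -- One strict summand suffices: the weights of `u 0` and `u 1`, a lattice basis, determine `b`
    -- once `b 2 = 2`.
    · refine ⟨0, Finset.mem_range.mpr C.n_pos, ?_⟩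
      rw [hwc, hwc]
      refine (inv_mul_midpoint (hw 0) (hw (0 + 1)) (hw' 0) (hw' (0 + 1))).2 fun h => hne ?_
      have e0 := (Prod.mk.inj h).1
      have e1 := (Prod.mk.inj h).2
      have hd := C.det_real 0
      simp only [wt, h2, h2'] at e0 e1
      funext i
      fin_cases i
      · simp
        linear_combination (b' 0 - b 0) * hd + C.u (0 + 1) 1 * e0 - C.u 0 1 * e1
      · simp
        linear_combination (b' 1 - b 1) * hd - C.u (0 + 1) 0 * e0 + C.u 0 0 * e1
      · simp [h2, h2']
  linarith

/-- The sum in `Critical` is -2 times the derivative of `vol` at `b` in the direction `(d₀, d₁, 0)`.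
-/
lemma critical_of_min (h2 : b 2 = 2) (hw : ∀ j, 0 < C.wt b j)
    (hmin : ∀ c : Fin 3 → ℝ, c 2 = 2 → (∀ j, 0 < C.wt c j) → C.vol b ≤ C.vol c) :
    C.Critical b := by
  intro d₀ d₁
  set e : ℕ → ℝ := fun j => C.u j 0 * d₀ + C.u j 1 * d₁ with he
  let c : ℝ → Fin 3 → ℝ := fun t => ![b 0 + t * d₀, b 1 + t * d₁, 2]
  have hwt : ∀ t j, C.wt (c t) j = C.wt b j + t * e j := by
    intro t j; simp [wt, c, he, h2]; ring
  have hpos : ∀ᶠ t in 𝓝 (0 : ℝ), ∀ j ∈ Finset.range C.n, 0 < C.wt (c t) j := by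
    rw [Filter.eventually_all_finset]
    intro j _
    have : Tendsto (fun t => C.wt (c t) j) (𝓝 0) (𝓝 (C.wt b j)) := by
      simp only [hwt]
      have h := (by fun_prop : Continuous fun t : ℝ => C.wt b j + t * e j).tendsto 0
      simpa using h
    exact this.eventually (lt_mem_nhds (hw j))
  have hc0 : C.vol (c 0) = C.vol b := by
    congr 1
    funext i; fin_cases i <;> simp [c, h2]
  have hloc : IsLocalMin (fun t => C.vol (c t)) 0 := by
    filter_upwards [hpos] with t ht
    rw [hc0]
    refine hmin _ (by simp [c]) fun j => ?_
    rw [← C.wt_mod]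
    exact ht _ (Finset.mem_range.mpr (Nat.mod_lt _ C.n_pos))
  have hderiv : HasDerivAt (fun t => C.vol (c t)) (1 / 2 * ∑ j ∈ Finset.range C.n,
      -(1 / (C.wt b j * C.wt b (j + 1)) * (e j / C.wt b j + e (j + 1) / C.wt b (j + 1)))) 0 := by
    simp only [vol, leadingCoeff, hwt]
    refine HasDerivAt.const_mul _ (HasDerivAt.fun_sum fun j _ => ?_)
    have hl : ∀ j, HasDerivAt (fun t : ℝ => C.wt b j + t * e j) (e j) 0 := by
      intro j
      simpa using ((hasDerivAt_id (0 : ℝ)).mul_const (e j)).const_add (C.wt b j)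
    have hne : (C.wt b j + 0 * e j) * (C.wt b (j + 1) + 0 * e (j + 1)) ≠ 0 := by
      simpa using ⟨(hw j).ne', (hw (j + 1)).ne'⟩
    have h := ((hl j).mul (hl (j + 1))).inv hne
    have h1 := (hw j).ne'
    have h2 := (hw (j + 1)).ne'
    refine (h.congr_deriv ?_).congr_of_eventuallyEq (Eventually.of_forall fun t => ?_)
    · simp only [zero_mul, add_zero, Pi.mul_apply]
      field_simp
    · simp [one_div]
  have h0 := hloc.hasDerivAt_eq_zero hderiv
  rw [Finset.sum_neg_distrib] at h0
  linarith

lemma isVolumeMinimizing_iff : IsVolumeMinimizing C.polygon b ↔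
    (b 2 = 2 ∧ ∀ j, 0 < C.wt b j) ∧
    ∀ c : Fin 3 → ℝ, c 2 = 2 → (∀ j, 0 < C.wt c j) → C.vol b ≤ C.vol c := by
  rw [IsVolumeMinimizing, mem_reebVectors_iff]
  refine and_congr_right fun hb => ⟨?_, fun h => ?_⟩
  · rintro ⟨V, hV, hmin⟩ c hc hcw
    obtain ⟨V', hV', hle⟩ := hmin c (C.mem_reebVectors_iff.mpr ⟨hc, hcw⟩)
    rw [tendsto_nhds_unique hV (C.hasVolume hb.2 hb.1),
      tendsto_nhds_unique hV' (C.hasVolume hcw hc)] at hle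
    linarith
  · refine ⟨_, C.hasVolume hb.2 hb.1, fun c hc => ?_⟩
    obtain ⟨hc2, hcw⟩ := C.mem_reebVectors_iff.mp hc
    exact ⟨_, C.hasVolume hcw hc2, by linarith [h c hc2 hcw]⟩

theorem existsUnique_minimizing : ∃! b, IsVolumeMinimizing C.polygon b := by
  obtain ⟨b, hb, hmin⟩ := C.exists_minimizer
  refine ⟨b, C.isVolumeMinimizing_iff.mpr ⟨hb, hmin⟩, fun b' hb' => ?_⟩
  obtain ⟨hb2, hmin'⟩ := C.isVolumeMinimizing_iff.mp hb'
  exact (C.minimizer_unique hb.1 hb.2 hb2.1 hb2.2 hmin (hmin' b hb.1 hb.2)).symm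

/-- Every generator has weight at least `4/3` at the minimizing Reeb vector. -/
theorem four_thirds_le (hw : ∀ j, 0 < C.wt b j) (hb : b 2 = 2) (hc : C.Critical b)
    (m : dualMonoid C.polygon) (hm : m ≠ 0) : 4 / 3 ≤ pairing (m : Fin 3 → ℤ) b := by
  have h1 := C.one_le_of_ne_zero m hm
  by_cases h0 : (m : Fin 3 → ℤ) 0 = 0 ∧ (m : Fin 3 → ℤ) 1 = 0
  · have : pairing (m : Fin 3 → ℤ) b = 2 * (m : Fin 3 → ℤ) 2 := by
      simp [pairing, Fin.sum_univ_three, h0.1, h0.2, hb]; ring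
    rw [this]
    have : (1 : ℝ) ≤ (m : Fin 3 → ℤ) 2 := by exact_mod_cast h1
    linarith
  -- Choosing the cone that contains the negated projection of `m` makes the height at `v j` equal
  -- to `m 2 + (i + 1 + k) ≥ 2`.
  · obtain ⟨j, -, i, k, hjk⟩ := C.exists_cone ![-(m : Fin 3 → ℤ) 0, -(m : Fin 3 → ℤ) 1] (by
      intro h
      exact h0 ⟨by simpa using congrFun h 0, by simpa using congrFun h 1⟩)
    have hd : dot2 ![-(m : Fin 3 → ℤ) 0, -(m : Fin 3 → ℤ) 1] (C.v j) = -(i + 1 + k) := by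
      have hl := C.dot_left j
      have hr := C.dot_right j
      rw [hjk]
      simp [dot2] at *
      linear_combination (i + 1 : ℤ) * hl + (k : ℤ) * hr
    have hh : 2 ≤ height (m : Fin 3 → ℤ) (C.v j) := by
      simp [dot2] at hd
      rw [height]
      linarith
    have h3 := C.height_le hw hb hc (C.toReal_v_mem j) m hm
    have h4 : (2 : ℝ) ≤ height (m : Fin 3 → ℤ) (C.v j) := by exact_mod_cast hh
    linarith

end LatticeCycle

/-! ### Vertices, equality cases and the final assembly. -/

lemma toReal_injective {n : ℕ} : Function.Injective (toReal : (Fin n → ℤ) → Fin n → ℝ) := by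
  intro v w h
  ext i
  exact Int.cast_injective (congrFun h i)

lemma vertices_finite {Δ : Set (Fin 2 → ℝ)} (hΔ : IsLatticePolytope Δ) : (vertices Δ).Finite := by
  obtain ⟨V, rfl⟩ := hΔ
  refine V.finite_toSet.subset fun v hv => ?_
  obtain ⟨w, hw, hwv⟩ := extremePoints_convexHull_subset hv
  rwa [← toReal_injective hwv]

lemma mem_of_mem_vertices_triangle {A B D v : Fin 2 → ℤ} (hv : v ∈ vertices (triangle A B D)) :
    v = A ∨ v = B ∨ v = D := by
  rcases extremePoints_convexHull_subset hv with h | h | h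
  exacts [Or.inl (toReal_injective h), Or.inr (Or.inl (toReal_injective h)),
    Or.inr (Or.inr (toReal_injective h))]

namespace LatticeCycle

variable (C : LatticeCycle) {b : Fin 3 → ℝ}

/-! ### The bound and its equality cases -/

/-- Two independent polygon inequalities, those of `u j` and `u (j + 1)`, are tight at `v j`. -/
lemma v_mem_vertices (j : ℕ) : C.v j ∈ vertices C.polygon := by
  rw [vertices, Set.mem_ofPred_eq, mem_extremePoints]
  refine ⟨C.toReal_v_mem j, ?_⟩
  rintro x hx y hy ⟨s, t, hs, ht, hst, hxy⟩
  have hl : (C.u j 0 : ℝ) * C.v j 0 + C.u j 1 * C.v j 1 = -1 := by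
    exact_mod_cast C.dot_left j
  have hr : (C.u (j + 1) 0 : ℝ) * C.v j 0 + C.u (j + 1) 1 * C.v j 1 = -1 := by
    exact_mod_cast C.dot_right j
  have h0 : s * x 0 + t * y 0 = C.v j 0 := by simpa [toReal] using congrFun hxy 0
  have h1 : s * x 1 + t * y 1 = C.v j 1 := by simpa [toReal] using congrFun hxy 1
  have tight : ∀ p q : ℝ, -1 ≤ p → -1 ≤ q → s * p + t * q = -1 → p = -1 ∧ q = -1 := by
    intro p q hp hq h
    have e1 := mul_nonneg hs.le (by linarith : 0 ≤ p + 1)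
    have e2 := mul_nonneg ht.le (by linarith : 0 ≤ q + 1)
    have e3 : s * (p + 1) + t * (q + 1) = 0 := by linear_combination h + hst
    have f1 : p + 1 = 0 := (mul_eq_zero.mp (by linarith : s * (p + 1) = 0)).resolve_left hs.ne'
    have f2 : q + 1 = 0 := (mul_eq_zero.mp (by linarith : t * (q + 1) = 0)).resolve_left ht.ne'
    exact ⟨by linarith, by linarith⟩
  obtain ⟨xl, yl⟩ := tight _ _ (hx j) (hy j)
    (by linear_combination hl + C.u j 0 * h0 + C.u j 1 * h1)
  obtain ⟨xr, yr⟩ := tight _ _ (hx (j + 1)) (hy (j + 1))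
    (by linear_combination hr + C.u (j + 1) 0 * h0 + C.u (j + 1) 1 * h1)
  have hd := C.det_real j
  have uniq : ∀ z : Fin 2 → ℝ, (C.u j 0 : ℝ) * z 0 + C.u j 1 * z 1 = -1 →
      (C.u (j + 1) 0 : ℝ) * z 0 + C.u (j + 1) 1 * z 1 = -1 → z = toReal (C.v j) := by
    intro z e1 e2
    apply fin2_ext
    · simp only [toReal]
      linear_combination ((C.v j 0 : ℝ) - z 0) * hd + C.u (j + 1) 1 * (e1 - hl)
        - C.u j 1 * (e2 - hr)
    · simp only [toReal]
      linear_combination ((C.v j 1 : ℝ) - z 1) * hd - C.u (j + 1) 0 * (e1 - hl)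
        + C.u j 0 * (e2 - hr)
  exact ⟨uniq x xl xr, uniq y yl yr⟩

lemma exists_generator {u : Fin 2 → ℤ} (h : ∀ j, 0 ≤ height ![u 0, u 1, 1] (C.v j)) :
    ∃ g : generators C.polygon, (g.1 : Fin 3 → ℤ) = ![u 0, u 1, 1] := by
  refine ⟨⟨⟨![u 0, u 1, 1], (C.mem_dualMonoid_iff _).mpr h⟩, fun h0 => ?_, fun x y hxy => ?_⟩, rfl⟩
  · simpa using congrFun (congrArg Subtype.val h0) 2
  · by_contra! hne
    have hx := C.one_le_of_ne_zero x hne.1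
    have hy := C.one_le_of_ne_zero y hne.2
    have h2 : 1 = (x : Fin 3 → ℤ) 2 + (y : Fin 3 → ℤ) 2 := by
      simpa using congrFun (congrArg Subtype.val hxy) 2
    omega

/-- For a triangle all facet volumes agree, and a lattice vector with values `1, -1, -1` on the
vertices gives a generator of least weight. -/
lemma equality_of_triangle (hw : ∀ j, 0 < C.wt b j) (hb : b 2 = 2) (hc : C.Critical b)
    {A B D u : Fin 2 → ℤ} (hΔ : C.polygon = triangle A B D) (hBD : B ≠ D)
    (hA : dot2 u A = 1) (hB : dot2 u B = -1) (hD : dot2 u D = -1) :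
    (∀ α ∈ vertices C.polygon, C.facetVol b α = 2 / 3 * C.vol b) ∧
    ∃ h : generators C.polygon, pairing (h.1 : Fin 3 → ℤ) b = 4 / 3 := by
  have hv : ∀ α ∈ vertices C.polygon, α = A ∨ α = B ∨ α = D := by
    intro α hα
    rw [hΔ] at hα
    exact mem_of_mem_vertices_triangle hα
  have hAB : A ≠ B := by rintro rfl; omega
  have hAD : A ≠ D := by rintro rfl; omega
  -- Each `v j` is one of the three vertices, so the facet volumes exhaust the total; being each at
  -- most a third of it, all are equal.
  have hsum : C.facetVol b A + C.facetVol b B + C.facetVol b D = 2 * C.vol b := by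
    rw [two_vol, facetVol, facetVol, facetVol, ← Finset.sum_add_distrib, ← Finset.sum_add_distrib]
    refine Finset.sum_congr rfl fun j _ => ?_
    rcases hv _ (C.v_mem_vertices j) with h | h | h <;> rw [h]
    · simp [hAB, hAD]
    · simp [hAB.symm, hBD]
    · simp [hAD.symm, hBD.symm]
  have lA := C.facetVol_le hw hb hc A
  have lB := C.facetVol_le hw hb hc B
  have lD := C.facetVol_le hw hb hc D
  refine ⟨fun α hα => ?_, ?_⟩
  · rcases hv α hα with rfl | rfl | rfl <;> linarith
  · have hval : ∀ j, height ![u 0, u 1, 1] (C.v j) = if C.v j = A then 2 else 0 := by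
      intro j
      have hh : height ![u 0, u 1, 1] (C.v j) = dot2 u (C.v j) + 1 := by simp [height, dot2]
      rw [hh]
      rcases hv _ (C.v_mem_vertices j) with h | h | h <;> rw [h]
      · simp [hA]
      · simp [hB, hAB.symm]
      · simp [hD, hAD.symm]
    obtain ⟨g, hg⟩ := C.exists_generator (u := u) fun j => by rw [hval]; split_ifs <;> norm_num
    refine ⟨g, ?_⟩
    have hpos := C.pairing_pos hw hb g.1 g.2.1
    have hs := C.sum_height hw hb _ hpos
    rw [hg] at hs ⊢
    -- In `sum_height` only the facet of `A` contributes, with height 2. This fixes the weight of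
    -- the generator at `2 * 2/3`.
    have hs' : 2 * C.facetVol b A = C.vol b * pairing ![u 0, u 1, 1] b := by
      rw [← hs, facetVol, Finset.mul_sum]
      refine Finset.sum_congr rfl fun j _ => ?_
      rw [hval]
      split_ifs <;> simp
    have hvol := C.vol_pos hw
    have hA' : C.facetVol b A = 2 / 3 * C.vol b := by linarith
    rw [hA'] at hs'
    exact mul_left_cancel₀ hvol.ne' (by linarith)

lemma equality_of_latticeEquivalent (hw : ∀ j, 0 < C.wt b j) (hb : b 2 = 2) (hc : C.Critical b)
    {A B D u : Fin 2 → ℤ} (hΔ : LatticeEquivalent (triangle A B D) C.polygon) (hBD : B ≠ D)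
    (hA : dot2 u A = 1) (hB : dot2 u B = -1) (hD : dot2 u D = -1) :
    (∀ α ∈ vertices C.polygon, C.facetVol b α = 2 / 3 * C.vol b) ∧
    ∃ h : generators C.polygon, pairing (h.1 : Fin 3 → ℤ) b = 4 / 3 := by
  obtain ⟨G, hG⟩ := hΔ
  set M : Matrix (Fin 2) (Fin 2) ℤ := G.val with hM
  set N : Matrix (Fin 2) (Fin 2) ℤ := G⁻¹.val with hN
  have hNM : N * M = 1 := by rw [hM, hN, ← Units.val_mul, inv_mul_cancel, Units.val_one]
  have himg : ∀ p : Fin 2 → ℤ, (M.map (Int.cast : ℤ → ℝ)).mulVecLin (toReal p)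
      = toReal (M.mulVec p) := by
    intro p
    ext i
    simp [toReal, Matrix.mulVec, dotProduct]
  have hdot : ∀ p, dot2 (Matrix.vecMul u N) (M.mulVec p) = dot2 u p := by
    intro p
    have h : ∀ x y : Fin 2 → ℤ, dot2 x y = x ⬝ᵥ y := by
      intro x y; simp [dot2, dotProduct, Fin.sum_univ_two]
    rw [h, h, Matrix.dotProduct_mulVec, Matrix.vecMul_vecMul, hNM, Matrix.vecMul_one]
  refine C.equality_of_triangle hw hb hc (A := M.mulVec A) (B := M.mulVec B) (D := M.mulVec D)
    (u := Matrix.vecMul u N) ?_ (fun h => hBD ?_) ((hdot A).trans hA) ((hdot B).trans hB)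
    ((hdot D).trans hD)
  · rw [hG]
    change (M.map (Int.cast : ℤ → ℝ)).mulVecLin '' _ = _
    rw [triangle, triangle, LinearMap.image_convexHull, Set.image_insert_eq, Set.image_pair,
      himg, himg, himg]
  · have := congrArg N.mulVec h
    rwa [Matrix.mulVec_mulVec, Matrix.mulVec_mulVec, hNM, Matrix.one_mulVec,
      Matrix.one_mulVec] at this

/-- Each `u` is the vertex of the dual triangle corresponding to the edge opposite the first listed
vertex, chosen so that its value at that vertex is 1. -/
lemma equality_of_model (hw : ∀ j, 0 < C.wt b j) (hb : b 2 = 2) (hc : C.Critical b)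
    (h : LatticeEquivalent model2 C.polygon ∨ LatticeEquivalent model7 C.polygon ∨
      LatticeEquivalent model13 C.polygon) :
    (∀ α ∈ vertices C.polygon, C.facetVol b α = 2 / 3 * C.vol b) ∧
    ∃ h : generators C.polygon, pairing (h.1 : Fin 3 → ℤ) b = 4 / 3 := by
  rcases h with h | h | h
  · exact C.equality_of_latticeEquivalent hw hb hc (u := ![0, 1]) h (by decide) (by decide)
      (by decide) (by decide)
  · exact C.equality_of_latticeEquivalent hw hb hc (u := ![1, -1]) h (by decide) (by decide)
      (by decide) (by decide)
  · exact C.equality_of_latticeEquivalent hw hb hc (u := ![0, 1]) h (by decide) (by decide)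
      (by decide) (by decide)

end LatticeCycle
end ToricCY

theorem mainTheorem6 (Δ : Set (Fin 2 → ℝ)) (hΔ : IsReflexivePolygon Δ) :
    (∃! b : Fin 3 → ℝ, IsVolumeMinimizing Δ b) ∧
    ∀ b : Fin 3 → ℝ, IsVolumeMinimizing Δ b →
      ∃ (F : generators Δ → ℝ) (W : vertices Δ → ℝ) (Wmax Wmin : ℝ),
        (∀ h, HasFutaki (toricIdeal Δ) (reebWeights Δ b) (testSymmetry Δ h) (F h)) ∧
        (∀ α : vertices Δ, HasDivisorVolume Δ b α.1 (W α)) ∧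
        (∀ h α, F h ≥ 27 / 64 * W α) ∧
        IsGreatest (Set.range W) Wmax ∧ IsLeast (Set.range W) Wmin ∧
        (∀ h, F h ≥ 27 / 64 * Wmax ∧ F h ≥ 27 / 64 * Wmin) ∧
        (LatticeEquivalent model2 Δ ∨ LatticeEquivalent model7 Δ ∨ LatticeEquivalent model13 Δ →
          ∃ h, F h = 27 / 64 * Wmax ∧ F h = 27 / 64 * Wmin) := by
  have hfin := vertices_finite hΔ.1
  obtain ⟨C, rfl⟩ := hΔ.exists_cycle
  refine ⟨C.existsUnique_minimizing, fun b hbmin => ?_⟩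
  obtain ⟨⟨hb, hw⟩, hmin⟩ := C.isVolumeMinimizing_iff.mp hbmin
  have hc := C.critical_of_min hb hw hmin
  have hvol := C.vol_pos hw
  have : Finite (vertices C.polygon) := hfin
  have : Nonempty (vertices C.polygon) := ⟨⟨_, C.v_mem_vertices 0⟩⟩
  set F : generators C.polygon → ℝ :=
    fun h => C.vol b / 4 - C.vol b / (6 * pairing (h.1 : Fin 3 → ℤ) b) with hF
  set W : vertices C.polygon → ℝ := fun α => 4 / 9 * C.facetVol b α.1 with hW
  have hFW : ∀ h α, F h ≥ 27 / 64 * W α := by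
    intro h α
    have h1 := C.four_thirds_le hw hb hc h.1 h.2.1
    have h2 := C.facetVol_le hw hb hc α.1
    -- Weight at least 4/3 gives `F h ≥ vol / 4 - vol / 8 = vol / 8`, and `27/64 * 4/9 * 2/3 = 1/8`
    -- is the matching bound for the divisor volume.
    have h3 : C.vol b / (6 * pairing (h.1 : Fin 3 → ℤ) b) ≤ C.vol b / 8 :=
      div_le_div_of_nonneg_left hvol.le (by norm_num) (by linarith)
    simp only [hF, hW]
    linarith
  obtain ⟨α, hα⟩ := Finite.exists_max W
  obtain ⟨β, hβ⟩ := Finite.exists_min W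
  refine ⟨F, W, W α, W β, fun h => C.hasFutaki h hw hb,
    fun γ => C.hasDivisorVolume hw hb (extremePoints_subset γ.2), hFW,
    ⟨⟨α, rfl⟩, Set.forall_mem_range.mpr hα⟩, ⟨⟨β, rfl⟩, Set.forall_mem_range.mpr hβ⟩,
    fun h => ⟨hFW h α, hFW h β⟩, fun hmodel => ?_⟩
  obtain ⟨hfacet, h, hh⟩ := C.equality_of_model hw hb hc hmodel
  refine ⟨h, ?_, ?_⟩ <;>
  · simp only [hF, hW, hh, hfacet _ (Subtype.property _)]
    ring
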